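/- Let $T>0$, let $\Omega_0\subset\mathbb R^3$ be a bounded domain of class $C^{2+\nu}$ with $0<\nu\le 1$, and let $\mathbf V\in C^1([0,T];C^3_c(\mathbb R^3;\mathbb R^3))$. Choose $R>0$ such that $\mathbf V=0$ on $[0,T]\times\{|x|>R\}$ and $\overline{\Omega}_0\subset\{|x|<R\}$, and put $B=\{|x|<2R\}$. Let $\mathbf X$ be the flow of $\mathbf V$, $$\partial_t\mathbf X(t,x)=\mathbf V(t,\mathbf X(t,x)),\quad t\in[0,T],\qquad \mathbf X(0,x)=x,$$ and set $\Omega_\tau=\mathbf X(\tau,\Omega_0)$ and $\Gamma_\tau=\partial\Omega_\tau$, with outer unit normal $\mathbf n$. Let $\varrho_0\in L^2(\mathbb R^3)$ satisfy $\varrho_0\ge 0$ a.e. and $\varrho_0=0$ a.e. on $B\setminus\Omega_0$. Let $\varrho\in L^\infty(0,T;L^2(B))$, $\varrho\ge 0$ a.e. in $(0,T)\times B$, with $\varrho(\tau,\cdot)\in L^1(B)$ given for every $\tau\in[0,T]$, and $\mathbf u\in L^2(0,T;W^{1,2}_0(B;\mathbb R^3))$ be a weak solution of the equation of continuity, that is,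 $$\int_B\big(\varrho(\tau,\cdot)\varphi(\tau,\cdot)-\varrho_0\,\varphi(0,\cdot)\big)\,dx=\int_0^\tau\!\!\int_B\big(\varrho\,\partial_t\varphi+\varrho\,\mathbf u\cdot\nabla_x\varphi\big)\,dx\,dt$$ for every $\tau\in[0,T]$ and every $\varphi\in C^1_c([0,T]\times\mathbb R^3)$. Assume moreover that, for a.e. $\tau\in(0,T)$, $$(\mathbf u-\mathbf V)(\tau,\cdot)\cdot\mathbf n=0\quad\text{on }\Gamma_\tau\text{ in the sense of traces.}$$ Then, for every $\tau\in[0,T]$, $\varrho(\tau,\cdot)=0$ a.e. on $B\setminus\Omega_\tau$. -/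

import Mathlib

open MeasureTheory Filter Topology Set
open scoped NNReal ENNReal ContDiff Gradient

/-- The physical space with its Euclidean norm. -/
abbrev R3 := EuclideanSpace ℝ (Fin 3)

/-- A bounded domain of class `C^{2+ν}`: a bounded, nonempty, connected open set which near each
boundary point is, in suitable orthonormal coordinates `y` centred at that point, the region
`y₂ > g (y₀, y₁)` above the graph of a `C²` function `g` with `ν`-Hölder second derivative. -/
structure IsC2HolderDomain (ν : ℝ≥0) (Ω : Set R3) : Prop where
  isOpen : IsOpen Ω
  isConnected : IsConnected Ω
  isBounded : Bornology.IsBounded Ω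
  chart : ∀ x₀ ∈ frontier Ω, ∃ (r : ℝ) (e : R3 ≃ₗᵢ[ℝ] R3) (g : EuclideanSpace ℝ (Fin 2) → ℝ)
    (C : ℝ≥0), 0 < r ∧ ContDiff ℝ 2 g ∧ HolderWith C ν (iteratedFDeriv ℝ 2 g) ∧
    ∀ x ∈ Metric.ball x₀ r, (x ∈ Ω ↔ g !₂[e (x - x₀) 0, e (x - x₀) 1] < e (x - x₀) 2)

/-- `V ∈ C¹([0,T]; C³_c(ℝ³;ℝ³))` with `V(t,·) = 0` on `{|x| > R}` for all `t ∈ [0,T]`.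
`W` is the time derivative of the `C³`-valued curve `V`; limits of such curves are
uniform convergence in `x` of all spatial derivatives up to order three. -/
def IsC1C3c (T R : ℝ) (V : ℝ → R3 → R3) : Prop :=
  (∀ t ∈ Icc 0 T, ContDiff ℝ 3 (V t)) ∧
  (∀ t ∈ Icc 0 T, ∀ x, R < ‖x‖ → V t x = 0) ∧
  ∃ W : ℝ → R3 → R3, (∀ t ∈ Icc 0 T, ContDiff ℝ 3 (W t)) ∧
    ∀ k ≤ 3, ∀ t ∈ Icc 0 T,
      TendstoUniformly (fun (s : ℝ) (x : R3) =>
          (s - t)⁻¹ • (iteratedFDeriv ℝ k (V s) x - iteratedFDeriv ℝ k (V t) x))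
        (iteratedFDeriv ℝ k (W t)) (𝓝[Icc 0 T \ {t}] t) ∧
      TendstoUniformly (fun (s : ℝ) (x : R3) => iteratedFDeriv ℝ k (W s) x)
        (iteratedFDeriv ℝ k (W t)) (𝓝[Icc 0 T] t)

/-- `X` is the flow of `V` on `[0,T]`: `∂ₜ X(t,x) = V(t, X(t,x))`, `X(0,x) = x`. -/
def IsFlow (T : ℝ) (V X : ℝ → R3 → R3) : Prop :=
  ∀ x, X 0 x = x ∧
    ∀ t ∈ Icc 0 T, HasDerivWithinAt (fun s => X s x) (V t (X t x)) (Icc 0 T) t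

/-- `n` is the outer unit normal to `∂Ω` at `x`: the normalized gradient of a local `C¹` defining
function `ψ`, with `Ω = {ψ < 0}` near `x`. -/
def IsOuterUnitNormal (Ω : Set R3) (x n : R3) : Prop :=
  ∃ (U : Set R3) (ψ : R3 → ℝ), IsOpen U ∧ x ∈ U ∧ ContDiffOn ℝ 1 ψ U ∧
    (∀ y ∈ U, (y ∈ Ω ↔ ψ y < 0)) ∧ ψ x = 0 ∧ ∇ ψ x ≠ 0 ∧ n = ‖∇ ψ x‖⁻¹ • ∇ ψ x

/-- The partial derivative `∂ᵢ φ`. -/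
noncomputable def partialDeriv (i : Fin 3) (φ : R3 → R3) (x : R3) : R3 :=
  fderiv ℝ φ x (EuclideanSpace.single i 1)

/-- `φ n ∈ C^∞_c(B;ℝ³)` and `φ n → v`, `∂ᵢ φ n → G i` in `L²(B)` for `i = 0, 1, 2`. -/
def ApproxW120 (B : Set R3) (φ : ℕ → R3 → R3) (v : R3 → R3) (G : Fin 3 → R3 → R3) : Prop :=
  (∀ n, ContDiff ℝ ∞ (φ n) ∧ HasCompactSupport (φ n) ∧ tsupport (φ n) ⊆ B) ∧
  Tendsto (fun n => eLpNorm (fun x => φ n x - v x) 2 (volume.restrict B)) atTop (𝓝 0) ∧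
  ∀ i, Tendsto (fun n => eLpNorm (fun x => partialDeriv i (φ n) x - G i x) 2 (volume.restrict B))
    atTop (𝓝 0)

/-- `v ∈ W^{1,2}_0(B;ℝ³)` with weak partial derivatives `G i`: membership in the closure of `C^∞_c(B;ℝ³)` in
the `W^{1,2}` norm. -/
def MemW120 (B : Set R3) (v : R3 → R3) (G : Fin 3 → R3 → R3) : Prop :=
  MemLp v 2 (volume.restrict B) ∧ (∀ i, MemLp (G i) 2 (volume.restrict B)) ∧
    ∃ φ, ApproxW120 B φ v G

/-- `g` is the trace on the surface `Γ` of `v ∈ W^{1,2}_0(B;ℝ³)`: the `L²(Γ)` limit, with respect to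
surface (two-dimensional Hausdorff) measure, of the restrictions to `Γ` of smooth functions that
converge to `v` in `W^{1,2}(B)`. -/
def HasTrace (B Γ : Set R3) (v g : R3 → R3) : Prop :=
  MemLp g 2 ((Measure.hausdorffMeasure 2).restrict Γ) ∧
  ∃ (G : Fin 3 → R3 → R3) (φ : ℕ → R3 → R3),
    MemLp v 2 (volume.restrict B) ∧ (∀ i, MemLp (G i) 2 (volume.restrict B)) ∧ ApproxW120 B φ v G ∧
    Tendsto (fun n => eLpNorm (fun x => φ n x - g x) 2
      ((Measure.hausdorffMeasure 2).restrict Γ)) atTop (𝓝 0)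

/-- `(v - w) · n = 0` on `∂Ω` in the sense of traces, for `v ∈ W^{1,2}_0(B;ℝ³)` and continuous `w`,
where `n` is the outer normal to `∂Ω`. -/
def NormalTraceEq (B Ω : Set R3) (v w : R3 → R3) : Prop :=
  ∃ g : R3 → R3, HasTrace B (frontier Ω) v g ∧
    ∀ᵐ x ∂((Measure.hausdorffMeasure 2).restrict (frontier Ω)),
      ∀ n : R3, IsOuterUnitNormal Ω x n → inner ℝ (g x - w x) n = 0

/-- `ρ ∈ L^∞(0,T; L²(B))`. -/
def MemLinftyL2 (T : ℝ) (B : Set R3) (ρ : ℝ → R3 → ℝ) : Prop :=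
  AEStronglyMeasurable (Function.uncurry ρ)
    ((volume.restrict (Ioo 0 T)).prod (volume.restrict B)) ∧
  ∃ C : ℝ≥0, ∀ᵐ t ∂(volume.restrict (Ioo 0 T)), eLpNorm (ρ t) 2 (volume.restrict B) ≤ C

/-- `u ∈ L²(0,T; W^{1,2}_0(B;ℝ³))`. -/
def MemL2W120 (T : ℝ) (B : Set R3) (u : ℝ → R3 → R3) : Prop :=
  ∃ G : Fin 3 → ℝ → R3 → R3,
    MemLp (Function.uncurry u) 2 ((volume.restrict (Ioo 0 T)).prod (volume.restrict B)) ∧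
    (∀ i, MemLp (Function.uncurry (G i)) 2
      ((volume.restrict (Ioo 0 T)).prod (volume.restrict B))) ∧
    ∀ᵐ t ∂(volume.restrict (Ioo 0 T)), MemW120 B (u t) (fun i => G i t)

/-- Weak formulation of `∂ₜρ + div(ρu) = 0`, `ρ(0,·) = ρ₀`, for every `τ ∈ [0,T]` and every test
function in `C¹_c([0,T] × ℝ³)` (the restrictions to `[0,T] × ℝ³` of functions in `C¹_c(ℝ × ℝ³)`).
Here `fderiv ℝ φ (t, x) (1, 0) = ∂ₜφ(t,x)` and `fderiv ℝ φ (t, x) (0, v) = v · ∇ₓφ(t,x)`. -/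
def WeakContinuityEq (T : ℝ) (B : Set R3) (ρ₀ : R3 → ℝ) (ρ : ℝ → R3 → ℝ) (u : ℝ → R3 → R3) :
    Prop :=
  ∀ τ ∈ Icc 0 T, ∀ φ : ℝ × R3 → ℝ, ContDiff ℝ 1 φ → HasCompactSupport φ →
    ∫ x in B, (ρ τ x * φ (τ, x) - ρ₀ x * φ (0, x)) =
      ∫ t in (0 : ℝ)..τ, ∫ x in B,
        (ρ t x * fderiv ℝ φ (t, x) (1, 0) + ρ t x * fderiv ℝ φ (t, x) (0, u t x))

/-! ### Uniform bounds and joint continuity of the velocity field -/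

section VelocityField

variable {T R : ℝ} {V : ℝ → R3 → R3}

/-! Let `Y t` be the inverse of the flow map `X t`. Since `Y` is constant along trajectories, `(∂ₜ +
V·∇)(f ∘ Y) = 0` for every `C¹` function `f`. Testing the equation with `f ∘ Y` therefore leaves
only the relative velocity `u - V` on the right-hand side (`IsRegularFlow.fderiv_comp`). If `f`
could be the indicator of the complement of `Ω₀` and the right-hand side were zero, the integral of
`ρ τ` over `B \ Ω_τ` would equal that of `ρ₀` over `B \ Ω₀`, which vanishes, and nonnegativity of `ρ
τ` would finish the proof.

The indicator is replaced by `C¹` cutoffs that equal 1 off `Ω₀` and fall to 0 in a layer of width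
`ξ` inside `Ω₀`. Their gradient has size `1/ξ` there, but its singular part points along the
conormal of the boundary, and the conormal component of `u - V` has zero trace on `Γ_τ`. Hardy's
inequality (`BoundaryChart.exists_hardy`) bounds the `L²` norm of that component over the layer by
`C ξ` times the square root of the energy `∑ |∂ᵢu|² + |u - V|² + 1` of the layer; the summand 1
absorbs the Lipschitz constant of `V`. The factors `ξ` cancel. By Cauchy–Schwarz with `ρ t ∈ L²`,
the singular flux is at most the square root of an energy over a shrinking set, so it tends to 0 at
almost every time (`BoundaryPartition.tendsto_lintegral_flux`). The energy of all of `B` dominates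
the flux uniformly in `ξ` and is integrable in time, so the limit passes through the time integral
(`BoundaryPartition.tendsto_integral_transport`).

Three points need care. The test functions require `Y` to be `C¹` in space-time, also across the
times `0` and `T`, and Hardy's inequality requires a Lipschitz bound for its spatial differential
(`IsFlow.exists_isRegularFlow`). Hardy's inequality is first proved for smooth fields with a
boundary term kept, which disappears in the limit because the approximations converge to the trace
in `L²(Γ)`. Finally, `ρ τ ≥ 0` is given only for almost every time and is extended to every time by
continuity of the averages of `ρ` (`WeakContinuityEq.ae_nonneg`). -/

theorem iteratedFDeriv_eq_zero_of_outside {f : R3 → R3} {R : ℝ} (hf : ∀ x, R < ‖x‖ → f x = 0)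
    (k : ℕ) {x : R3} (hx : R < ‖x‖) : iteratedFDeriv ℝ k f x = 0 := by
  have h : f =ᶠ[𝓝 x] fun _ => (0 : R3) := by
    filter_upwards [(isOpen_lt continuous_const continuous_norm).mem_nhds hx] with y hy
    exact hf y hy
  have := (h.iteratedFDeriv ℝ k).eq_of_nhds
  rw [this]
  simp

/-- The difference quotients converge uniformly to the derivatives of `W t`. These are bounded,
being continuous and, as limits of zeros, zero for `‖x‖ > R`. Hence the increments are `O(|s - t|)`
uniformly in `x`. -/
theorem IsC1C3c.tendstoUniformly (hT : 0 < T) (hV : IsC1C3c T R V) {k : ℕ} (hk : k ≤ 3) {t : ℝ}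
    (ht : t ∈ Icc 0 T) :
    TendstoUniformly (fun (s : ℝ) (x : R3) => iteratedFDeriv ℝ k (V s) x)
      (iteratedFDeriv ℝ k (V t)) (𝓝[Icc 0 T] t) := by
  obtain ⟨h3, h0, W, hW3, hW⟩ := hV
  have hlim := (hW k hk t ht).1
  have hne : (𝓝[Icc 0 T \ {t}] t).NeBot := by
    exact accPt_principal_iff_nhdsWithin.1 (uniqueDiffOn_Icc hT t ht).accPt
  have hWz : ∀ x, R < ‖x‖ → iteratedFDeriv ℝ k (W t) x = 0 := by
    intro x hx
    refine tendsto_nhds_unique (hlim.tendsto_at x) ?_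
    refine tendsto_const_nhds.congr' ?_
    filter_upwards [self_mem_nhdsWithin] with s hs
    rw [iteratedFDeriv_eq_zero_of_outside (h0 s hs.1) k hx,
      iteratedFDeriv_eq_zero_of_outside (h0 t ht) k hx]
    simp
  obtain ⟨C, hC⟩ : ∃ C : ℝ, ∀ x, ‖iteratedFDeriv ℝ k (W t) x‖ ≤ C := by
    have hcont : Continuous fun x => iteratedFDeriv ℝ k (W t) x :=
      (hW3 t ht).continuous_iteratedFDeriv (by exact_mod_cast hk)
    obtain ⟨C, hC⟩ := (isCompact_closedBall (0 : R3) R).exists_bound_of_continuousOn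
      hcont.continuousOn
    refine ⟨max C 0, fun x => ?_⟩
    by_cases hx : R < ‖x‖
    · rw [hWz x hx]; simp
    · exact (hC x (by simpa using hx)).trans (le_max_left _ _)
  have hC0 : 0 ≤ C := (norm_nonneg _).trans (hC 0)
  rw [Metric.tendstoUniformly_iff] at hlim ⊢
  intro ε hε
  have h1 := hlim 1 one_pos
  rw [eventually_nhdsWithin_iff] at h1 ⊢
  have h2 : ∀ᶠ s in 𝓝 t, |s - t| < ε / (C + 1) := by
    have : 0 < ε / (C + 1) := by positivity
    filter_upwards [Metric.ball_mem_nhds t this] with s hs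
    simpa [Real.dist_eq] using hs
  filter_upwards [h1, h2] with s hs1 hs2 hs x
  by_cases hst : s = t
  · subst hst; simpa using hε
  have hst' : 0 < |s - t| := abs_pos.mpr (sub_ne_zero.mpr hst)
  have h3 := hs1 ⟨hs, hst⟩ x
  rw [dist_comm, dist_eq_norm] at h3
  have h4 : ‖(s - t)⁻¹ • (iteratedFDeriv ℝ k (V s) x - iteratedFDeriv ℝ k (V t) x)‖ ≤ C + 1 := by
    calc _ = ‖((s - t)⁻¹ • (iteratedFDeriv ℝ k (V s) x - iteratedFDeriv ℝ k (V t) x) -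
        iteratedFDeriv ℝ k (W t) x) + iteratedFDeriv ℝ k (W t) x‖ := by rw [sub_add_cancel]
      _ ≤ 1 + C := (norm_add_le _ _).trans (add_le_add h3.le (hC x))
      _ = C + 1 := add_comm _ _
  rw [norm_smul, norm_inv, Real.norm_eq_abs, inv_mul_le_iff₀ hst'] at h4
  rw [dist_comm, dist_eq_norm]
  refine h4.trans_lt ?_
  rw [lt_div_iff₀ (by positivity)] at hs2
  exact hs2

theorem IsC1C3c.continuousOn_iteratedFDeriv (hT : 0 < T) (hV : IsC1C3c T R V) {k : ℕ} (hk : k ≤ 3) :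
    ContinuousOn (fun p : ℝ × R3 => iteratedFDeriv ℝ k (V p.1) p.2) (Icc 0 T ×ˢ univ) := by
  rintro ⟨t, x⟩ ⟨ht, -⟩
  have h1 := hV.tendstoUniformly hT hk ht
  have hcont : Continuous fun x => iteratedFDeriv ℝ k (V t) x :=
      (hV.1 t ht).continuous_iteratedFDeriv (by exact_mod_cast hk)
  rw [ContinuousWithinAt, Metric.tendsto_nhds]
  intro ε hε
  rw [Metric.tendstoUniformly_iff] at h1
  have h2 := h1 (ε / 2) (half_pos hε)
  have h3 := Metric.tendsto_nhds.1 (hcont.tendsto x) (ε / 2) (half_pos hε)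
  rw [nhdsWithin_prod_eq, nhdsWithin_univ]
  filter_upwards [h2.prod_mk h3] with p hp
  have a := hp.1 p.2
  have b := hp.2
  rw [dist_comm] at a
  calc _ ≤ _ := dist_triangle _ (iteratedFDeriv ℝ k (V t) p.2) _
    _ < ε := by linarith

theorem IsC1C3c.exists_bound (hT : 0 < T) (hV : IsC1C3c T R V) {k : ℕ} (hk : k ≤ 3) :
    ∃ C : ℝ≥0, ∀ t ∈ Icc 0 T, ∀ x, ‖iteratedFDeriv ℝ k (V t) x‖ ≤ C := by
  obtain ⟨C, hC⟩ := ((isCompact_Icc (a := 0) (b := T)).prod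
    (isCompact_closedBall (0 : R3) R)).exists_bound_of_continuousOn
    ((hV.continuousOn_iteratedFDeriv hT hk).mono (prod_mono_right (subset_univ _)))
  refine ⟨C.toNNReal, fun t ht x => ?_⟩
  by_cases hx : R < ‖x‖
  · rw [iteratedFDeriv_eq_zero_of_outside (hV.2.1 t ht) k hx]; simp
  · exact (hC (t, x) ⟨ht, by simpa using hx⟩).trans (Real.le_coe_toNNReal _)

/-- The properties of the velocity field that are used for its flow. -/
structure IsRegularField (T : ℝ) (L : ℝ≥0) (V : ℝ → R3 → R3) : Prop where
  contDiff : ∀ t ∈ Icc 0 T, ContDiff ℝ 2 (V t)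
  continuousOn : ContinuousOn (fun p : ℝ × R3 => V p.1 p.2) (Icc 0 T ×ˢ univ)
  continuousOn_fderiv : ContinuousOn (fun p : ℝ × R3 => fderiv ℝ (V p.1) p.2) (Icc 0 T ×ˢ univ)
  norm_le : ∀ t ∈ Icc 0 T, ∀ x, ‖V t x‖ ≤ L
  norm_fderiv_le : ∀ t ∈ Icc 0 T, ∀ x, ‖fderiv ℝ (V t) x‖ ≤ L
  lipschitz : ∀ t ∈ Icc 0 T, LipschitzWith L (V t)
  lipschitz_fderiv : ∀ t ∈ Icc 0 T, LipschitzWith L (fderiv ℝ (V t))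

theorem IsC1C3c.exists_isRegularField (hT : 0 < T) (hV : IsC1C3c T R V) :
    ∃ L : ℝ≥0, 0 < L ∧ IsRegularField T L V := by
  obtain ⟨C0, h0⟩ := hV.exists_bound hT (k := 0) (by norm_num)
  obtain ⟨C1, h1⟩ := hV.exists_bound hT (k := 1) (by norm_num)
  obtain ⟨C2, h2⟩ := hV.exists_bound hT (k := 2) (by norm_num)
  simp only [norm_iteratedFDeriv_zero] at h0
  simp only [norm_iteratedFDeriv_one] at h1
  have h2' : ∀ t ∈ Icc 0 T, ∀ x, ‖fderiv ℝ (fderiv ℝ (V t)) x‖ ≤ C2 := by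
    intro t ht x
    rw [← norm_iteratedFDeriv_one, norm_iteratedFDeriv_fderiv]
    exact h2 t ht x
  have hc2 : ∀ t ∈ Icc 0 T, ContDiff ℝ 2 (V t) := fun t ht => (hV.1 t ht).of_le (by norm_num)
  have hd1 : ∀ t ∈ Icc 0 T, ContDiff ℝ 1 (fderiv ℝ (V t)) := fun t ht =>
    (hc2 t ht).fderiv_right (by norm_num)
  -- The entry `1` makes the bound positive; the Gronwall constant `exp (L T) / L` divides by it.
  refine ⟨max C0 (max C1 (max C2 1)), by simp, hc2, ?_, ?_, ?_, ?_, ?_, ?_⟩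
  · have := hV.continuousOn_iteratedFDeriv hT (k := 0) (by norm_num)
    have h := (continuousMultilinearCurryFin0 ℝ R3 R3).continuous.comp_continuousOn this
    refine h.congr fun p hp => ?_
    simp
  · have := hV.continuousOn_iteratedFDeriv hT (k := 1) (by norm_num)
    have h := (continuousMultilinearCurryFin1 ℝ R3 R3).continuous.comp_continuousOn this
    refine h.congr fun p hp => ?_
    ext v
    simp
  · exact fun t ht x => (h0 t ht x).trans (by exact_mod_cast le_max_left _ _)
  · exact fun t ht x => (h1 t ht x).trans (by exact_mod_cast (le_max_left _ _).trans (le_max_right _ _))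
  · intro t ht
    refine lipschitzWith_of_nnnorm_fderiv_le (𝕜 := ℝ) ((hc2 t ht).differentiable (by norm_num)) fun x => ?_
    have := h1 t ht x
    exact (show ‖fderiv ℝ (V t) x‖₊ ≤ C1 from this).trans ((le_max_left _ _).trans (le_max_right _ _))
  · intro t ht
    refine lipschitzWith_of_nnnorm_fderiv_le (𝕜 := ℝ) ((hd1 t ht).differentiable (by norm_num)) fun x => ?_
    have := h2' t ht x
    exact (show ‖fderiv ℝ (fderiv ℝ (V t)) x‖₊ ≤ C2 from this).trans
      ((le_max_left _ _).trans ((le_max_right _ _).trans (le_max_right _ _)))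

end VelocityField

/-! ### Gronwall estimates and linear differential equations -/

section ODE

variable {E : Type*} [NormedAddCommGroup E] [NormedSpace ℝ E]

theorem hasDerivWithinAt_Ici_of_Icc {f : ℝ → E} {f' : E} {a b t : ℝ} (ht : t ∈ Ico a b)
    (h : HasDerivWithinAt f f' (Icc a b) t) : HasDerivWithinAt f f' (Ici t) t :=
  h.mono_of_mem_nhdsWithin (Icc_mem_nhdsGE_of_mem ht)

theorem norm_sub_le_exp_mul_of_solutions {v : ℝ → E → E} {K : ℝ≥0} {T : ℝ} {f g : ℝ → E}
    (hv : ∀ t ∈ Icc 0 T, LipschitzWith K (v t))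
    (hf : ∀ t ∈ Icc 0 T, HasDerivWithinAt f (v t (f t)) (Icc 0 T) t)
    (hg : ∀ t ∈ Icc 0 T, HasDerivWithinAt g (v t (g t)) (Icc 0 T) t) {t : ℝ} (ht : t ∈ Icc 0 T) :
    dist (f t) (g t) ≤ dist (f 0) (g 0) * Real.exp (K * t) := by
  have := dist_le_of_trajectories_ODE_of_mem (s := fun _ => univ) (K := K) (v := v) (f := f) (g := g)
    (a := 0) (b := T) (δ := dist (f 0) (g 0))
    (fun t ht => (hv t (Ico_subset_Icc_self ht)).lipschitzOnWith)
    (fun t ht => (hf t ht).continuousWithinAt)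
    (fun t ht => hasDerivWithinAt_Ici_of_Icc ht (hf t (Ico_subset_Icc_self ht))) (by simp)
    (fun t ht => (hg t ht).continuousWithinAt)
    (fun t ht => hasDerivWithinAt_Ici_of_Icc ht (hg t (Ico_subset_Icc_self ht))) (by simp) le_rfl t ht
  simpa using this

/-- Run time backwards from `t`: `s ↦ f (t - s)` solves the equation of `-v (t - s)`, which has the
same Lipschitz constant. This gives the lower Lipschitz bound for the flow. -/
theorem norm_sub_le_exp_mul_of_solutions_reverse {v : ℝ → E → E} {K : ℝ≥0} {T : ℝ} {f g : ℝ → E}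
    (hv : ∀ t ∈ Icc 0 T, LipschitzWith K (v t))
    (hf : ∀ t ∈ Icc 0 T, HasDerivWithinAt f (v t (f t)) (Icc 0 T) t)
    (hg : ∀ t ∈ Icc 0 T, HasDerivWithinAt g (v t (g t)) (Icc 0 T) t) {t : ℝ} (ht : t ∈ Icc 0 T) :
    dist (f 0) (g 0) ≤ dist (f t) (g t) * Real.exp (K * t) := by
  have hmaps : MapsTo (fun s => t - s) (Icc 0 t) (Icc 0 T) := fun s hs =>
    ⟨by linarith [hs.2], by linarith [hs.1, ht.2]⟩
  have key : ∀ f : ℝ → E, (∀ t ∈ Icc 0 T, HasDerivWithinAt f (v t (f t)) (Icc 0 T) t) →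
      ∀ s ∈ Icc 0 t, HasDerivWithinAt (fun s => f (t - s)) (-v (t - s) (f (t - s))) (Icc 0 t) s := by
    intro f hf s hs
    have h1 : HasDerivWithinAt (fun s : ℝ => t - s) (-1) (Icc 0 t) s :=
      ((hasDerivAt_id s).const_sub t).hasDerivWithinAt
    have := HasDerivWithinAt.scomp s (hf (t - s) (hmaps hs)) h1 hmaps
    simpa [Function.comp_def] using this
  have := norm_sub_le_exp_mul_of_solutions (v := fun s z => -v (t - s) z) (K := K) (T := t)
    (f := fun s => f (t - s)) (g := fun s => g (t - s))
    (fun s hs => (hv _ (hmaps hs)).neg) (key f hf) (key g hg) (t := t) ⟨ht.1, le_rfl⟩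
  simpa using this

/-- Solutions of linear differential equations exist on the whole interval of continuity. -/
theorem exists_solution_of_linear [FiniteDimensional ℝ E] {T : ℝ} (hT : 0 ≤ T) {L : ℝ≥0}
    {A : ℝ → E →L[ℝ] E} (hA : ContinuousOn A (Icc 0 T)) (hL : ∀ t ∈ Icc 0 T, ‖A t‖ ≤ L) (x₀ : E) :
    ∃ α : ℝ → E, α 0 = x₀ ∧ ∀ t ∈ Icc 0 T, HasDerivWithinAt α (A t (α t)) (Icc 0 T) t := by
  have : CompleteSpace E := FiniteDimensional.complete ℝ E
  -- `N` exceeds the Gronwall bound for the solution. Truncating the argument of `A t` outside the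
  -- ball of radius `N` makes the field bounded, so Picard–Lindelöf reaches all of `[0, T]` at once;
  -- Gronwall's inequality then keeps the solution where the truncation is the identity.
  set N : ℝ := ‖x₀‖ * Real.exp (L * T) + 1 with hN
  have hN0 : 0 < N := by positivity
  let b : ContDiffBump (0 : E) := ⟨N, N + 1, hN0, by linarith⟩
  let G : E → E := fun z => b z • z
  have hGs : ContDiff ℝ 1 G := b.contDiff.smul contDiff_id
  have hGc : HasCompactSupport G := b.hasCompactSupport.smul_right
  obtain ⟨C, hC⟩ := hGs.lipschitzWith_of_hasCompactSupport hGc (n := 1) one_ne_zero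
  have hGb : ∀ z, ‖G z‖ ≤ N + 1 := by
    intro z
    by_cases hz : ‖z‖ < N + 1
    · calc ‖G z‖ = b z * ‖z‖ := by rw [norm_smul, Real.norm_eq_abs, abs_of_nonneg b.nonneg]
        _ ≤ 1 * ‖z‖ := by gcongr; exact b.le_one
        _ ≤ N + 1 := by linarith
    · have : b z = 0 := b.zero_of_le_dist (by simpa using not_lt.1 hz)
      simp only [G, this, zero_smul, norm_zero]; positivity
  have hGn : ∀ z, ‖G z‖ ≤ ‖z‖ := by
    intro z
    calc ‖G z‖ = b z * ‖z‖ := by rw [norm_smul, Real.norm_eq_abs, abs_of_nonneg b.nonneg]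
        _ ≤ 1 * ‖z‖ := by gcongr; exact b.le_one
        _ = ‖z‖ := one_mul _
  have hN1 : 0 ≤ N + 1 := by positivity
  have hP : IsPicardLindelof (fun t z => A t (G z)) (⟨0, left_mem_Icc.2 hT⟩ : Icc (0 : ℝ) T) x₀
      ((L : ℝ) * (N + 1) * T).toNNReal 0 (L * (N + 1).toNNReal) (L * C) := by
    refine ⟨fun t ht => ?_, fun z _ => hA.clm_apply continuousOn_const, fun t ht z _ => ?_, ?_⟩
    · refine (LipschitzWith.comp ?_ hC).lipschitzOnWith
      exact (A t).lipschitz.weaken (hL t ht)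
    · calc ‖A t (G z)‖ ≤ ‖A t‖ * ‖G z‖ := (A t).le_opNorm _
        _ ≤ L * (N + 1) := by gcongr; exacts [hL t ht, hGb z]
        _ = _ := by push_cast; rw [Real.coe_toNNReal _ hN1]
    · have h1 : 0 ≤ (L : ℝ) * (N + 1) * T := by positivity
      push_cast
      rw [Real.coe_toNNReal _ hN1, Real.coe_toNNReal _ h1]
      simp [hT]
  obtain ⟨α, hα0, hα⟩ := hP.exists_eq_forall_mem_Icc_hasDerivWithinAt₀
  refine ⟨α, hα0, fun t ht => ?_⟩
  have hbound : ‖α t‖ ≤ N := by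
    have := norm_le_gronwallBound_of_norm_deriv_right_le (f := α) (f' := fun t => A t (G (α t)))
      (δ := ‖x₀‖) (K := L) (ε := 0) (a := 0) (b := T)
      (fun t ht => (hα t ht).continuousWithinAt)
      (fun t ht => hasDerivWithinAt_Ici_of_Icc ht (hα t (Ico_subset_Icc_self ht)))
      (by rw [← hα0]) (fun t ht => ?_) t ht
    · rw [gronwallBound_ε0] at this
      refine this.trans ?_
      have h1 : Real.exp (L * (t - 0)) ≤ Real.exp (L * T) := by
        gcongr; linarith [ht.2]
      have := mul_le_mul_of_nonneg_left h1 (norm_nonneg x₀)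
      linarith
    · rw [add_zero]
      exact ((A t).le_opNorm _).trans
        (mul_le_mul (hL t (Ico_subset_Icc_self ht)) (hGn _) (norm_nonneg _) L.2)
  have h1 : G (α t) = α t := by
    have : b (α t) = 1 := b.one_of_mem_closedBall (by simpa using hbound)
    simp [G, this]
  simpa [h1] using hα t ht

/-- Gronwall's inequality for an approximate solution with zero initial value of a linear
differential equation. -/
theorem norm_le_of_linear_approx {T : ℝ} {L : ℝ≥0} (hL0 : 0 < L) {A : ℝ → E →L[ℝ] E}
    (hL : ∀ t ∈ Icc 0 T, ‖A t‖ ≤ L) {f f' : ℝ → E} (hf0 : f 0 = 0)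
    (hf : ∀ t ∈ Icc 0 T, HasDerivWithinAt f (f' t) (Icc 0 T) t) {ε : ℝ} (hε : 0 ≤ ε)
    (hb : ∀ t ∈ Icc 0 T, ‖f' t - A t (f t)‖ ≤ ε) {t : ℝ} (ht : t ∈ Icc 0 T) :
    ‖f t‖ ≤ Real.exp (L * T) / L * ε := by
  have := norm_le_gronwallBound_of_norm_deriv_right_le (f := f) (f' := f')
      (δ := 0) (K := L) (ε := ε) (a := 0) (b := T)
      (fun t ht => (hf t ht).continuousWithinAt)
      (fun t ht => hasDerivWithinAt_Ici_of_Icc ht (hf t (Ico_subset_Icc_self ht)))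
      (by simp [hf0]) (fun t ht => ?_) t ht
  · have hL0' : (0 : ℝ) < L := hL0
    rw [gronwallBound_of_K_ne_0 hL0'.ne'] at this
    refine this.trans ?_
    simp only [zero_mul, zero_add, sub_zero]
    have h1 : Real.exp (L * t) ≤ Real.exp (L * T) := by gcongr; exact ht.2
    have : ε / L * (Real.exp (L * t) - 1) ≤ ε / L * Real.exp (L * T) := by
      gcongr; linarith
    calc _ ≤ _ := this
      _ = _ := by ring
  · have ht' := Ico_subset_Icc_self ht
    calc ‖f' t‖ = ‖A t (f t) + (f' t - A t (f t))‖ := by congr 1; abel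
      _ ≤ ‖A t (f t)‖ + ‖f' t - A t (f t)‖ := norm_add_le _ _
      _ ≤ L * ‖f t‖ + ε := add_le_add (((A t).le_opNorm _).trans (by gcongr; exact hL t ht')) (hb t ht')

theorem norm_sub_sub_fderiv_le {F : Type*} [NormedAddCommGroup F] [NormedSpace ℝ F] {f : E → F}
    {L : ℝ≥0} (hf : Differentiable ℝ f)
    (hL : LipschitzWith L (fderiv ℝ f)) (a b : E) :
    ‖f b - f a - fderiv ℝ f a (b - a)‖ ≤ L * ‖b - a‖ ^ 2 := by
  have := (convex_closedBall a ‖b - a‖).norm_image_sub_le_of_norm_fderiv_le' (𝕜 := ℝ) (f := f)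
    (C := L * ‖b - a‖) (φ := fderiv ℝ f a) (x := a) (y := b) (fun x _ => hf x) (fun x hx => ?_)
    (by simp) (by simp [dist_eq_norm])
  · rw [sq, ← mul_assoc]; exact this
  · rw [← dist_eq_norm]
    refine (hL.dist_le_mul _ _).trans ?_
    gcongr
    exact hx

end ODE

/-! ### Spatial differentiability of the flow -/

/-- `J t x` solves the variational equation along the trajectory of `x`. -/
theorem IsFlow.exists_fderiv {T : ℝ} {L : ℝ≥0} {V X : ℝ → R3 → R3} (hT : 0 < T) (hL : 0 < L)
    (hV : IsRegularField T L V) (hX : IsFlow T V X) {c : ℝ≥0}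
    (hc : ∀ t ∈ Icc 0 T, LipschitzWith c (X t)) :
    ∃ J : ℝ → R3 → R3 →L[ℝ] R3, (∀ t ∈ Icc 0 T, ∀ x, HasFDerivAt (X t) (J t x) x) ∧
      (∀ x, ContinuousOn (fun t => J t x) (Icc 0 T)) ∧
      ∃ C : ℝ≥0, ∀ t ∈ Icc 0 T, LipschitzWith C (J t) := by
  have hXc : ∀ x, ContinuousOn (fun t => X t x) (Icc 0 T) := fun x t ht =>
    ((hX x).2 t ht).continuousWithinAt
  have hMc : ∀ x, ContinuousOn (fun t => fderiv ℝ (V t) (X t x)) (Icc 0 T) := fun x =>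
    hV.continuousOn_fderiv.comp (continuousOn_id.prodMk (hXc x)) fun t ht => ⟨ht, mem_univ _⟩
  have hMn : ∀ x, ∀ t ∈ Icc 0 T, ‖ContinuousLinearMap.compL ℝ R3 R3 R3 (fderiv ℝ (V t) (X t x))‖ ≤ L := by
    intro x t ht
    refine ContinuousLinearMap.opNorm_le_bound _ L.2 fun N => ?_
    exact (ContinuousLinearMap.opNorm_comp_le _ _).trans
      (mul_le_mul_of_nonneg_right (hV.norm_fderiv_le t ht _) (norm_nonneg _))
  have hex := fun x => exists_solution_of_linear (E := R3 →L[ℝ] R3) hT.le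
    (A := fun t => ContinuousLinearMap.compL ℝ R3 R3 R3 (fderiv ℝ (V t) (X t x)))
    ((ContinuousLinearMap.continuous _).comp_continuousOn (hMc x)) (hMn x)
    (ContinuousLinearMap.id ℝ R3)
  choose J hJ0 hJ using hex
  have hJv : ∀ x h, ∀ t ∈ Icc 0 T, HasDerivWithinAt (fun t => J x t h)
      (fderiv ℝ (V t) (X t x) (J x t h)) (Icc 0 T) t := by
    intro x h t ht
    simpa using (hJ x t ht).clm_apply (hasDerivWithinAt_const t (Icc 0 T) h)
  -- The linearisation error starts at zero and solves the variational equation along `x` up to the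
  -- Taylor remainder of `V s`, which is at most `L c² ‖h‖²`.
  have hquad : ∀ t ∈ Icc 0 T, ∀ x h, ‖X t (x + h) - X t x - J x t h‖ ≤
      Real.exp (L * T) / L * (L * c ^ 2) * ‖h‖ ^ 2 := by
    intro t ht x h
    have hb : ∀ s ∈ Icc 0 T, ‖V s (X s (x + h)) - V s (X s x) - fderiv ℝ (V s) (X s x) (J x s h) -
        fderiv ℝ (V s) (X s x) (X s (x + h) - X s x - J x s h)‖ ≤ L * c ^ 2 * ‖h‖ ^ 2 := by
      intro s hs
      have h1 := norm_sub_sub_fderiv_le ((hV.contDiff s hs).differentiable (by norm_num))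
        (hV.lipschitz_fderiv s hs) (X s x) (X s (x + h))
      have h2 := (hc s hs).dist_le_mul (x + h) x
      rw [dist_eq_norm, dist_eq_norm, add_sub_cancel_left] at h2
      calc _ = ‖V s (X s (x + h)) - V s (X s x) -
            fderiv ℝ (V s) (X s x) (X s (x + h) - X s x)‖ := by
              congr 1; simp only [map_sub]; abel
        _ ≤ _ := h1
        _ ≤ L * (c * ‖h‖) ^ 2 := by gcongr
        _ = _ := by ring
    have := norm_le_of_linear_approx hL (fun t ht => hV.norm_fderiv_le t ht (X t x))
      (f := fun t => X t (x + h) - X t x - J x t h) (by simp [hJ0, (hX _).1])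
      (fun s hs => (((hX (x + h)).2 s hs).sub ((hX x).2 s hs)).sub (hJv x h s hs))
      (by positivity) hb ht
    rw [mul_assoc]
    exact this
  have hder : ∀ t ∈ Icc 0 T, ∀ x, HasFDerivAt (X t) (J x t) x := by
    intro t ht x
    rw [hasFDerivAt_iff_isLittleO_nhds_zero]
    refine (Asymptotics.IsBigO.of_bound (g := fun h : R3 => ‖h‖ ^ 2)
      (Real.exp (L * T) / L * (L * c ^ 2)) (Eventually.of_forall fun h => ?_)).trans_isLittleO ?_
    · simpa using hquad t ht x h
    · simpa using (Asymptotics.isLittleO_norm_pow_id (E' := R3) one_lt_two)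
  have hJn : ∀ t ∈ Icc 0 T, ∀ x, ‖J x t‖ ≤ c := fun t ht x => (hder t ht x).le_of_lipschitz (hc t ht)
  refine ⟨fun t x => J x t, hder, fun x t ht => (hJ x t ht).continuousWithinAt,
    (Real.exp (L * T) / L * (L * c ^ 2)).toNNReal, fun t ht => ?_⟩
  refine LipschitzWith.of_dist_le_mul fun x y => ?_
  rw [dist_eq_norm]
  have := norm_le_of_linear_approx hL (hMn x) (f := fun t => J x t - J y t) (by simp [hJ0])
    (fun s hs => (hJ x s hs).sub (hJ y s hs)) (ε := L * c ^ 2 * dist x y) (by positivity)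
    (fun s hs => ?_) ht
  · calc _ ≤ _ := this
      _ = _ := by rw [Real.coe_toNNReal _ (by positivity)]; ring
  -- `J x - J y` solves the variational equation of `x` with the source `(DV(X x) - DV(X y)) ∘ J y`,
  -- where `‖J y s‖ ≤ c`.
  · have h1 : ‖fderiv ℝ (V s) (X s x) - fderiv ℝ (V s) (X s y)‖ ≤ L * (c * dist x y) := by
      rw [← dist_eq_norm]
      exact ((hV.lipschitz_fderiv s hs).dist_le_mul _ _).trans
        (mul_le_mul_of_nonneg_left ((hc s hs).dist_le_mul _ _) L.2)
    calc _ = ‖(fderiv ℝ (V s) (X s x) - fderiv ℝ (V s) (X s y)) ∘L J y s‖ := by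
            congr 1; ext v; simp
      _ ≤ _ := ContinuousLinearMap.opNorm_comp_le _ _
      _ ≤ L * (c * dist x y) * c := by gcongr; exact hJn s hs y
      _ = _ := by ring

/-! ### Inversion of a `C¹` family of maps -/

section Inverse

variable {E : Type*} [NormedAddCommGroup E] [NormedSpace ℝ E]

/-- If `f' h = 0`, then `f (x + s h) - f x` is `o(s)`, while the lower bound makes it at least a
multiple of `‖s h‖`; so `h = 0`. -/
theorem HasFDerivAt.injective_of_antilipschitz {f : E → E} {f' : E →L[ℝ] E} {x : E} {K : ℝ≥0}
    (hf : HasFDerivAt f f' x) (hK : AntilipschitzWith K f) : Function.Injective f' := by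
  rw [injective_iff_map_eq_zero]
  intro h hh
  have h1 : HasDerivAt (fun s : ℝ => f (x + s • h)) 0 0 := by
    have h2 : HasDerivAt (fun s : ℝ => x + s • h) h 0 := by
      simpa using ((hasDerivAt_id (0 : ℝ)).smul_const h).const_add x
    have := HasFDerivAt.comp_hasDerivAt (f := fun s : ℝ => x + s • h) (0 : ℝ) (l := f) (l' := f')
      (by simpa using hf) h2
    rwa [hh] at this
  rw [hasDerivAt_iff_isLittleO_nhds_zero] at h1
  have h3 : (fun s : ℝ => s • h) =O[𝓝 0] fun s => f (x + (0 + s) • h) - f (x + (0 : ℝ) • h) - s • (0 : E) := by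
    refine Asymptotics.IsBigO.of_bound K (Eventually.of_forall fun s => ?_)
    have := hK.le_mul_dist (x + s • h) x
    simpa [dist_eq_norm] using this
  have h4 := h3.trans_isLittleO h1
  by_contra hne
  have h5 := h4.def (c := ‖h‖ / 2) (by positivity)
  obtain ⟨s, hs, hs0⟩ := (((h5.filter_mono nhdsWithin_le_nhds).and self_mem_nhdsWithin) :
    ∀ᶠ s in 𝓝[≠] (0 : ℝ), _).exists
  rw [norm_smul] at hs
  have : 0 < ‖s‖ * ‖h‖ := mul_pos (norm_pos_iff.2 hs0) (norm_pos_iff.2 hne)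
  nlinarith

variable [FiniteDimensional ℝ E]

/-- A `C¹` family of maps that are uniformly bounded below has a `C¹` family of inverses. -/
theorem exists_contDiff_inverse_of_antilipschitz {f : ℝ → E → E} {K : ℝ≥0}
    (hf : ContDiff ℝ 1 (Function.uncurry f)) (hK : ∀ t, AntilipschitzWith K (f t))
    (hu : ∀ t, UniformContinuous (f t)) :
    ∃ g : ℝ → E → E, ContDiff ℝ 1 (Function.uncurry g) ∧ (∀ t x, g t (f t x) = x) ∧
      ∀ t x, f t (g t x) = x := by
  have : CompleteSpace E := FiniteDimensional.complete ℝ E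
  -- Carrying the time along turns the family into one map, and the inverse function theorem yields
  -- regularity of the inverses jointly in time and space.
  let Φ : ℝ × E → ℝ × E := fun p => (p.1, f p.1 p.2)
  have hΦ : ContDiff ℝ 1 Φ := contDiff_fst.prodMk hf
  have hequiv : ∀ p, ∃ e : (ℝ × E) ≃L[ℝ] (ℝ × E), HasStrictFDerivAt Φ (e : ℝ × E →L[ℝ] ℝ × E) p := by
    rintro ⟨t, x⟩
    have h1 : HasStrictFDerivAt (Function.uncurry f) (fderiv ℝ (Function.uncurry f) (t, x)) (t, x) :=
      hf.contDiffAt.hasStrictFDerivAt one_ne_zero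
    have h2 : HasStrictFDerivAt Φ ((ContinuousLinearMap.fst ℝ ℝ E).prod
      (fderiv ℝ (Function.uncurry f) (t, x))) (t, x) := hasStrictFDerivAt_fst.prodMk h1
    have h3 : HasFDerivAt (f t)
        ((fderiv ℝ (Function.uncurry f) (t, x)).comp (ContinuousLinearMap.inr ℝ ℝ E)) x :=
      HasFDerivAt.comp x h1.hasFDerivAt (hasFDerivAt_prodMk_right t x)
    have hinj : Function.Injective ((ContinuousLinearMap.fst ℝ ℝ E).prod
        (fderiv ℝ (Function.uncurry f) (t, x))) := by
      rw [injective_iff_map_eq_zero]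
      rintro ⟨s, h⟩ hsh
      simp only [ContinuousLinearMap.prod_apply, ContinuousLinearMap.coe_fst', Prod.mk_eq_zero] at hsh
      obtain ⟨rfl, h0⟩ := hsh
      have := (injective_iff_map_eq_zero _).1 (h3.injective_of_antilipschitz (hK t)) h
        (by simpa using h0)
      simp [this]
    let e := (LinearEquiv.ofInjectiveEndo (((ContinuousLinearMap.fst ℝ ℝ E).prod
        (fderiv ℝ (Function.uncurry f) (t, x))) : ℝ × E →ₗ[ℝ] ℝ × E) hinj).toContinuousLinearEquiv
    refine ⟨e, ?_⟩
    have he : (e : ℝ × E →L[ℝ] ℝ × E) = (ContinuousLinearMap.fst ℝ ℝ E).prod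
        (fderiv ℝ (Function.uncurry f) (t, x)) := by
      ext p <;> rfl
    rwa [he]
  have hopen : IsOpenMap Φ := isOpenMap_iff_nhds_le.2 fun p => by
    obtain ⟨e, he⟩ := hequiv p
    exact he.map_nhds_eq_of_equiv.ge
  have hinjΦ : Function.Injective Φ := by
    rintro ⟨t, x⟩ ⟨s, y⟩ h
    simp only [Φ, Prod.mk.injEq] at h
    obtain ⟨rfl, h⟩ := h
    rw [(hK t).injective h]
  -- The range is closed by the lower bound and completeness, and open because `Φ` is an open map;
  -- connectedness does the rest.
  have hsurj : ∀ t, Function.Surjective (f t) := by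
    intro t
    rw [← range_eq_univ]
    refine IsClopen.eq_univ ⟨?_, ?_⟩ (range_nonempty _)
    · exact (hK t).isClosed_range (hu t)
    · have : range (f t) = (fun x => (t, x)) ⁻¹' range Φ := by
        ext y; constructor
        · rintro ⟨x, rfl⟩; exact ⟨(t, x), rfl⟩
        · rintro ⟨⟨s, x⟩, h⟩
          simp only [Φ, Prod.mk.injEq] at h
          obtain ⟨rfl, h⟩ := h
          exact ⟨x, h⟩
      rw [this]
      exact hopen.isOpen_range.preimage (by fun_prop)
  have hsurjΦ : Function.Surjective Φ := by
    rintro ⟨t, y⟩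
    obtain ⟨x, hx⟩ := hsurj t y
    exact ⟨(t, x), by simp [Φ, hx]⟩
  let H : (ℝ × E) ≃ₜ (ℝ × E) :=
    (Equiv.ofBijective Φ ⟨hinjΦ, hsurjΦ⟩).toHomeomorphOfContinuousOpen hΦ.continuous hopen
  have hH : ∀ p, H p = Φ p := fun p => rfl
  have hsymm : ContDiff ℝ 1 H.symm := by
    rw [contDiff_iff_contDiffAt]
    intro q
    obtain ⟨e, he⟩ := hequiv (H.symm q)
    exact H.toOpenPartialHomeomorph.contDiffAt_symm (f₀' := e) (by simp) he.hasFDerivAt hΦ.contDiffAt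
  have hfst : ∀ q, (H.symm q).1 = q.1 := by
    intro q
    have := congrArg Prod.fst (H.apply_symm_apply q)
    exact this
  refine ⟨fun t x => (H.symm (t, x)).2, contDiff_snd.comp hsymm, fun t x => ?_, fun t x => ?_⟩
  · have := H.symm_apply_apply (t, x)
    have h2 : H (t, x) = (t, f t x) := rfl
    rw [h2] at this
    simp [this]
  · have := congrArg Prod.snd (H.apply_symm_apply (t, x))
    have h2 : H (H.symm (t, x)) = ((H.symm (t, x)).1, f (H.symm (t, x)).1 (H.symm (t, x)).2) := rfl
    rw [h2, hfst] at this
    exact this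

end Inverse

/-! ### Extension of the flow to all times and regularity of its inverse -/

/-- A `C¹` extension to all times of the flow of a regular field. -/
theorem IsFlow.exists_extension {T : ℝ} {L : ℝ≥0} {V X : ℝ → R3 → R3} (hT : 0 < T) (hL : 0 < L)
    (hV : IsRegularField T L V) (hX : IsFlow T V X) {c : ℝ≥0}
    (hc : ∀ t ∈ Icc 0 T, LipschitzWith c (X t)) (hc' : ∀ t ∈ Icc 0 T, AntilipschitzWith c (X t))
    {J : ℝ → R3 → R3 →L[ℝ] R3} (hJ : ∀ t ∈ Icc 0 T, ∀ x, HasFDerivAt (X t) (J t x) x)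
    (hJc : ∀ x, ContinuousOn (fun t => J t x) (Icc 0 T)) {C : ℝ≥0}
    (hJC : ∀ t ∈ Icc 0 T, LipschitzWith C (J t)) :
    ∃ Z : ℝ → R3 → R3, ContDiff ℝ 1 (Function.uncurry Z) ∧ (∀ t, UniformContinuous (Z t)) ∧
      (∀ t, AntilipschitzWith (2 * c) (Z t)) ∧ ∀ t ∈ Icc 0 T, Z t = X t := by
  set π : ℝ → ℝ := fun t => projIcc 0 T hT.le t with hπ
  have hπm : ∀ t, π t ∈ Icc 0 T := fun t => (projIcc 0 T hT.le t).2
  have hπc : Continuous π := continuous_subtype_val.comp continuous_projIcc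
  have hπe : ∀ t ∈ Icc 0 T, π t = t := fun t ht => by simp [π, projIcc_of_mem hT.le ht]
  have hπl : ∀ t ≤ 0, π t = 0 := fun t ht => by simp [π, projIcc_of_le_left hT.le ht]
  have hπr : ∀ t, T ≤ t → π t = T := fun t ht => by simp [π, projIcc_of_right_le hT.le ht]
  have hL' : (0 : ℝ) < L := hL
  -- With `δ L = 1/2` and `|a t| ≤ δ`, the correction `a t • V (π t)` added to the identity has
  -- Lipschitz constant at most `1/2`, so the antilipschitz constant of `X` at most doubles.
  set δ : ℝ := 1 / (2 * L) with hδ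
  have hδ0 : 0 < δ := by positivity
  have hδL : δ * L = 1 / 2 := by rw [hδ]; field_simp
  -- `a` vanishes on `[0, T]` and leaves either end with slope one, which matches the velocity of
  -- the flow there; the sine keeps it bounded for all times.
  set a : ℝ → ℝ := fun t => δ * Real.sin ((t - π t) / δ) with ha
  have hac : Continuous a := by fun_prop
  have hab : ∀ t, |a t| ≤ δ := fun t => by
    rw [ha, abs_mul, abs_of_pos hδ0]
    exact mul_le_of_le_one_right hδ0.le (Real.abs_sin_le_one _)
  have hXc : ∀ x, ContinuousOn (fun t => X t x) (Icc 0 T) := fun x t ht =>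
    ((hX x).2 t ht).continuousWithinAt
  have hXj : ContinuousOn (fun p : ℝ × R3 => X p.1 p.2) (Icc 0 T ×ˢ univ) :=
    continuousOn_prod_of_continuousOn_lipschitzOnWith' _ c
      (fun t ht => (hc t ht).lipschitzOnWith) fun x _ => hXc x
  have hJj : ContinuousOn (fun p : ℝ × R3 => J p.1 p.2) (Icc 0 T ×ˢ univ) :=
    continuousOn_prod_of_continuousOn_lipschitzOnWith' _ C
      (fun t ht => (hJC t ht).lipschitzOnWith) fun x _ => hJc x
  have hXπ : Continuous fun p : ℝ × R3 => X (π p.1) p.2 :=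
    hXj.comp_continuous (f := fun p : ℝ × R3 => (π p.1, p.2)) (by fun_prop)
      fun p => ⟨hπm _, mem_univ _⟩
  have hJπ : Continuous fun p : ℝ × R3 => J (π p.1) p.2 :=
    hJj.comp_continuous (f := fun p : ℝ × R3 => (π p.1, p.2)) (by fun_prop)
      fun p => ⟨hπm _, mem_univ _⟩
  have hVπ : Continuous fun p : ℝ × R3 => V (π p.1) (X (π p.1) p.2) :=
    hV.continuousOn.comp_continuous (f := fun p : ℝ × R3 => (π p.1, X (π p.1) p.2))
      ((hπc.comp continuous_fst).prodMk hXπ) fun p => ⟨hπm _, mem_univ _⟩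
  have hDVπ : Continuous fun p : ℝ × R3 => fderiv ℝ (V (π p.1)) (X (π p.1) p.2) :=
    hV.continuousOn_fderiv.comp_continuous (f := fun p : ℝ × R3 => (π p.1, X (π p.1) p.2))
      ((hπc.comp continuous_fst).prodMk hXπ) fun p => ⟨hπm _, mem_univ _⟩
  set Z : ℝ → R3 → R3 := fun t x => X (π t) x + a t • V (π t) (X (π t) x) with hZ
  set D₁ : ℝ → R3 → ℝ →L[ℝ] R3 := fun t x => ContinuousLinearMap.toSpanSingleton ℝ
    (Real.cos ((t - π t) / δ) • V (π t) (X (π t) x)) with hD₁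
  set D₂ : ℝ → R3 → R3 →L[ℝ] R3 := fun t x =>
    J (π t) x + a t • (fderiv ℝ (V (π t)) (X (π t) x) ∘L J (π t) x) with hD₂
  have hD₁c : Continuous (Function.uncurry D₁) := by
    refine (ContinuousLinearMap.toSpanSingletonCLE (𝕜 := ℝ) (E := R3)).continuous.comp ?_
    have : Continuous fun p : ℝ × R3 => Real.cos ((p.1 - π p.1) / δ) := by fun_prop
    exact this.smul hVπ
  have hD₂c : Continuous (Function.uncurry D₂) :=
    hJπ.add ((hac.comp continuous_fst).smul (hDVπ.clm_comp hJπ))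
  have hZ₂ : ∀ t x, HasFDerivAt (fun x => Z t x) (D₂ t x) x := by
    intro t x
    have h1 := hJ (π t) (hπm t) x
    have h2 : HasFDerivAt (V (π t)) (fderiv ℝ (V (π t)) (X (π t) x)) (X (π t) x) :=
      ((hV.contDiff _ (hπm t)).differentiable (by norm_num) _).hasFDerivAt
    exact h1.add ((h2.comp x h1).const_smul (a t))
  have hsin : ∀ t₀ t : ℝ, HasDerivAt (fun s => δ * Real.sin ((s - t₀) / δ))
      (Real.cos ((t - t₀) / δ)) t := by
    intro t₀ t
    have h1 : HasDerivAt (fun s : ℝ => (s - t₀) / δ) (1 / δ) t :=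
      ((hasDerivAt_id t).sub_const t₀).div_const δ
    refine (h1.sin.const_mul δ).congr_deriv ?_
    field_simp
  have hZ₁ : ∀ t x, HasDerivAt (fun s => Z s x)
      (Real.cos ((t - π t) / δ) • V (π t) (X (π t) x)) t := by
    intro t x
    -- The same derivative is verified within three closed pieces that cover the line; on a piece
    -- whose closure misses `t` the claim is vacuous.
    have hl : HasDerivWithinAt (fun s => Z s x)
        (Real.cos ((t - π t) / δ) • V (π t) (X (π t) x)) (Iic 0) t := by
      by_cases ht : t ≤ 0
      · have h1 : HasDerivWithinAt (fun s => X 0 x + (δ * Real.sin ((s - 0) / δ)) • V 0 (X 0 x))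
            (Real.cos ((t - 0) / δ) • V 0 (X 0 x)) (Iic 0) t :=
          (((hsin 0 t).smul_const _).const_add _).hasDerivWithinAt
        rw [hπl t ht]
        refine h1.congr (fun s hs => ?_) ?_
        · simp only [hZ, ha, hπl s hs]
        · simp only [hZ, ha, hπl t ht]
      · exact HasFDerivWithinAt.of_notMem_closure (by simpa using ht)
    have hr : HasDerivWithinAt (fun s => Z s x)
        (Real.cos ((t - π t) / δ) • V (π t) (X (π t) x)) (Ici T) t := by
      by_cases ht : T ≤ t
      · have h1 : HasDerivWithinAt (fun s => X T x + (δ * Real.sin ((s - T) / δ)) • V T (X T x))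
            (Real.cos ((t - T) / δ) • V T (X T x)) (Ici T) t :=
          (((hsin T t).smul_const _).const_add _).hasDerivWithinAt
        rw [hπr t ht]
        refine h1.congr (fun s hs => ?_) ?_
        · simp only [hZ, ha, hπr s hs]
        · simp only [hZ, ha, hπr t ht]
      · exact HasFDerivWithinAt.of_notMem_closure (by simpa using ht)
    have hm : HasDerivWithinAt (fun s => Z s x)
        (Real.cos ((t - π t) / δ) • V (π t) (X (π t) x)) (Icc 0 T) t := by
      by_cases ht : t ∈ Icc 0 T
      · rw [hπe t ht]
        simp only [sub_self, zero_div, Real.cos_zero, one_smul]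
        refine ((hX x).2 t ht).congr (fun s hs => ?_) ?_
        · simp [hZ, ha, hπe s hs]
        · simp [hZ, ha, hπe t ht]
      · exact HasFDerivWithinAt.of_notMem_closure (by simpa [isClosed_Icc.closure_eq] using ht)
    have hu : Iic 0 ∪ (Icc 0 T ∪ Ici T) = univ := by
      ext s; simp only [mem_union, mem_Iic, mem_Icc, mem_Ici, mem_univ, iff_true]
      by_cases h0 : s ≤ 0
      · exact Or.inl h0
      · by_cases h1 : s ≤ T
        · exact Or.inr (Or.inl ⟨(not_le.1 h0).le, h1⟩)
        · exact Or.inr (Or.inr (not_le.1 h1).le)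
    have := hl.union (hm.union hr)
    rwa [hu, hasDerivWithinAt_univ] at this
  have hstrict : ∀ p : ℝ × R3, HasStrictFDerivAt (Function.uncurry Z)
      ((D₁ p.1 p.2).coprod (D₂ p.1 p.2)) p := fun p =>
    hasStrictFDerivAt_uncurry_coprod (f := Z) (f₁ := D₁) (f₂ := D₂) (u := p)
      (Eventually.of_forall fun v => (hZ₁ v.1 v.2).hasFDerivAt)
      (Eventually.of_forall fun v => hZ₂ v.1 v.2) hD₁c.continuousAt hD₂c.continuousAt
  refine ⟨Z, ?_, ?_, ?_, ?_⟩
  · rw [contDiff_one_iff_fderiv]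
    refine ⟨fun p => (hstrict p).hasFDerivAt.differentiableAt, ?_⟩
    have : fderiv ℝ (Function.uncurry Z) = fun p : ℝ × R3 => (D₁ p.1 p.2).coprod (D₂ p.1 p.2) := by
      ext1 p; exact (hstrict p).hasFDerivAt.fderiv
    rw [this]
    exact ((ContinuousLinearMap.coprodEquivL ℝ :
      ((ℝ →L[ℝ] R3) × (R3 →L[ℝ] R3)) ≃L[ℝ] (ℝ × R3 →L[ℝ] R3)).continuous.comp (hD₁c.prodMk hD₂c))
  · intro t
    have h1 := hc _ (hπm t)
    have h2 : LipschitzWith (‖a t‖₊ * (L * c)) (fun x => a t • V (π t) (X (π t) x)) :=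
      (lipschitzWith_smul (a t)).comp ((hV.lipschitz _ (hπm t)).comp h1)
    exact (h1.add h2).uniformContinuous
  · intro t
    refine AntilipschitzWith.of_le_mul_dist fun x y => ?_
    have h1 := (hc' _ (hπm t)).le_mul_dist x y
    have h2 := (hV.lipschitz _ (hπm t)).dist_le_mul (X (π t) x) (X (π t) y)
    rw [dist_eq_norm (V _ _)] at h2
    have h3 : dist (X (π t) x) (X (π t) y) ≤ 2 * dist (Z t x) (Z t y) := by
      rw [dist_eq_norm, dist_eq_norm] at *
      have e1 : X (π t) x - X (π t) y = (Z t x - Z t y) -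
          a t • (V (π t) (X (π t) x) - V (π t) (X (π t) y)) := by
        simp only [hZ, smul_sub]; abel
      have e2 : ‖a t • (V (π t) (X (π t) x) - V (π t) (X (π t) y))‖ ≤
          1 / 2 * ‖X (π t) x - X (π t) y‖ := by
        rw [norm_smul, ← hδL, mul_assoc]
        exact mul_le_mul (hab t) h2 (norm_nonneg _) hδ0.le
      have e3 := norm_sub_le (Z t x - Z t y) (a t • (V (π t) (X (π t) x) - V (π t) (X (π t) y)))
      rw [← e1] at e3
      linarith
    push_cast
    nlinarith [c.2]
  · intro t ht
    ext1 x
    simp [hZ, ha, hπe t ht]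

/-- Uniform bounds for the flow `X` of `V` on `[0,T]` and its spatial inverse `Y`. -/
structure IsRegularFlow (T : ℝ) (K : ℝ≥0) (V X Y : ℝ → R3 → R3) : Prop where
  contDiff_inv : ContDiff ℝ 1 (Function.uncurry Y)
  left_inv : ∀ t ∈ Icc 0 T, ∀ x, Y t (X t x) = x
  right_inv : ∀ t ∈ Icc 0 T, ∀ x, X t (Y t x) = x
  contDiff : ∀ t ∈ Icc 0 T, ContDiff ℝ 1 (X t)
  lipschitz : ∀ t ∈ Icc 0 T, LipschitzWith K (X t)
  lipschitz_inv : ∀ t ∈ Icc 0 T, LipschitzWith K (Y t)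
  lipschitz_fderiv_inv : ∀ t ∈ Icc 0 T, LipschitzWith K (fderiv ℝ (Y t))
  transport : ∀ t ∈ Icc 0 T, ∀ x, fderiv ℝ (Function.uncurry Y) (t, x) (1, V t x) = 0

/-- Gronwall in both time directions makes `X t` bi-Lipschitz. Inverting the extended flow rather
than `X` itself makes `Y` of class `C¹` on all of space-time, as the test functions demand. -/
theorem IsFlow.exists_isRegularFlow {T : ℝ} {L : ℝ≥0} {V X : ℝ → R3 → R3} (hT : 0 < T) (hL : 0 < L)
    (hV : IsRegularField T L V) (hX : IsFlow T V X) : ∃ K Y, IsRegularFlow T K V X Y := by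
  set c : ℝ≥0 := (Real.exp (L * T)).toNNReal with hcdef
  have hcc : (c : ℝ) = Real.exp (L * T) := Real.coe_toNNReal _ (Real.exp_pos _).le
  have hexp : ∀ t ∈ Icc 0 T, Real.exp (L * t) ≤ c := by
    intro t ht; rw [hcc]; gcongr; exact ht.2
  have hc : ∀ t ∈ Icc 0 T, LipschitzWith c (X t) := fun t ht => by
    refine LipschitzWith.of_dist_le_mul fun x y => ?_
    have := norm_sub_le_exp_mul_of_solutions hV.lipschitz (hX x).2 (hX y).2 ht
    rw [(hX x).1, (hX y).1] at this
    rw [mul_comm]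
    exact this.trans (by gcongr; exact hexp t ht)
  have hc' : ∀ t ∈ Icc 0 T, AntilipschitzWith c (X t) := fun t ht => by
    refine AntilipschitzWith.of_le_mul_dist fun x y => ?_
    have := norm_sub_le_exp_mul_of_solutions_reverse hV.lipschitz (hX x).2 (hX y).2 ht
    rw [(hX x).1, (hX y).1] at this
    rw [mul_comm]
    exact this.trans (by gcongr; exact hexp t ht)
  obtain ⟨J, hJ, hJc, C, hJC⟩ := hX.exists_fderiv hT hL hV hc
  obtain ⟨Z, hZ, hZu, hZa, hZX⟩ := hX.exists_extension hT hL hV hc hc' hJ hJc hJC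
  obtain ⟨Y, hY, hYl, hYr⟩ := exists_contDiff_inverse_of_antilipschitz hZ hZa hZu
  have hYt : ∀ t, ContDiff ℝ 1 (Y t) := fun t => hY.comp (contDiff_const.prodMk contDiff_id)
  have hleft : ∀ t ∈ Icc 0 T, ∀ x, Y t (X t x) = x := fun t ht x => by
    rw [← hZX t ht]; exact hYl t x
  have hright : ∀ t ∈ Icc 0 T, ∀ x, X t (Y t x) = x := fun t ht x => by
    rw [← hZX t ht]; exact hYr t x
  have hYLip : ∀ t ∈ Icc 0 T, LipschitzWith c (Y t) := fun t ht =>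
    (hc' t ht).to_rightInverse (hright t ht)
  have hDY : ∀ t ∈ Icc 0 T, ∀ x, HasFDerivAt (Y t) (fderiv ℝ (Y t) x) x := fun t _ x =>
    ((hYt t).differentiable one_ne_zero x).hasFDerivAt
  have hDYn : ∀ t ∈ Icc 0 T, ∀ x, ‖fderiv ℝ (Y t) x‖ ≤ c := fun t ht x =>
    norm_fderiv_le_of_lipschitz ℝ (hYLip t ht)
  have hlinv : ∀ t ∈ Icc 0 T, ∀ x, fderiv ℝ (Y t) x ∘L J t (Y t x) = ContinuousLinearMap.id ℝ R3 := by
    intro t ht x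
    have h1 := hJ t ht (Y t x)
    have h2 := hDY t ht (X t (Y t x))
    have h3 := h2.comp (Y t x) h1
    have h4 : Y t ∘ X t = id := by ext1 y; exact hleft t ht y
    rw [h4, hright t ht] at h3
    exact h3.unique (hasFDerivAt_id _)
  have hrinv : ∀ t ∈ Icc 0 T, ∀ x, J t (Y t x) ∘L fderiv ℝ (Y t) x = ContinuousLinearMap.id ℝ R3 := by
    intro t ht x
    have h3 := (hJ t ht (Y t x)).comp x (hDY t ht x)
    have h4 : X t ∘ Y t = id := by ext1 y; exact hright t ht y
    rw [h4] at h3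
    exact h3.unique (hasFDerivAt_id _)
  have hDYlip : ∀ t ∈ Icc 0 T, LipschitzWith (c * (C * c) * c) (fderiv ℝ (Y t)) := by
    intro t ht
    refine LipschitzWith.of_dist_le_mul fun x y => ?_
    -- The identity `A⁻¹ - B⁻¹ = A⁻¹ (B - A) B⁻¹` transfers the Lipschitz bound from `J t` to its
    -- inverse.
    have e : fderiv ℝ (Y t) x - fderiv ℝ (Y t) y =
        fderiv ℝ (Y t) x ∘L (J t (Y t y) - J t (Y t x)) ∘L fderiv ℝ (Y t) y := by
      rw [ContinuousLinearMap.sub_comp, ContinuousLinearMap.comp_sub, hrinv t ht y,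
        ← ContinuousLinearMap.comp_assoc, hlinv t ht x]
      ext v; simp
    rw [dist_eq_norm, e]
    calc _ ≤ ‖fderiv ℝ (Y t) x‖ * (‖J t (Y t y) - J t (Y t x)‖ * ‖fderiv ℝ (Y t) y‖) :=
          (ContinuousLinearMap.opNorm_comp_le _ _).trans (by
            gcongr; exact ContinuousLinearMap.opNorm_comp_le _ _)
      _ ≤ c * ((C * (c * dist x y)) * c) := by
          gcongr
          · exact hDYn t ht x
          · rw [← dist_eq_norm, dist_comm]
            exact ((hJC t ht).dist_le_mul _ _).trans
              (mul_le_mul_of_nonneg_left ((hYLip t ht).dist_le_mul _ _) C.2)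
          · exact hDYn t ht y
      _ = _ := by push_cast; ring
  refine ⟨max c (c * (C * c) * c), Y, hY, hleft, hright, fun t ht => ?_,
    fun t ht => (hc t ht).weaken (le_max_left _ _), fun t ht => (hYLip t ht).weaken (le_max_left _ _),
    fun t ht => (hDYlip t ht).weaken (le_max_right _ _), fun t ht x => ?_⟩
  · rw [← hZX t ht]
    exact hZ.comp (contDiff_const.prodMk contDiff_id)
  -- Differentiate `Y s (X s y) = y` in `s` within `[0, T]`; derivatives within the interval are
  -- unique even at its ends.
  · obtain ⟨y, rfl⟩ : ∃ y, X t y = x := ⟨Y t x, hright t ht x⟩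
    have h1 : HasDerivWithinAt (fun s => (s, X s y)) ((1 : ℝ), V t (X t y)) (Icc 0 T) t :=
      (hasDerivWithinAt_id t _).prodMk ((hX y).2 t ht)
    have h2 : HasFDerivAt (Function.uncurry Y) (fderiv ℝ (Function.uncurry Y) (t, X t y)) (t, X t y) :=
      (hY.differentiable one_ne_zero _).hasFDerivAt
    have h3 := h2.comp_hasDerivWithinAt t h1
    have h4 : HasDerivWithinAt (Function.uncurry Y ∘ fun s => (s, X s y)) 0 (Icc 0 T) t :=
      (hasDerivWithinAt_const t _ y).congr (fun s hs => hleft s hs y) (hleft t ht y)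
    exact (uniqueDiffOn_Icc hT t ht).eq_deriv _ h3 h4

/-- Trajectories that leave the support of the velocity field are stationary. -/
theorem IsFlow.eq_self_or_norm_le {T R : ℝ} {L : ℝ≥0} {V X : ℝ → R3 → R3}
    (hV : ∀ t ∈ Icc 0 T, LipschitzWith L (V t)) (h0 : ∀ t ∈ Icc 0 T, ∀ x, R < ‖x‖ → V t x = 0)
    (hX : IsFlow T V X) {t : ℝ} (ht : t ∈ Icc 0 T) (x : R3) : X t x = x ∨ ‖X t x‖ ≤ R := by
  by_cases hR : ‖X t x‖ ≤ R
  · exact Or.inr hR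
  left
  -- The constant curve at `X t x` is a solution that meets the trajectory at time `t`; the backward
  -- estimate makes the two agree at time 0.
  have hconst : ∀ s ∈ Icc 0 T, HasDerivWithinAt (fun _ : ℝ => X t x) (V s (X t x)) (Icc 0 T) s := by
    intro s hs
    rw [h0 s hs _ (not_le.1 hR)]
    exact hasDerivWithinAt_const _ _ _
  have := norm_sub_le_exp_mul_of_solutions_reverse hV (hX x).2 hconst ht
  simp only [dist_self, zero_mul] at this
  rw [(hX x).1] at this
  exact (dist_le_zero.1 this).symm

/-! ### Geometry of boundary charts -/

/-- A local graph representation of the boundary of `Ω`. -/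
structure BoundaryChart (Ω : Set R3) where
  center : R3
  radius : ℝ
  frame : R3 ≃ₗᵢ[ℝ] R3
  graph : EuclideanSpace ℝ (Fin 2) → ℝ
  radius_pos : 0 < radius
  contDiff_graph : ContDiff ℝ 2 graph
  mem_iff : ∀ x ∈ Metric.ball center radius,
    (x ∈ Ω ↔ graph !₂[frame (x - center) 0, frame (x - center) 1] < frame (x - center) 2)

namespace BoundaryChart

variable {Ω : Set R3} (c : BoundaryChart Ω)

/-- The height over the graph. -/
noncomputable def height (x : R3) : ℝ :=
  c.frame (x - c.center) 2 - c.graph !₂[c.frame (x - c.center) 0, c.frame (x - c.center) 1]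

/-- The horizontal coordinates. -/
noncomputable def proj (x : R3) : Fin 2 → ℝ :=
  ![c.frame (x - c.center) 0, c.frame (x - c.center) 1]

/-- The point with horizontal coordinates `y` and height `s`. -/
noncomputable def param (y : Fin 2 → ℝ) (s : ℝ) : R3 :=
  c.center + c.frame.symm !₂[y 0, y 1, c.graph !₂[y 0, y 1] + s]

/-- The vertical unit vector. -/
noncomputable def vertical : R3 := c.frame.symm (EuclideanSpace.single 2 1)

theorem mem_iff_height {x : R3} (hx : x ∈ Metric.ball c.center c.radius) :
    x ∈ Ω ↔ 0 < c.height x := by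
  rw [c.mem_iff x hx, height, sub_pos]

theorem height_param (y : Fin 2 → ℝ) (s : ℝ) : c.height (c.param y s) = s := by
  simp [height, param]

theorem proj_param (y : Fin 2 → ℝ) (s : ℝ) : c.proj (c.param y s) = y := by
  ext i
  fin_cases i <;> simp [proj, param]

theorem param_proj_height (x : R3) : c.param (c.proj x) (c.height x) = x := by
  have : (!₂[c.proj x 0, c.proj x 1, c.graph !₂[c.proj x 0, c.proj x 1] + c.height x] : R3) =
      c.frame (x - c.center) := by
    ext i
    fin_cases i <;> simp [proj, height]
  rw [param, this]
  simp

theorem norm_vertical : ‖c.vertical‖ = 1 := by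
  simp [vertical]

theorem param_eq_add (y : Fin 2 → ℝ) (s : ℝ) : c.param y s = c.param y 0 + s • c.vertical := by
  have : (!₂[y 0, y 1, c.graph !₂[y 0, y 1] + s] : R3) =
      !₂[y 0, y 1, c.graph !₂[y 0, y 1] + 0] + s • EuclideanSpace.single 2 1 := by
    ext i
    fin_cases i <;> simp
  rw [param, param, vertical, this, map_add, map_smul, add_assoc]

theorem contDiff_height : ContDiff ℝ 2 c.height := by
  have h0 : ContDiff ℝ 2 fun x : R3 => c.frame (x - c.center) :=
    c.frame.contDiff.comp (contDiff_id.sub contDiff_const)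
  have hi : ∀ i, ContDiff ℝ 2 fun x : R3 => c.frame (x - c.center) i := fun i =>
    (contDiff_euclidean.1 h0) i
  refine (hi 2).sub (c.contDiff_graph.comp ?_)
  rw [contDiff_euclidean]
  intro i
  fin_cases i
  · exact hi 0
  · exact hi 1

theorem lipschitz_proj : LipschitzWith 1 c.proj := by
  refine LipschitzWith.of_dist_le_mul fun x y => ?_
  rw [NNReal.coe_one, one_mul, dist_pi_le_iff dist_nonneg]
  have key : ∀ i, dist (c.frame (x - c.center) i) (c.frame (y - c.center) i) ≤ dist x y := by
    intro i
    have := PiLp.norm_apply_le (c.frame (x - c.center) - c.frame (y - c.center)) i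
    rw [← map_sub, c.frame.norm_map] at this
    rw [dist_eq_norm, dist_eq_norm]
    simpa using this
  intro i
  fin_cases i
  · exact key 0
  · exact key 1

theorem continuous_param : Continuous fun p : (Fin 2 → ℝ) × ℝ => c.param p.1 p.2 := by
  have hg := c.contDiff_graph.continuous
  unfold param
  refine continuous_const.add (c.frame.symm.continuous.comp ?_)
  have h2 : Continuous fun p : (Fin 2 → ℝ) × ℝ => (!₂[p.1 0, p.1 1] : EuclideanSpace ℝ (Fin 2)) := by
    refine (PiLp.continuous_toLp 2 _).comp (continuous_pi fun i => ?_)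
    fin_cases i <;> simp <;> fun_prop
  refine (PiLp.continuous_toLp 2 _).comp (continuous_pi fun i => ?_)
  fin_cases i
  · simp; fun_prop
  · simp; fun_prop
  · exact (hg.comp h2).add continuous_snd

/-- The map is a vertical shear followed by a permutation of coordinates and a rigid motion, so
Fubini's theorem in a chart carries no Jacobian. -/
theorem measurePreserving_param :
    MeasurePreserving (fun p : (Fin 2 → ℝ) × ℝ => c.param p.1 p.2) := by
  have hg := c.contDiff_graph.continuous
  have h2 : Continuous fun y : Fin 2 → ℝ => (!₂[y 0, y 1] : EuclideanSpace ℝ (Fin 2)) := by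
    refine (PiLp.continuous_toLp 2 _).comp (continuous_pi fun i => ?_)
    fin_cases i <;> simp <;> fun_prop
  have hshear : MeasurePreserving (fun p : (Fin 2 → ℝ) × ℝ => (p.1, c.graph !₂[p.1 0, p.1 1] + p.2))
      (volume.prod volume) (volume.prod volume) := by
    refine (MeasurePreserving.id volume).skew_product
      (g := fun (y : Fin 2 → ℝ) (s : ℝ) => c.graph !₂[y 0, y 1] + s) ?_ ?_
    · exact (((hg.comp h2).comp continuous_fst).add continuous_snd).measurable
    · exact Eventually.of_forall fun y => map_add_left_eq_self _ _
  have hswap : MeasurePreserving (Prod.swap : (Fin 2 → ℝ) × ℝ → ℝ × (Fin 2 → ℝ))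
      (volume.prod volume) (volume.prod volume) := Measure.measurePreserving_swap
  have hpi := (volume_preserving_piFinSuccAbove (fun _ : Fin 3 => ℝ) 2).symm
  have htoLp := EuclideanSpace.volume_preserving_symm_measurableEquiv_toLp (Fin 3) |>.symm
  have hframe := c.frame.symm.measurePreserving
  have hadd : MeasurePreserving (fun x : R3 => c.center + x) := measurePreserving_add_left _ _
  have := hadd.comp (hframe.comp (htoLp.comp (hpi.comp (hswap.comp hshear))))
  convert this using 1
  · ext1 p
    simp only [param, Function.comp]
    congr 2
    ext i
    fin_cases i <;> rfl
  · rfl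

theorem isOpen_ball_base : IsOpen {y : Fin 2 → ℝ | c.param y 0 ∈ Metric.ball c.center c.radius} :=
  Metric.isOpen_ball.preimage (c.continuous_param.comp (continuous_id.prodMk continuous_const))

theorem param_mem_frontier {y : Fin 2 → ℝ} (hy : c.param y 0 ∈ Metric.ball c.center c.radius) :
    c.param y 0 ∈ frontier Ω := by
  have hnot : c.param y 0 ∉ Ω := by
    rw [c.mem_iff_height hy, height_param]; exact lt_irrefl _
  refine ⟨?_, fun h => hnot (interior_subset h)⟩
  have hcont : Continuous fun s : ℝ => c.param y s :=
    c.continuous_param.comp (continuous_const.prodMk continuous_id)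
  have h1 : Tendsto (fun s : ℝ => c.param y s) (𝓝[>] 0) (𝓝 (c.param y 0)) :=
    (hcont.tendsto 0).mono_left nhdsWithin_le_nhds
  refine mem_closure_of_tendsto h1 ?_
  filter_upwards [h1.eventually (Metric.isOpen_ball.mem_nhds hy), self_mem_nhdsWithin] with s hs hs0
  rw [c.mem_iff_height hs, height_param]
  exact hs0

/-- Along a vertical line the height is the parameter itself. This is what makes the conormal
nonzero. -/
theorem fderiv_height_vertical (x : R3) : fderiv ℝ c.height x c.vertical = 1 := by
  have h1 : HasFDerivAt c.height (fderiv ℝ c.height x) (c.param (c.proj x) (c.height x)) := by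
    rw [c.param_proj_height]
    exact (c.contDiff_height.differentiable (by norm_num) x).hasFDerivAt
  have h2 : HasDerivAt (fun s => c.param (c.proj x) s) c.vertical (c.height x) := by
    have : (fun s => c.param (c.proj x) s) = fun s => c.param (c.proj x) 0 + s • c.vertical := by
      ext1 s; exact c.param_eq_add _ _
    rw [this]
    simpa using ((hasDerivAt_id (c.height x)).smul_const c.vertical).const_add (c.param (c.proj x) 0)
  have h3 := h1.comp_hasDerivAt _ h2
  have h4 : (c.height ∘ fun s => c.param (c.proj x) s) = id := by
    ext1 s; exact c.height_param _ _
  rw [h4] at h3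
  exact h3.unique (hasDerivAt_id _)

/-- Bounds for the differential of the height near the chart. -/
theorem exists_bound_fderiv_height : ∃ A : ℝ≥0,
    (∀ x ∈ Metric.closedBall c.center (c.radius + 1), ‖fderiv ℝ c.height x‖ ≤ A) ∧
    ∀ x ∈ Metric.closedBall c.center (c.radius + 1),
      ∀ y ∈ Metric.closedBall c.center (c.radius + 1),
        ‖fderiv ℝ c.height x - fderiv ℝ c.height y‖ ≤ A * ‖x - y‖ := by
  have h1 : ContDiff ℝ 1 (fderiv ℝ c.height) := c.contDiff_height.fderiv_right (by norm_num)
  obtain ⟨A₁, hA₁⟩ := (isCompact_closedBall c.center (c.radius + 1)).exists_bound_of_continuousOn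
    h1.continuous.continuousOn
  obtain ⟨A₂, hA₂⟩ := (isCompact_closedBall c.center (c.radius + 1)).exists_bound_of_continuousOn
    (h1.continuous_fderiv one_ne_zero).continuousOn
  refine ⟨(max A₁ A₂).toNNReal, fun x hx => ?_, fun x hx y hy => ?_⟩
  · exact (hA₁ x hx).trans ((le_max_left _ _).trans (Real.le_coe_toNNReal _))
  · refine (convex_closedBall _ _).norm_image_sub_le_of_norm_fderiv_le (𝕜 := ℝ)
      (fun z _ => h1.differentiable one_ne_zero z) (fun z hz => ?_) hy hx
    exact (hA₂ z hz).trans ((le_max_right _ _).trans (Real.le_coe_toNNReal _))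

end BoundaryChart

/-! ### Change of variables by Lipschitz bounds -/

section Pushforward

/-- Volume is a multiple of three-dimensional Hausdorff measure, as both are translation invariant,
and Hausdorff measure scales by `K ^ 3`. One-sided bounds of this kind suffice throughout, so no
Jacobian determinant is needed. -/
theorem volume_image_le_of_lipschitz {K : ℝ≥0} {f : R3 → R3} (hf : LipschitzWith K f) (s : Set R3) :
    volume (f '' s) ≤ (K : ℝ≥0∞) ^ 3 * volume s := by
  have h := Measure.isAddLeftInvariant_eq_smul (volume : Measure R3)
    (μH[(Module.finrank ℝ R3 : ℕ)] : Measure R3)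
  rw [h]
  simp only [Measure.smul_apply]
  have := hf.hausdorffMeasure_image_le (d := (Module.finrank ℝ R3 : ℕ)) (by positivity) s
  rw [ENNReal.rpow_natCast] at this
  have e : Module.finrank ℝ R3 = 3 := by simp
  have e3 : (K : ℝ≥0∞) ^ Module.finrank ℝ R3 = (K : ℝ≥0∞) ^ 3 := by rw [e]
  rw [e3] at this
  rw [ENNReal.smul_def, ENNReal.smul_def, smul_eq_mul, smul_eq_mul, mul_left_comm]
  gcongr

theorem map_volume_le_of_lipschitz {K : ℝ≥0} {f g : R3 → R3} (hf : LipschitzWith K f)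
    (hg : Measurable g) (hgf : ∀ x, g (f x) = x) (hfg : ∀ x, f (g x) = x) :
    Measure.map g volume ≤ ((K : ℝ≥0∞) ^ 3) • (volume : Measure R3) := by
  refine Measure.le_iff.2 fun s hs => ?_
  rw [Measure.map_apply hg hs]
  have : g ⁻¹' s = f '' s := by
    ext x; constructor
    · exact fun hx => ⟨g x, hx, hfg x⟩
    · rintro ⟨y, hy, rfl⟩; simpa [hgf] using hy
  rw [this]
  exact volume_image_le_of_lipschitz hf s

theorem lintegral_comp_le_of_lipschitz {K : ℝ≥0} {f g : R3 → R3} (hf : LipschitzWith K f)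
    (hg : Measurable g) (hgf : ∀ x, g (f x) = x) (hfg : ∀ x, f (g x) = x) {F : R3 → ℝ≥0∞}
    (hF : Measurable F) : ∫⁻ x, F (g x) ≤ (K : ℝ≥0∞) ^ 3 * ∫⁻ x, F x := by
  rw [← lintegral_map hF hg]
  calc _ ≤ ∫⁻ x, F x ∂(((K : ℝ≥0∞) ^ 3) • (volume : Measure R3)) :=
        lintegral_mono' (map_volume_le_of_lipschitz hf hg hgf hfg) le_rfl
    _ = _ := by rw [lintegral_smul_measure, smul_eq_mul]

/-- The parametrisation `β` has the Lipschitz left inverse `P`, so parameter area is at most `K ^ 2`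
times surface area. This is the direction that carries `L²(Γ)` convergence to the base. The sup norm
on `Fin 2 → ℝ` makes Hausdorff measure equal to Lebesgue measure exactly. -/
theorem map_restrict_le_hausdorffMeasure {K : ℝ≥0} {P : R3 → Fin 2 → ℝ} (hP : LipschitzWith K P)
    {β : (Fin 2 → ℝ) → R3} (hβ : Measurable β) {D : Set (Fin 2 → ℝ)} {Γ : Set R3} (hβD : ∀ y ∈ D, β y ∈ Γ) (hPβ : ∀ y, P (β y) = y) :
    Measure.map β (volume.restrict D) ≤ ((K : ℝ≥0∞) ^ 2) • (μH[2] : Measure R3).restrict Γ := by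
  refine Measure.le_iff.2 fun s hs => ?_
  rw [Measure.map_apply hβ hs, Measure.restrict_apply (hβ hs), Measure.smul_apply,
    Measure.restrict_apply hs, smul_eq_mul]
  have hsub : β ⁻¹' s ∩ D ⊆ P '' (s ∩ Γ) := fun y hy => ⟨β y, ⟨hy.1, hβD y hy.2⟩, hPβ y⟩
  have hH : (μH[2] : Measure (Fin 2 → ℝ)) = volume := by
    rw [← hausdorffMeasure_pi_real]; simp
  have := hP.hausdorffMeasure_image_le (d := 2) (by norm_num) (s ∩ Γ)
  rw [hH] at this
  calc _ ≤ _ := measure_mono hsub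
    _ ≤ _ := this
    _ = _ := by norm_num

end Pushforward

/-! ### Quadratic inequalities -/

theorem ENNReal.add_sq_le_two_mul (a b : ℝ≥0∞) : (a + b) ^ 2 ≤ 2 * (a ^ 2 + b ^ 2) := by
  induction a with
  | top => simp
  | coe a =>
    induction b with
    | top => simp
    | coe b =>
      have : (a + b) ^ 2 ≤ 2 * (a ^ 2 + b ^ 2) := add_sq_le
      exact_mod_cast this

theorem ENNReal.add_add_sq_le_three_mul (a b c : ℝ≥0∞) :
    (a + b + c) ^ 2 ≤ 3 * (a ^ 2 + b ^ 2 + c ^ 2) := by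
  induction a with
  | top => simp
  | coe a =>
    induction b with
    | top => simp
    | coe b =>
      induction c with
      | top => simp
      | coe c =>
        have : (a + b + c) ^ 2 ≤ 3 * (a ^ 2 + b ^ 2 + c ^ 2) := by
          rw [← NNReal.coe_le_coe]
          push_cast
          nlinarith [sq_nonneg ((a : ℝ) - b), sq_nonneg ((a : ℝ) - c), sq_nonneg ((b : ℝ) - c)]
        exact_mod_cast this

theorem lintegral_mul_sq_le {α : Type*} [MeasurableSpace α] {μ : Measure α} {f g : α → ℝ≥0∞}
    (hf : AEMeasurable f μ) (hg : AEMeasurable g μ) :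
    (∫⁻ x, f x * g x ∂μ) ^ 2 ≤ (∫⁻ x, f x ^ 2 ∂μ) * ∫⁻ x, g x ^ 2 ∂μ := by
  have h := ENNReal.lintegral_mul_le_Lp_mul_Lq μ (p := 2) (q := 2)
    ((Real.holderConjugate_iff_eq_conjExponent (by norm_num)).2 (by norm_num)) hf hg
  simp only [Pi.mul_apply, ENNReal.rpow_two] at h
  calc _ ≤ ((∫⁻ x, f x ^ 2 ∂μ) ^ (1 / 2 : ℝ) * (∫⁻ x, g x ^ 2 ∂μ) ^ (1 / 2 : ℝ)) ^ 2 := by gcongr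
    _ = _ := by
      rw [mul_pow, ← ENNReal.rpow_two, ← ENNReal.rpow_two, ← ENNReal.rpow_mul, ← ENNReal.rpow_mul]
      norm_num

theorem lintegral_Ioo_sq_le {ξ : ℝ} {m : ℝ → ℝ≥0∞} (hm : Measurable m) :
    (∫⁻ s in Ioo 0 ξ, m s) ^ 2 ≤ ENNReal.ofReal ξ * ∫⁻ s in Ioo 0 ξ, m s ^ 2 := by
  have := lintegral_mul_sq_le (μ := volume.restrict (Ioo 0 ξ)) (f := fun _ => 1) (g := m)
    aemeasurable_const hm.aemeasurable
  simpa using this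

/-! ### Hardy's inequality along a curve -/

section Hardy

theorem enorm_sub_le_lintegral_fderiv {φ : R3 → R3} (hφ : ContDiff ℝ 1 φ) {γ : ℝ → R3}
    (hγ : ContDiff ℝ 1 γ) {K : ℝ≥0} (hγK : LipschitzWith K γ) {ξ s : ℝ} (hs : s ∈ Ioo 0 ξ) :
    ‖φ (γ s) - φ (γ 0)‖ₑ ≤ ∫⁻ σ in Ioo 0 ξ, ‖fderiv ℝ φ (γ σ)‖ₑ * K := by
  have hcomp : ContDiff ℝ 1 (φ ∘ γ) := hφ.comp hγ
  have h1 : ∫ σ in (0 : ℝ)..s, deriv (φ ∘ γ) σ = φ (γ s) - φ (γ 0) :=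
    intervalIntegral.integral_deriv_eq_sub (fun x _ => hcomp.differentiable one_ne_zero x)
      ((hcomp.continuous_deriv le_rfl).intervalIntegrable _ _)
  rw [← h1, intervalIntegral.integral_of_le hs.1.le]
  refine (enorm_integral_le_lintegral_enorm _).trans
    ((lintegral_mono fun σ => ?_).trans (lintegral_mono_set fun σ hσ => ⟨hσ.1, hσ.2.trans_lt hs.2⟩))
  have h2 : deriv (φ ∘ γ) σ = fderiv ℝ φ (γ σ) (deriv γ σ) :=
    fderiv_comp_deriv σ (hφ.differentiable one_ne_zero _) (hγ.differentiable one_ne_zero σ)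
  rw [h2]
  refine (ContinuousLinearMap.le_opENorm _ _).trans (mul_le_mul' le_rfl ?_)
  rw [enorm_le_coe]
  exact norm_deriv_le_of_lipschitz hγK

/-- A one-dimensional Hardy inequality along a curve that starts on the boundary. -/
theorem lintegral_sq_le_of_curve {φ V : R3 → R3} (hφ : ContDiff ℝ 1 φ) {K : ℝ≥0}
    (hV : LipschitzWith K V) {γ : ℝ → R3} (hγ : ContDiff ℝ 1 γ) (hγK : LipschitzWith K γ)
    {a : ℝ → R3 →L[ℝ] ℝ} {A : ℝ≥0} {ξ : ℝ} (ha0 : ‖a 0‖ ≤ A)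
    (ha : ∀ s ∈ Ioo 0 ξ, ‖a s - a 0‖ ≤ A * s) :
    ∫⁻ s in Ioo 0 ξ, ‖a s (φ (γ s) - V (γ s))‖ₑ ^ 2 ≤
      3 * ENNReal.ofReal ξ * ‖a 0 (φ (γ 0) - V (γ 0))‖ₑ ^ 2 +
      (3 * A ^ 2 * (1 + 2 * K ^ 2 + 2 * K ^ 4) : ℝ≥0) * ENNReal.ofReal ξ ^ 2 *
        ∫⁻ s in Ioo 0 ξ, (‖fderiv ℝ φ (γ s)‖ₑ ^ 2 + ‖φ (γ s) - V (γ s)‖ₑ ^ 2 + 1) := by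
  set w : ℝ → R3 := fun s => φ (γ s) - V (γ s) with hw
  have hwc : Continuous w := (hφ.continuous.comp hγ.continuous).sub (hV.continuous.comp hγ.continuous)
  have hDc : Continuous fun s => fderiv ℝ φ (γ s) := (hφ.continuous_fderiv one_ne_zero).comp hγ.continuous
  set m : ℝ → ℝ≥0∞ := fun σ => ‖fderiv ℝ φ (γ σ)‖ₑ * K + (K : ℝ≥0∞) ^ 2 with hm
  have hmm : Measurable m := by
    have : Measurable fun σ => ‖fderiv ℝ φ (γ σ)‖ₑ := hDc.enorm.measurable
    exact (this.mul_const _).add_const _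
  have hA0 : ‖a 0‖ₑ ≤ A := by
    rw [enorm_le_coe]; exact ha0
  -- The fundamental theorem handles `φ`; for `V` only the Lipschitz constant along the curve, `K *
  -- K`, is available, which explains the constant term of `m`.
  have hdiff : ∀ s ∈ Ioo 0 ξ, ‖w s - w 0‖ₑ ≤ ∫⁻ σ in Ioo 0 ξ, m σ := by
    intro s hs
    have h1 := enorm_sub_le_lintegral_fderiv hφ hγ hγK hs
    have h2 : ‖V (γ s) - V (γ 0)‖ₑ ≤ ENNReal.ofReal ξ * (K : ℝ≥0∞) ^ 2 := by
      have h3 := (hV.comp hγK).edist_le_mul s 0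
      rw [edist_eq_enorm_sub] at h3
      refine h3.trans ?_
      have : edist s 0 ≤ ENNReal.ofReal ξ := by
        rw [edist_dist]
        apply ENNReal.ofReal_le_ofReal
        simp [abs_of_pos hs.1, hs.2.le]
      push_cast
      calc _ ≤ (K : ℝ≥0∞) * K * ENNReal.ofReal ξ := by gcongr
        _ = _ := by ring
    have e : w s - w 0 = (φ (γ s) - φ (γ 0)) - (V (γ s) - V (γ 0)) := by simp only [hw]; abel
    rw [e]
    refine (enorm_sub_le).trans ((add_le_add h1 h2).trans (le_of_eq ?_))
    rw [hm, lintegral_add_right _ measurable_const]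
    simp [mul_comm]
  have hpt : ∀ s ∈ Ioo 0 ξ, ‖a s (w s)‖ₑ ^ 2 ≤ 3 * (‖a 0 (w 0)‖ₑ ^ 2 +
      (A * ∫⁻ σ in Ioo 0 ξ, m σ) ^ 2 + (A * ENNReal.ofReal ξ * ‖w s‖ₑ) ^ 2) := by
    intro s hs
    refine le_trans ?_ (ENNReal.add_add_sq_le_three_mul _ _ _)
    gcongr
    -- The first term is the boundary value, the second an integral over a curve of length `O(ξ)`,
    -- and the third is small because the covector moves by at most `A s`.
    have e : a s (w s) = a 0 (w 0) + a 0 (w s - w 0) + (a s - a 0) (w s) := by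
      simp only [map_sub, _root_.sub_apply]; abel
    rw [e]
    refine (enorm_add_le _ _).trans (add_le_add ((enorm_add_le _ _).trans (add_le_add le_rfl ?_)) ?_)
    · exact ((a 0).le_opENorm _).trans (mul_le_mul' hA0 (hdiff s hs))
    · refine ((a s - a 0).le_opENorm _).trans (mul_le_mul' ?_ le_rfl)
      have h1 := ha s hs
      have h2 : ‖a s - a 0‖ ≤ A * ξ := h1.trans (by gcongr; exact hs.2.le)
      calc ‖a s - a 0‖ₑ = ENNReal.ofReal ‖a s - a 0‖ := (ofReal_norm _).symm
        _ ≤ ENNReal.ofReal (A * ξ) := ENNReal.ofReal_le_ofReal h2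
        _ = _ := by rw [ENNReal.ofReal_mul (NNReal.coe_nonneg A)]; simp
  have hmsq : ∫⁻ σ in Ioo 0 ξ, m σ ^ 2 ≤ ((2 * K ^ 2 + 2 * K ^ 4 : ℝ≥0) : ℝ≥0∞) *
      ∫⁻ s in Ioo 0 ξ, (‖fderiv ℝ φ (γ s)‖ₑ ^ 2 + ‖w s‖ₑ ^ 2 + 1) := by
    rw [← lintegral_const_mul' _ _ ENNReal.coe_ne_top]
    refine lintegral_mono fun σ => ?_
    refine (ENNReal.add_sq_le_two_mul _ _).trans ?_
    push_cast
    have : (‖fderiv ℝ φ (γ σ)‖ₑ ^ 2 + 1) ≤ ‖fderiv ℝ φ (γ σ)‖ₑ ^ 2 + ‖w σ‖ₑ ^ 2 + 1 := by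
      rw [add_right_comm]; exact le_self_add
    refine le_trans ?_ (mul_le_mul' le_rfl this)
    calc _ = 2 * (K : ℝ≥0∞) ^ 2 * ‖fderiv ℝ φ (γ σ)‖ₑ ^ 2 + 2 * (K : ℝ≥0∞) ^ 4 * 1 := by ring
      _ ≤ (2 * (K : ℝ≥0∞) ^ 2 + 2 * (K : ℝ≥0∞) ^ 4) * ‖fderiv ℝ φ (γ σ)‖ₑ ^ 2 +
          (2 * (K : ℝ≥0∞) ^ 2 + 2 * (K : ℝ≥0∞) ^ 4) * 1 :=
        add_le_add (mul_le_mul' le_self_add le_rfl) (mul_le_mul' le_add_self le_rfl)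
      _ = _ := by ring
  set I := ∫⁻ s in Ioo 0 ξ, (‖fderiv ℝ φ (γ s)‖ₑ ^ 2 + ‖w s‖ₑ ^ 2 + 1) with hI
  have hwI : ∫⁻ s in Ioo 0 ξ, ‖w s‖ₑ ^ 2 ≤ I := lintegral_mono fun s => by
    rw [add_right_comm]; exact le_add_self
  set Mm := ∫⁻ σ in Ioo 0 ξ, m σ with hMm
  have hM : Mm ^ 2 ≤ ENNReal.ofReal ξ * (((2 * K ^ 2 + 2 * K ^ 4 : ℝ≥0) : ℝ≥0∞) * I) :=
    (lintegral_Ioo_sq_le hmm).trans (mul_le_mul' le_rfl hmsq)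
  calc ∫⁻ s in Ioo 0 ξ, ‖a s (w s)‖ₑ ^ 2
      ≤ ∫⁻ s in Ioo 0 ξ, 3 * (‖a 0 (w 0)‖ₑ ^ 2 + (A * Mm) ^ 2 + (A * ENNReal.ofReal ξ * ‖w s‖ₑ) ^ 2) :=
        setLIntegral_mono' measurableSet_Ioo hpt
    _ = 3 * (ENNReal.ofReal ξ * ‖a 0 (w 0)‖ₑ ^ 2 + ENNReal.ofReal ξ * (A * Mm) ^ 2 +
          (A * ENNReal.ofReal ξ) ^ 2 * ∫⁻ s in Ioo 0 ξ, ‖w s‖ₑ ^ 2) := by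
        rw [lintegral_const_mul' _ _ (by norm_num), lintegral_add_left measurable_const]
        simp only [mul_pow]
        rw [lintegral_const_mul' _ _ (by finiteness)]
        simp only [lintegral_const, MeasurableSet.univ, Measure.restrict_apply, univ_inter,
          Real.volume_Ioo, sub_zero]
        ring
    _ ≤ 3 * (ENNReal.ofReal ξ * ‖a 0 (w 0)‖ₑ ^ 2 + ENNReal.ofReal ξ * (A ^ 2 *
          (ENNReal.ofReal ξ * (((2 * K ^ 2 + 2 * K ^ 4 : ℝ≥0) : ℝ≥0∞) * I))) +
          (A * ENNReal.ofReal ξ) ^ 2 * I) := by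
        rw [mul_pow]; gcongr
    _ = _ := by push_cast; ring

end Hardy

/-! ### Hardy's inequality in the transported boundary layer -/

/-- A bi-Lipschitz `C¹` change of variables whose inverse has a Lipschitz differential. -/
structure IsRegularChange (K : ℝ≥0) (S Y : R3 → R3) : Prop where
  left_inv : ∀ x, Y (S x) = x
  right_inv : ∀ x, S (Y x) = x
  contDiff : ContDiff ℝ 1 S
  contDiff_inv : ContDiff ℝ 1 Y
  lipschitz : LipschitzWith K S
  lipschitz_inv : LipschitzWith K Y
  lipschitz_fderiv_inv : LipschitzWith K (fderiv ℝ Y)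

theorem IsRegularFlow.isRegularChange {T : ℝ} {K : ℝ≥0} {V X Y : ℝ → R3 → R3}
    (h : IsRegularFlow T K V X Y) {t : ℝ} (ht : t ∈ Icc 0 T) : IsRegularChange K (X t) (Y t) where
  left_inv := h.left_inv t ht
  right_inv := h.right_inv t ht
  contDiff := h.contDiff t ht
  contDiff_inv := h.contDiff_inv.comp (contDiff_const.prodMk contDiff_id)
  lipschitz := h.lipschitz t ht
  lipschitz_inv := h.lipschitz_inv t ht
  lipschitz_fderiv_inv := h.lipschitz_fderiv_inv t ht

namespace IsRegularChange

variable {K : ℝ≥0} {S Y : R3 → R3}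

theorem norm_fderiv_inv_le (h : IsRegularChange K S Y) (x : R3) : ‖fderiv ℝ Y x‖ ≤ K :=
  norm_fderiv_le_of_lipschitz ℝ h.lipschitz_inv

theorem image_eq_preimage (h : IsRegularChange K S Y) (s : Set R3) : S '' s = Y ⁻¹' s := by
  ext x; constructor
  · rintro ⟨y, hy, rfl⟩; simpa [h.left_inv] using hy
  · exact fun hx => ⟨Y x, hx, h.right_inv x⟩

theorem mem_frontier_image (h : IsRegularChange K S Y) {s : Set R3} {x : R3}
    (hx : x ∈ frontier s) : S x ∈ frontier (S '' s) := by
  let H : R3 ≃ₜ R3 := ⟨⟨S, Y, h.left_inv, h.right_inv⟩, h.contDiff.continuous,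
    h.contDiff_inv.continuous⟩
  have : H '' frontier s = frontier (H '' s) := H.image_frontier s
  have h2 : S x ∈ H '' frontier s := ⟨x, hx, rfl⟩
  rw [this] at h2
  exact h2

theorem fderiv_inv_comp (h : IsRegularChange K S Y) (x v : R3) :
    fderiv ℝ Y (S x) (fderiv ℝ S x v) = v := by
  have h1 := (h.contDiff_inv.differentiable one_ne_zero (S x)).hasFDerivAt.comp x
    (h.contDiff.differentiable one_ne_zero x).hasFDerivAt
  have h2 : Y ∘ S = id := by ext1 y; exact h.left_inv y
  rw [h2] at h1
  have := h1.unique (hasFDerivAt_id x)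
  simpa using congrArg (fun L : R3 →L[ℝ] R3 => L v) this

end IsRegularChange

namespace BoundaryChart

variable {Ω : Set R3} (c : BoundaryChart Ω)

/-- The points of the base of the chart. -/
def base : Set (Fin 2 → ℝ) := {y | c.param y 0 ∈ Metric.ball c.center c.radius}

/-- The points at height less than `ξ` over the base of the chart. -/
def slab (ξ : ℝ) : Set R3 := {z | c.proj z ∈ c.base ∧ c.height z ∈ Ioo 0 ξ}

/-- The differential of the transported height function `c.height ∘ Y`. -/
noncomputable def conormal (Y : R3 → R3) (x : R3) : R3 →L[ℝ] ℝ :=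
  fderiv ℝ c.height (Y x) ∘L fderiv ℝ Y x

theorem isOpen_base : IsOpen c.base := c.isOpen_ball_base

theorem isOpen_slab (ξ : ℝ) : IsOpen (c.slab ξ) :=
  (c.isOpen_base.preimage c.lipschitz_proj.continuous).inter
    (isOpen_Ioo.preimage c.contDiff_height.continuous)

theorem norm_param_sub (y : Fin 2 → ℝ) (s : ℝ) : ‖c.param y s - c.param y 0‖ = |s| := by
  rw [c.param_eq_add y s, add_sub_cancel_left, norm_smul, c.norm_vertical, mul_one, Real.norm_eq_abs]

/-- The vertical vector is a unit vector, so heights up to 1 cost one unit of radius; hence the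
enlarged ball in `exists_bound_fderiv_height`. -/
theorem param_mem_closedBall {y : Fin 2 → ℝ} (hy : y ∈ c.base) {s : ℝ} (hs : |s| ≤ 1) :
    c.param y s ∈ Metric.closedBall c.center (c.radius + 1) := by
  have h1 : dist (c.param y 0) c.center < c.radius := hy
  have h2 := c.norm_param_sub y s
  rw [← dist_eq_norm] at h2
  have := dist_triangle (c.param y s) (c.param y 0) c.center
  rw [Metric.mem_closedBall]
  linarith

theorem lintegral_slab {H : R3 → ℝ≥0∞} (hH : Measurable H) (ξ : ℝ) :
    ∫⁻ z in c.slab ξ, H z = ∫⁻ y in c.base, ∫⁻ s in Ioo 0 ξ, H (c.param y s) := by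
  have hm := (c.isOpen_slab ξ).measurableSet
  rw [← lintegral_indicator hm, ← c.measurePreserving_param.lintegral_comp (hH.indicator hm)]
  rw [Measure.volume_eq_prod, lintegral_prod
    (fun p : (Fin 2 → ℝ) × ℝ => (c.slab ξ).indicator H (c.param p.1 p.2)) ((hH.indicator hm).comp c.continuous_param.measurable).aemeasurable,
    ← lintegral_indicator c.isOpen_base.measurableSet]
  refine lintegral_congr fun y => ?_
  by_cases hy : y ∈ c.base
  · rw [indicator_of_mem hy, ← lintegral_indicator measurableSet_Ioo]
    refine lintegral_congr fun s => ?_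
    by_cases hs : s ∈ Ioo 0 ξ
    · rw [indicator_of_mem hs, indicator_of_mem]
      exact ⟨by rwa [proj_param], by rwa [height_param]⟩
    · rw [indicator_of_notMem hs, indicator_of_notMem]
      exact fun h => hs (by simpa [height_param] using h.2)
  · rw [indicator_of_notMem hy, lintegral_eq_zero_iff']
    · refine Eventually.of_forall fun s => ?_
      exact indicator_of_notMem (fun h => hy (by simpa [proj_param] using h.1)) _
    · exact ((hH.indicator hm).comp (c.continuous_param.comp
        (continuous_const.prodMk continuous_id)).measurable).aemeasurable

theorem continuous_conormal {Y : R3 → R3} (hY : ContDiff ℝ 1 Y) : Continuous (c.conormal Y) :=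
  ((c.contDiff_height.continuous_fderiv (by norm_num)).comp hY.continuous).clm_comp
    (hY.continuous_fderiv one_ne_zero)

/-- Second-order regularity of the boundary and of the flow enters here: the conormal is a product
of two bounded Lipschitz factors. The constant depends on `S` and `Y` only through `K`, hence serves
all times. -/
theorem exists_bound_conormal (K : ℝ≥0) : ∃ A : ℝ≥0, ∀ S Y : R3 → R3, IsRegularChange K S Y →
    (∀ x, Y x ∈ Metric.closedBall c.center (c.radius + 1) → ‖c.conormal Y x‖ ≤ A) ∧
    ∀ y ∈ c.base, ∀ s ∈ Icc (0 : ℝ) 1,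
      ‖c.conormal Y (S (c.param y s)) - c.conormal Y (S (c.param y 0))‖ ≤ A * s := by
  obtain ⟨A, hA, hA'⟩ := c.exists_bound_fderiv_height
  refine ⟨A * K + A * K * K, fun S Y h => ⟨fun x hx => ?_, fun y hy s hs => ?_⟩⟩
  · calc ‖c.conormal Y x‖ ≤ ‖fderiv ℝ c.height (Y x)‖ * ‖fderiv ℝ Y x‖ :=
          ContinuousLinearMap.opNorm_comp_le _ _
      _ ≤ A * K := by gcongr; exacts [hA _ hx, h.norm_fderiv_inv_le x]
      _ ≤ _ := by push_cast; exact le_add_of_nonneg_right (by positivity)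
  · have hs1 : |s| ≤ 1 := by rw [abs_of_nonneg hs.1]; exact hs.2
    have hp := c.param_mem_closedBall hy hs1
    have hp0 := c.param_mem_closedBall hy (s := 0) (by simp)
    have hn := c.norm_param_sub y s
    rw [abs_of_nonneg hs.1] at hn
    have e : c.conormal Y (S (c.param y s)) - c.conormal Y (S (c.param y 0)) =
        (fderiv ℝ c.height (c.param y s) - fderiv ℝ c.height (c.param y 0)) ∘L
          fderiv ℝ Y (S (c.param y s)) +
        fderiv ℝ c.height (c.param y 0) ∘L
          (fderiv ℝ Y (S (c.param y s)) - fderiv ℝ Y (S (c.param y 0))) := by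
      simp only [conormal, h.left_inv, ContinuousLinearMap.sub_comp, ContinuousLinearMap.comp_sub]
      abel
    rw [e]
    have h1 : ‖fderiv ℝ Y (S (c.param y s)) - fderiv ℝ Y (S (c.param y 0))‖ ≤ K * (K * s) := by
      rw [← dist_eq_norm]
      refine (h.lipschitz_fderiv_inv.dist_le_mul _ _).trans ?_
      gcongr
      refine (h.lipschitz.dist_le_mul _ _).trans ?_
      rw [dist_eq_norm, hn]
    calc _ ≤ (A * s) * K + A * (K * (K * s)) := by
          refine (norm_add_le _ _).trans (add_le_add ?_ ?_)
          · refine (ContinuousLinearMap.opNorm_comp_le _ _).trans ?_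
            refine mul_le_mul ?_ (h.norm_fderiv_inv_le _) (norm_nonneg _) (mul_nonneg A.2 hs.1)
            have := hA' _ hp _ hp0
            rwa [hn] at this
          · refine (ContinuousLinearMap.opNorm_comp_le _ _).trans ?_
            exact mul_le_mul (hA _ hp0) h1 (norm_nonneg _) A.2
      _ = _ := by push_cast; ring

/-- Hardy's inequality in a boundary layer for `C¹` vector fields. -/
theorem exists_hardy_of_contDiff (K : ℝ≥0) : ∃ C : ℝ≥0, ∀ S Y V φ : R3 → R3,
    IsRegularChange K S Y → LipschitzWith K V → ContDiff ℝ 1 φ → ∀ ξ ∈ Ioc (0 : ℝ) 1,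
    ∫⁻ x in Y ⁻¹' c.slab ξ, ‖c.conormal Y x (φ x - V x)‖ₑ ^ 2 ≤
      C * ENNReal.ofReal ξ * (∫⁻ y in c.base, ‖c.conormal Y (S (c.param y 0))
          (φ (S (c.param y 0)) - V (S (c.param y 0)))‖ₑ ^ 2) +
      C * ENNReal.ofReal ξ ^ 2 *
        ∫⁻ x in Y ⁻¹' c.slab ξ, (‖fderiv ℝ φ x‖ₑ ^ 2 + ‖φ x - V x‖ₑ ^ 2 + 1) := by
  obtain ⟨A, hA⟩ := c.exists_bound_conormal K
  set C₁ : ℝ≥0 := 3 * A ^ 2 * (1 + 2 * K ^ 2 + 2 * K ^ 4) with hC₁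
  refine ⟨K ^ 3 * 3 + K ^ 3 * C₁ * K ^ 3, fun S Y V φ h hV hφ ξ hξ => ?_⟩
  obtain ⟨hA1, hA2⟩ := hA S Y h
  have hwc : Continuous fun x => φ x - V x := hφ.continuous.sub hV.continuous
  have hac := c.continuous_conormal h.contDiff_inv
  have hF : Measurable fun x => ‖c.conormal Y x (φ x - V x)‖ₑ ^ 2 :=
    ((hac.clm_apply hwc).enorm.measurable).pow_const 2
  have hN : Measurable fun x => ‖fderiv ℝ φ x‖ₑ ^ 2 + ‖φ x - V x‖ₑ ^ 2 + 1 :=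
    ((((hφ.continuous_fderiv one_ne_zero).enorm.measurable).pow_const 2).add
      ((hwc.enorm.measurable).pow_const 2)).add_const 1
  have hslab := (c.isOpen_slab ξ).measurableSet
  have hSm := h.contDiff.continuous.measurable
  have hYm := h.contDiff_inv.continuous.measurable
  -- Each passage between the moving layer and the fixed slab costs a factor `K ^ 3`; the volume
  -- term pays it twice, the boundary term once.
  have step1 : ∀ F : R3 → ℝ≥0∞, Measurable F →
      ∫⁻ x in Y ⁻¹' c.slab ξ, F x ≤ (K : ℝ≥0∞) ^ 3 * ∫⁻ z in c.slab ξ, F (S z) := by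
    intro F hF
    have := lintegral_comp_le_of_lipschitz h.lipschitz hYm h.left_inv h.right_inv
      (F := (c.slab ξ).indicator (fun z => F (S z))) ((hF.comp hSm).indicator hslab)
    rw [lintegral_indicator hslab] at this
    rw [← lintegral_indicator (hYm hslab)]
    refine le_trans (lintegral_mono fun x => ?_) this
    by_cases hx : Y x ∈ c.slab ξ
    · rw [indicator_of_mem hx, indicator_of_mem (show x ∈ Y ⁻¹' c.slab ξ from hx), h.right_inv]
    · rw [indicator_of_notMem (show x ∉ Y ⁻¹' c.slab ξ from hx)]; exact zero_le
  have step2 : ∀ F : R3 → ℝ≥0∞, Measurable F →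
      ∫⁻ z in c.slab ξ, F (S z) ≤ (K : ℝ≥0∞) ^ 3 * ∫⁻ x in Y ⁻¹' c.slab ξ, F x := by
    intro F hF
    have := lintegral_comp_le_of_lipschitz h.lipschitz_inv hSm h.right_inv h.left_inv
      (F := (Y ⁻¹' c.slab ξ).indicator F) (hF.indicator (hYm hslab))
    rw [lintegral_indicator (hYm hslab)] at this
    rw [← lintegral_indicator hslab]
    refine le_trans (lintegral_mono fun z => ?_) this
    by_cases hz : z ∈ c.slab ξ
    · rw [indicator_of_mem hz, indicator_of_mem (show S z ∈ Y ⁻¹' c.slab ξ by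
        simpa [h.left_inv] using hz)]
    · rw [indicator_of_notMem hz]; exact zero_le
  have hβ : Continuous fun y => S (c.param y 0) :=
    h.contDiff.continuous.comp (c.continuous_param.comp (continuous_id.prodMk continuous_const))
  have hpt : ∀ y ∈ c.base, ∫⁻ s in Ioo 0 ξ, ‖c.conormal Y (S (c.param y s))
        (φ (S (c.param y s)) - V (S (c.param y s)))‖ₑ ^ 2 ≤
      3 * ENNReal.ofReal ξ * ‖c.conormal Y (S (c.param y 0))
        (φ (S (c.param y 0)) - V (S (c.param y 0)))‖ₑ ^ 2 + C₁ * ENNReal.ofReal ξ ^ 2 *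
        ∫⁻ s in Ioo 0 ξ, (‖fderiv ℝ φ (S (c.param y s))‖ₑ ^ 2 +
          ‖φ (S (c.param y s)) - V (S (c.param y s))‖ₑ ^ 2 + 1) := by
    intro y hy
    have hp : ContDiff ℝ 1 fun s : ℝ => c.param y s := by
      have : (fun s => c.param y s) = fun s => c.param y 0 + s • c.vertical := by
        ext1 s; exact c.param_eq_add _ _
      rw [this]; fun_prop
    have hpl : LipschitzWith 1 fun s : ℝ => c.param y s := by
      refine LipschitzWith.of_dist_le_mul fun s s' => ?_
      rw [dist_eq_norm, c.param_eq_add y s, c.param_eq_add y s', add_sub_add_left_eq_sub, ← sub_smul,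
        norm_smul, c.norm_vertical, NNReal.coe_one, one_mul, mul_one, dist_eq_norm]
    have hγK : LipschitzWith K fun s : ℝ => S (c.param y s) := by
      simpa [Function.comp_def] using h.lipschitz.comp hpl
    refine lintegral_sq_le_of_curve hφ hV (h.contDiff.comp hp) hγK
      (a := fun s => c.conormal Y (S (c.param y s))) ?_ fun s hs => ?_
    · exact hA1 _ (by rw [h.left_inv]; exact c.param_mem_closedBall hy (by simp))
    · exact hA2 y hy s ⟨hs.1.le, hs.2.le.trans hξ.2⟩
  have hbm : Measurable fun y => 3 * ENNReal.ofReal ξ * ‖c.conormal Y (S (c.param y 0))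
        (φ (S (c.param y 0)) - V (S (c.param y 0)))‖ₑ ^ 2 := (hF.comp hβ.measurable).const_mul _
  set I₀ := ∫⁻ y in c.base, ‖c.conormal Y (S (c.param y 0))
          (φ (S (c.param y 0)) - V (S (c.param y 0)))‖ₑ ^ 2 with hI₀
  set I₁ := ∫⁻ x in Y ⁻¹' c.slab ξ, (‖fderiv ℝ φ x‖ₑ ^ 2 + ‖φ x - V x‖ₑ ^ 2 + 1) with hI₁
  calc ∫⁻ x in Y ⁻¹' c.slab ξ, ‖c.conormal Y x (φ x - V x)‖ₑ ^ 2
      ≤ (K : ℝ≥0∞) ^ 3 * ∫⁻ y in c.base, ∫⁻ s in Ioo 0 ξ, ‖c.conormal Y (S (c.param y s))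
        (φ (S (c.param y s)) - V (S (c.param y s)))‖ₑ ^ 2 := by
        rw [← c.lintegral_slab (H := fun z => ‖c.conormal Y (S z) (φ (S z) - V (S z))‖ₑ ^ 2)
          (hF.comp hSm)]
        exact step1 _ hF
    _ ≤ (K : ℝ≥0∞) ^ 3 * ∫⁻ y in c.base, (3 * ENNReal.ofReal ξ * ‖c.conormal Y (S (c.param y 0))
        (φ (S (c.param y 0)) - V (S (c.param y 0)))‖ₑ ^ 2 + C₁ * ENNReal.ofReal ξ ^ 2 *
        ∫⁻ s in Ioo 0 ξ, (‖fderiv ℝ φ (S (c.param y s))‖ₑ ^ 2 +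
          ‖φ (S (c.param y s)) - V (S (c.param y s))‖ₑ ^ 2 + 1)) :=
        mul_le_mul' le_rfl (setLIntegral_mono' c.isOpen_base.measurableSet hpt)
    _ = (K : ℝ≥0∞) ^ 3 * (3 * ENNReal.ofReal ξ * I₀ + C₁ * ENNReal.ofReal ξ ^ 2 *
          ∫⁻ z in c.slab ξ, (‖fderiv ℝ φ (S z)‖ₑ ^ 2 + ‖φ (S z) - V (S z)‖ₑ ^ 2 + 1)) := by
        rw [lintegral_add_left hbm, lintegral_const_mul' _ _ (by finiteness),
          lintegral_const_mul' _ _ (by finiteness),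
          ← c.lintegral_slab (H := fun z => ‖fderiv ℝ φ (S z)‖ₑ ^ 2 + ‖φ (S z) - V (S z)‖ₑ ^ 2 + 1)
            (hN.comp hSm)]
    _ ≤ (K : ℝ≥0∞) ^ 3 * (3 * ENNReal.ofReal ξ * I₀ + C₁ * ENNReal.ofReal ξ ^ 2 *
          ((K : ℝ≥0∞) ^ 3 * I₁)) := by
        gcongr; exact step2 _ hN
    _ = (K : ℝ≥0∞) ^ 3 * 3 * ENNReal.ofReal ξ * I₀ +
          (K : ℝ≥0∞) ^ 3 * C₁ * (K : ℝ≥0∞) ^ 3 * ENNReal.ofReal ξ ^ 2 * I₁ := by ring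
    _ ≤ _ := by
        push_cast
        gcongr
        · exact le_self_add
        · exact le_add_self

/-- The function `-c.height ∘ Y` defines `S '' Ω` near the point and its differential is minus the
conormal. The latter takes the value 1 on the image of the vertical vector under the differential of
`S`, so the gradient is nonzero and can be normalised. -/
theorem exists_outerUnitNormal {K : ℝ≥0} {S Y : R3 → R3} (h : IsRegularChange K S Y)
    {y : Fin 2 → ℝ} (hy : y ∈ c.base) :
    ∃ n, IsOuterUnitNormal (S '' Ω) (S (c.param y 0)) n ∧
      ∀ w, inner ℝ w n = 0 → c.conormal Y (S (c.param y 0)) w = 0 := by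
  set x := S (c.param y 0) with hx
  have hYx : Y x = c.param y 0 := h.left_inv _
  let ψ : R3 → ℝ := fun x => -c.height (Y x)
  have hψ : ContDiff ℝ 1 ψ := ((c.contDiff_height.of_le (by norm_num)).comp h.contDiff_inv).neg
  have hd : fderiv ℝ ψ x = -c.conormal Y x := by
    have h1 := ((c.contDiff_height.differentiable (by norm_num) (Y x)).hasFDerivAt.comp x
      (h.contDiff_inv.differentiable one_ne_zero x).hasFDerivAt).neg
    exact h1.fderiv
  have hgrad : ∀ w, inner ℝ w (∇ ψ x) = -c.conormal Y x w := by
    intro w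
    rw [real_inner_comm, gradient, InnerProductSpace.toDual_symm_apply, hd]
    rfl
  have hne : ∇ ψ x ≠ 0 := by
    intro h0
    have := hgrad (fderiv ℝ S (c.param y 0) c.vertical)
    rw [h0, inner_zero_right, conormal, ContinuousLinearMap.comp_apply, hx, h.fderiv_inv_comp,
      c.fderiv_height_vertical] at this
    norm_num at this
  refine ⟨‖∇ ψ x‖⁻¹ • ∇ ψ x, ⟨Y ⁻¹' Metric.ball c.center c.radius, ψ,
    Metric.isOpen_ball.preimage h.contDiff_inv.continuous, ?_, hψ.contDiffOn, ?_, ?_, hne, rfl⟩, ?_⟩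
  · rw [mem_preimage, hYx]; exact hy
  · intro z hz
    rw [h.image_eq_preimage, mem_preimage, c.mem_iff_height hz]
    simp [ψ]
  · simp only [ψ, hYx, c.height_param, neg_zero]
  · intro w hw
    rw [inner_smul_right, hgrad] at hw
    have := (mul_eq_zero.1 hw).resolve_left (inv_ne_zero (norm_ne_zero_iff.2 hne))
    linarith

end BoundaryChart

theorem lintegral_enorm_sq_eq {α F : Type*} [MeasurableSpace α] [NormedAddCommGroup F]
    (μ : Measure α) (f : α → F) : ∫⁻ x, ‖f x‖ₑ ^ 2 ∂μ = eLpNorm f 2 μ ^ 2 := by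
  have := eLpNorm_nnreal_pow_eq_lintegral (f := f) (μ := μ) (p := 2) (by norm_num)
  simpa using this.symm

theorem enorm_fderiv_sq_le (φ : R3 → R3) (x : R3) :
    ‖fderiv ℝ φ x‖ₑ ^ 2 ≤ 3 * ∑ i, ‖partialDeriv i φ x‖ₑ ^ 2 := by
  have h1 : ‖fderiv ℝ φ x‖ ≤ ∑ i, ‖partialDeriv i φ x‖ := by
    refine ContinuousLinearMap.opNorm_le_bound _ (by positivity) fun v => ?_
    have hv : v = ∑ i, v i • (EuclideanSpace.single i (1 : ℝ) : R3) := by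
      ext j; simp [Pi.single_apply]
    have e : fderiv ℝ φ x v = ∑ i, v i • partialDeriv i φ x := by
      conv_lhs => rw [hv]
      rw [map_sum]
      exact Finset.sum_congr rfl fun i _ => by rw [map_smul]; rfl
    rw [e, Finset.sum_mul]
    refine (norm_sum_le _ _).trans (Finset.sum_le_sum fun i _ => ?_)
    rw [norm_smul, mul_comm]
    gcongr
    exact PiLp.norm_apply_le v i
  have h2 : ‖fderiv ℝ φ x‖ₑ ≤ ∑ i, ‖partialDeriv i φ x‖ₑ := by
    have := ENNReal.ofReal_le_ofReal h1
    rw [ENNReal.ofReal_sum_of_nonneg fun _ _ => norm_nonneg _] at this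
    simpa only [ofReal_norm] using this
  rw [Fin.sum_univ_three] at h2 ⊢
  exact (pow_le_pow_left' h2 2).trans (ENNReal.add_add_sq_le_three_mul _ _ _)

theorem enorm_sq_le_two_mul {F : Type*} [NormedAddCommGroup F] (a b : F) :
    ‖a‖ₑ ^ 2 ≤ 2 * ‖b‖ₑ ^ 2 + 2 * ‖a - b‖ₑ ^ 2 := by
  have h1 : ‖a‖ₑ ≤ ‖b‖ₑ + ‖a - b‖ₑ := by
    calc ‖a‖ₑ = ‖b + (a - b)‖ₑ := by rw [add_sub_cancel]
      _ ≤ _ := enorm_add_le _ _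
  calc _ ≤ (‖b‖ₑ + ‖a - b‖ₑ) ^ 2 := by gcongr
    _ ≤ _ := ENNReal.add_sq_le_two_mul _ _
    _ = _ := by ring

namespace BoundaryChart

variable {Ω : Set R3} (c : BoundaryChart Ω)

/-- Convergence to the trace controls the convergence of the normal component on the chart. -/
theorem lintegral_base_le_of_trace {K A : ℝ≥0} {S Y V φ g : R3 → R3} (h : IsRegularChange K S Y)
    (hA : ∀ y ∈ c.base, ‖c.conormal Y (S (c.param y 0))‖ ≤ A) (hφ : Continuous φ)
    (hg : MemLp g 2 ((μH[2] : Measure R3).restrict (frontier (S '' Ω))))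
    (hgV : ∀ᵐ x ∂((μH[2] : Measure R3).restrict (frontier (S '' Ω))),
      ∀ n : R3, IsOuterUnitNormal (S '' Ω) x n → inner ℝ (g x - V x) n = 0) :
    ∫⁻ y in c.base, ‖c.conormal Y (S (c.param y 0))
        (φ (S (c.param y 0)) - V (S (c.param y 0)))‖ₑ ^ 2 ≤
      ((A ^ 2 * K ^ 2 : ℝ≥0) : ℝ≥0∞) *
        eLpNorm (fun x => φ x - g x) 2 ((μH[2] : Measure R3).restrict (frontier (S '' Ω))) ^ 2 := by
  set β : (Fin 2 → ℝ) → R3 := fun y => S (c.param y 0) with hβ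
  have hβc : Continuous β :=
    h.contDiff.continuous.comp (c.continuous_param.comp (continuous_id.prodMk continuous_const))
  have hpush : Measure.map β (volume.restrict c.base) ≤
      ((K : ℝ≥0∞) ^ 2) • (μH[2] : Measure R3).restrict (frontier (S '' Ω)) := by
    have hP : LipschitzWith K (c.proj ∘ Y) := by
      simpa using c.lipschitz_proj.comp h.lipschitz_inv
    refine map_restrict_le_hausdorffMeasure hP hβc.measurable (fun y hy => ?_) fun y => ?_
    · exact h.mem_frontier_image (c.param_mem_frontier hy)
    · simp only [hβ, Function.comp, h.left_inv, c.proj_param]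
  have hac : Measure.map β (volume.restrict c.base) ≪
      (μH[2] : Measure R3).restrict (frontier (S '' Ω)) :=
    (Measure.absolutelyContinuous_of_le hpush).trans Measure.smul_absolutelyContinuous
  have hae : ∀ᵐ y ∂(volume.restrict c.base), c.conormal Y (β y) (g (β y) - V (β y)) = 0 := by
    have h1 := ae_of_ae_map hβc.measurable.aemeasurable (hac.ae_le hgV)
    filter_upwards [h1, ae_restrict_mem c.isOpen_base.measurableSet] with y hy hyb
    obtain ⟨n, hn, hn'⟩ := c.exists_outerUnitNormal h hyb
    exact hn' _ (hy n hn)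
  have hm : AEMeasurable (fun x => ‖φ x - g x‖ₑ ^ 2)
      (Measure.map β (volume.restrict c.base)) :=
    (((hφ.aestronglyMeasurable.sub hg.1).enorm.pow_const 2).mono_ac hac)
  calc _ ≤ ∫⁻ y in c.base, (A : ℝ≥0∞) ^ 2 * ‖φ (β y) - g (β y)‖ₑ ^ 2 := by
        refine lintegral_mono_ae ?_
        filter_upwards [hae, ae_restrict_mem c.isOpen_base.measurableSet] with y hy hyb
        rw [← mul_pow]
        gcongr
        -- The conormal annihilates `g - V` on the boundary, so `V` may be replaced by the trace
        -- `g`.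
        have e : c.conormal Y (β y) (φ (β y) - V (β y)) = c.conormal Y (β y) (φ (β y) - g (β y)) := by
          rw [← sub_add_sub_cancel (φ (β y)) (g (β y)) (V (β y)), map_add, hy, add_zero]
        rw [e]
        refine (ContinuousLinearMap.le_opENorm _ _).trans (mul_le_mul' ?_ le_rfl)
        rw [enorm_le_coe]
        exact hA y hyb
    _ = (A : ℝ≥0∞) ^ 2 * ∫⁻ x, ‖φ x - g x‖ₑ ^ 2 ∂(Measure.map β (volume.restrict c.base)) := by
        rw [lintegral_const_mul' _ _ (by finiteness), lintegral_map' hm hβc.measurable.aemeasurable]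
    _ ≤ (A : ℝ≥0∞) ^ 2 * ((K : ℝ≥0∞) ^ 2 * ∫⁻ x, ‖φ x - g x‖ₑ ^ 2
          ∂((μH[2] : Measure R3).restrict (frontier (S '' Ω)))) := by
        gcongr
        rw [← smul_eq_mul, ← lintegral_smul_measure]
        exact lintegral_mono' hpush le_rfl
    _ = _ := by rw [lintegral_enorm_sq_eq]; push_cast; ring

/-- Hardy's inequality in a boundary layer for Sobolev vector fields with a vanishing relative
normal trace. -/
theorem exists_hardy (K : ℝ≥0) : ∃ C : ℝ≥0, ∀ (S Y V v g : R3 → R3) (G : Fin 3 → R3 → R3)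
    (φ : ℕ → R3 → R3) (B : Set R3), IsRegularChange K S Y → LipschitzWith K V →
    MemLp v 2 (volume.restrict B) → (∀ i, MemLp (G i) 2 (volume.restrict B)) →
    ApproxW120 B φ v G →
    MemLp g 2 ((μH[2] : Measure R3).restrict (frontier (S '' Ω))) →
    (∀ᵐ x ∂((μH[2] : Measure R3).restrict (frontier (S '' Ω))),
      ∀ n : R3, IsOuterUnitNormal (S '' Ω) x n → inner ℝ (g x - V x) n = 0) →
    Tendsto (fun n => eLpNorm (fun x => φ n x - g x) 2
      ((μH[2] : Measure R3).restrict (frontier (S '' Ω)))) atTop (𝓝 0) →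
    ∀ ξ ∈ Ioc (0 : ℝ) 1, Y ⁻¹' c.slab ξ ⊆ B →
    ∫⁻ x in Y ⁻¹' c.slab ξ, ‖c.conormal Y x (v x - V x)‖ₑ ^ 2 ≤
      C * ENNReal.ofReal ξ ^ 2 *
        ∫⁻ x in Y ⁻¹' c.slab ξ, (∑ i, ‖G i x‖ₑ ^ 2 + ‖v x - V x‖ₑ ^ 2 + 1) := by
  obtain ⟨C, hC⟩ := c.exists_hardy_of_contDiff K
  obtain ⟨A, hA⟩ := c.exists_bound_conormal K
  -- `12 = 2 * 6`: a factor 2 for replacing `v` by `φ n`, and 6 from comparing the two energies,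
  -- namely 3 for three partial derivatives times 2 for the same replacement.
  refine ⟨12 * C, fun S Y V v g G φ B h hV hv hG hφ hg hgV hφg ξ hξ hB => ?_⟩
  obtain ⟨hφs, hφv, hφG⟩ := hφ
  obtain ⟨hA1, -⟩ := hA S Y h
  set E := Y ⁻¹' c.slab ξ with hE
  have hEm : MeasurableSet E := h.contDiff_inv.continuous.measurable (c.isOpen_slab ξ).measurableSet
  have hμ : volume.restrict E ≤ (volume.restrict B : Measure R3) := Measure.restrict_mono hB le_rfl
  have hEY : ∀ x ∈ E, ‖c.conormal Y x‖ₑ ≤ A := by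
    intro x hx
    rw [enorm_le_coe]
    refine hA1 x ?_
    rw [← c.param_proj_height (Y x)]
    refine c.param_mem_closedBall hx.1 ?_
    rw [abs_of_pos hx.2.1]
    exact hx.2.2.le.trans hξ.2
  set δ : ℕ → ℝ≥0∞ := fun n => eLpNorm (fun x => φ n x - v x) 2 (volume.restrict B) with hδ
  set η : Fin 3 → ℕ → ℝ≥0∞ := fun i n =>
    eLpNorm (fun x => partialDeriv i (φ n) x - G i x) 2 (volume.restrict B) with hη
  set τ : ℕ → ℝ≥0∞ := fun n => eLpNorm (fun x => φ n x - g x) 2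
      ((μH[2] : Measure R3).restrict (frontier (S '' Ω))) with hτ
  set N := ∫⁻ x in E, (∑ i, ‖G i x‖ₑ ^ 2 + ‖v x - V x‖ₑ ^ 2 + 1) with hN
  have hφc : ∀ n, ContDiff ℝ 1 (φ n) := fun n => (hφs n).1.of_le (by exact_mod_cast le_top)
  have hDc : ∀ i n, Continuous (partialDeriv i (φ n)) := fun i n =>
    ((hφc n).continuous_fderiv one_ne_zero).clm_apply continuous_const
  have hδm : ∀ n, AEMeasurable (fun x => ‖φ n x - v x‖ₑ ^ 2) (volume.restrict E) := fun n =>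
    (((hφc n).continuous.aestronglyMeasurable.sub (hv.1.mono_measure hμ)).enorm.pow_const 2)
  have hηm : ∀ i n, AEMeasurable (fun x => ‖partialDeriv i (φ n) x - G i x‖ₑ ^ 2)
      (volume.restrict E) := fun i n =>
    (((hDc i n).aestronglyMeasurable.sub ((hG i).1.mono_measure hμ)).enorm.pow_const 2)
  have hδE : ∀ n, ∫⁻ x in E, ‖φ n x - v x‖ₑ ^ 2 ≤ δ n ^ 2 := fun n => by
    rw [hδ, ← lintegral_enorm_sq_eq]; exact lintegral_mono' hμ le_rfl
  have hηE : ∀ i n, ∫⁻ x in E, ‖partialDeriv i (φ n) x - G i x‖ₑ ^ 2 ≤ η i n ^ 2 := fun i n => by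
    rw [hη]; simp only; rw [← lintegral_enorm_sq_eq]; exact lintegral_mono' hμ le_rfl
  have bound1 : ∀ n, ∫⁻ x in E, ‖c.conormal Y x (v x - V x)‖ₑ ^ 2 ≤
      2 * (∫⁻ x in E, ‖c.conormal Y x (φ n x - V x)‖ₑ ^ 2) + 2 * A ^ 2 * δ n ^ 2 := by
    intro n
    calc _ ≤ ∫⁻ x in E, (2 * ‖c.conormal Y x (φ n x - V x)‖ₑ ^ 2 +
          2 * A ^ 2 * ‖φ n x - v x‖ₑ ^ 2) := by
          refine setLIntegral_mono' hEm fun x hx => ?_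
          refine (enorm_sq_le_two_mul _ (c.conormal Y x (φ n x - V x))).trans ?_
          refine add_le_add le_rfl ?_
          rw [mul_assoc, ← mul_pow]
          gcongr
          rw [← map_sub, sub_sub_sub_cancel_right]
          refine (ContinuousLinearMap.le_opENorm _ _).trans (mul_le_mul' (hEY x hx) ?_)
          rw [enorm_sub_rev]
      _ = 2 * (∫⁻ x in E, ‖c.conormal Y x (φ n x - V x)‖ₑ ^ 2) +
            2 * A ^ 2 * ∫⁻ x in E, ‖φ n x - v x‖ₑ ^ 2 := by
          rw [lintegral_add_right' _ ((hδm n).const_mul _), lintegral_const_mul' _ _ (by finiteness),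
            lintegral_const_mul' _ _ (by finiteness)]
      _ ≤ _ := by gcongr; exact hδE n
  have bound2 : ∀ n, ∫⁻ x in E, (‖fderiv ℝ (φ n) x‖ₑ ^ 2 + ‖φ n x - V x‖ₑ ^ 2 + 1) ≤
      6 * N + (6 * (∑ i, η i n ^ 2) + 2 * δ n ^ 2) := by
    intro n
    calc _ ≤ ∫⁻ x in E, (6 * (∑ i, ‖G i x‖ₑ ^ 2 + ‖v x - V x‖ₑ ^ 2 + 1) +
          (6 * (∑ i, ‖partialDeriv i (φ n) x - G i x‖ₑ ^ 2) + 2 * ‖φ n x - v x‖ₑ ^ 2)) := by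
          refine lintegral_mono fun x => ?_
          have e1 : ‖fderiv ℝ (φ n) x‖ₑ ^ 2 ≤ 6 * (∑ i, ‖G i x‖ₑ ^ 2) +
              6 * (∑ i, ‖partialDeriv i (φ n) x - G i x‖ₑ ^ 2) := by
            refine (enorm_fderiv_sq_le _ _).trans ?_
            calc _ ≤ 3 * ∑ i, (2 * ‖G i x‖ₑ ^ 2 + 2 * ‖partialDeriv i (φ n) x - G i x‖ₑ ^ 2) := by
                  gcongr with i _; exact enorm_sq_le_two_mul _ _
              _ = _ := by
                  rw [Finset.sum_add_distrib, ← Finset.mul_sum, ← Finset.mul_sum, mul_add, ← mul_assoc,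
                    ← mul_assoc]; norm_num
          have e2 : ‖φ n x - V x‖ₑ ^ 2 ≤ 6 * ‖v x - V x‖ₑ ^ 2 + 2 * ‖φ n x - v x‖ₑ ^ 2 := by
            refine (enorm_sq_le_two_mul _ (v x - V x)).trans ?_
            rw [sub_sub_sub_cancel_right]
            gcongr; norm_num
          calc _ ≤ (6 * (∑ i, ‖G i x‖ₑ ^ 2) + 6 * (∑ i, ‖partialDeriv i (φ n) x - G i x‖ₑ ^ 2)) +
                (6 * ‖v x - V x‖ₑ ^ 2 + 2 * ‖φ n x - v x‖ₑ ^ 2) + 6 * 1 := by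
                gcongr; norm_num
            _ = _ := by ring
      _ = 6 * N + (6 * (∑ i, ∫⁻ x in E, ‖partialDeriv i (φ n) x - G i x‖ₑ ^ 2) +
            2 * ∫⁻ x in E, ‖φ n x - v x‖ₑ ^ 2) := by
          rw [lintegral_add_right', lintegral_const_mul' _ _ (by finiteness),
            lintegral_add_right' _ ((hδm n).const_mul _), lintegral_const_mul' _ _ (by finiteness),
            lintegral_const_mul' _ _ (by finiteness), lintegral_finsetSum' _ fun i _ => hηm i n]
          exact ((Finset.aemeasurable_fun_sum _ fun i _ => hηm i n).const_mul _).add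
            ((hδm n).const_mul _)
      _ ≤ _ := by
          gcongr with i _
          · exact hηE i n
          · exact hδE n
  have bound3 := fun n => c.lintegral_base_le_of_trace h (V := V)
    (hA := fun y hy => hA1 (S (c.param y 0)) (by
      rw [h.left_inv]; exact c.param_mem_closedBall hy (by simp))) (hφc n).continuous hg hgV
  -- The boundary term `τ n` and the approximation errors `δ n`, `η i n` vanish as `n → ∞` with `ξ`
  -- fixed; only the multiple of `N` survives.
  have total : ∀ n, ∫⁻ x in E, ‖c.conormal Y x (v x - V x)‖ₑ ^ 2 ≤
      2 * (C * ENNReal.ofReal ξ * (((A ^ 2 * K ^ 2 : ℝ≥0) : ℝ≥0∞) * τ n ^ 2) +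
        C * ENNReal.ofReal ξ ^ 2 * (6 * N + (6 * (∑ i, η i n ^ 2) + 2 * δ n ^ 2))) +
      2 * A ^ 2 * δ n ^ 2 := by
    intro n
    refine (bound1 n).trans ?_
    gcongr
    refine (hC S Y V (φ n) h hV (hφc n) ξ hξ).trans ?_
    gcongr
    · exact bound3 n
    · exact bound2 n
  have lim : Tendsto (fun n => 2 * (C * ENNReal.ofReal ξ * (((A ^ 2 * K ^ 2 : ℝ≥0) : ℝ≥0∞) * τ n ^ 2) +
        C * ENNReal.ofReal ξ ^ 2 * (6 * N + (6 * (∑ i, η i n ^ 2) + 2 * δ n ^ 2))) +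
      2 * A ^ 2 * δ n ^ 2) atTop (𝓝 (2 * (C * ENNReal.ofReal ξ * (((A ^ 2 * K ^ 2 : ℝ≥0) : ℝ≥0∞) * 0 ^ 2) +
        C * ENNReal.ofReal ξ ^ 2 * (6 * N + (6 * (∑ _i : Fin 3, 0 ^ 2) + 2 * 0 ^ 2))) +
      2 * A ^ 2 * 0 ^ 2)) := by
    have hsum : Tendsto (fun n => ∑ i, η i n ^ 2) atTop (𝓝 (∑ _i : Fin 3, 0 ^ 2)) :=
      tendsto_finsetSum _ fun i _ => ENNReal.Tendsto.pow (hφG i)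
    refine Tendsto.add (ENNReal.Tendsto.const_mul (Tendsto.add (ENNReal.Tendsto.const_mul
      (ENNReal.Tendsto.const_mul (ENNReal.Tendsto.pow hφg) (Or.inr (by finiteness))) (Or.inr (by finiteness)))
      (ENNReal.Tendsto.const_mul (Tendsto.add tendsto_const_nhds (Tendsto.add
        (ENNReal.Tendsto.const_mul hsum (Or.inr (by finiteness)))
        (ENNReal.Tendsto.const_mul (ENNReal.Tendsto.pow hφv) (Or.inr (by finiteness)))))
        (Or.inr (by finiteness)))) (Or.inr (by finiteness)))
      (ENNReal.Tendsto.const_mul (ENNReal.Tendsto.pow hφv) (Or.inr (by finiteness)))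
  refine (ge_of_tendsto' lim total).trans (le_of_eq ?_)
  simp
  ring

end BoundaryChart

theorem lintegral_enorm_mul_enorm_le {α F H : Type*} [MeasurableSpace α] {μ : Measure α}
    [NormedAddCommGroup F] [NormedAddCommGroup H] {f : α → F} {g : α → H}
    (hf : AEStronglyMeasurable f μ) (hg : AEStronglyMeasurable g μ) :
    ∫⁻ x, ‖f x‖ₑ * ‖g x‖ₑ ∂μ ≤ eLpNorm f 2 μ * eLpNorm g 2 μ := by
  have := lintegral_mul_sq_le hf.enorm hg.enorm
  rw [lintegral_enorm_sq_eq, lintegral_enorm_sq_eq, ← mul_pow] at this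
  exact (ENNReal.pow_le_pow_left_iff two_ne_zero).1 this

theorem integrable_smul_of_memLp_two {α F : Type*} [MeasurableSpace α] {μ : Measure α}
    [NormedAddCommGroup F] [NormedSpace ℝ F] {k : α → ℝ} {f : α → F} (hk : MemLp k 2 μ)
    (hf : MemLp f 2 μ) : Integrable (fun x => k x • f x) μ := by
  refine ⟨hk.1.smul hf.1, ?_⟩
  rw [HasFiniteIntegral]
  simp only [enorm_smul]
  exact (lintegral_enorm_mul_enorm_le hk.1 hf.1).trans_lt (ENNReal.mul_lt_top hk.2 hf.2)

/-! ### Uniqueness of the weak gradient -/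

section WeakGradient

variable {B : Set R3} {v : R3 → R3} {G G' : Fin 3 → R3 → R3} {φ φ' : ℕ → R3 → R3}

/-- The weak gradient of a function in `W^{1,2}_0` is unique. -/
theorem ApproxW120.ae_eq (hB : IsOpen B) (hv : MemLp v 2 (volume.restrict B))
    (hG : ∀ i, MemLp (G i) 2 (volume.restrict B)) (hG' : ∀ i, MemLp (G' i) 2 (volume.restrict B))
    (h : ApproxW120 B φ v G) (h' : ApproxW120 B φ' v G') (i : Fin 3) :
    G i =ᵐ[volume.restrict B] G' i := by
  have hφ : ∀ n, ContDiff ℝ 1 (φ n) := fun n => (h.1 n).1.of_le (by exact_mod_cast le_top)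
  have hφ' : ∀ n, ContDiff ℝ 1 (φ' n) := fun n => (h'.1 n).1.of_le (by exact_mod_cast le_top)
  have hDc : ∀ ψ : R3 → R3, ContDiff ℝ 1 ψ → Continuous (partialDeriv i ψ) := fun ψ hψ =>
    (hψ.continuous_fderiv one_ne_zero).clm_apply continuous_const
  have hloc : LocallyIntegrableOn (fun x => G i x - G' i x) B := by
    have : LocallyIntegrable (fun x => G i x - G' i x) (volume.restrict B) :=
      ((hG i).sub (hG' i)).locallyIntegrable (by norm_num)
    exact locallyIntegrableOn_of_locallyIntegrable_restrict this
  have key := hB.ae_eq_zero_of_integral_contDiff_smul_eq_zero hloc ?_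
  · rw [EventuallyEq, ae_restrict_iff' hB.measurableSet]
    filter_upwards [key] with x hx hxB
    exact sub_eq_zero.1 (hx hxB)
  intro ζ hζ hζc hζB
  have hζ1 : ContDiff ℝ 1 ζ := hζ.of_le (by exact_mod_cast le_top)
  set Dζ : R3 → ℝ := fun x => fderiv ℝ ζ x (EuclideanSpace.single i 1) with hDζ
  have hDζc : Continuous Dζ := (hζ1.continuous_fderiv one_ne_zero).clm_apply continuous_const
  have hDζs : HasCompactSupport Dζ := hζc.fderiv_apply (𝕜 := ℝ) _
  have hzero : ∀ x ∉ B, ζ x = 0 := fun x hx => image_eq_zero_of_notMem_tsupport fun hx' => hx (hζB hx')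
  have hDzero : ∀ x ∉ B, Dζ x = 0 := fun x hx => image_eq_zero_of_notMem_tsupport fun hx' =>
    hx (hζB (tsupport_fderiv_apply_subset ℝ _ hx'))
  have hres : ∀ f : R3 → R3, ∀ k : R3 → ℝ, (∀ x ∉ B, k x = 0) →
      ∫ x, k x • f x = ∫ x in B, k x • f x := fun f k hk =>
    (setIntegral_eq_integral_of_forall_compl_eq_zero fun x hx => by rw [hk x hx, zero_smul]).symm
  have hζL : MemLp ζ 2 (volume.restrict B) := (hζ1.continuous.memLp_of_hasCompactSupport hζc).restrict B
  have hDζL : MemLp Dζ 2 (volume.restrict B) := (hDζc.memLp_of_hasCompactSupport hDζs).restrict B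
  have hparts : ∀ ψ : R3 → R3, ContDiff ℝ 1 ψ →
      ∫ x, ζ x • partialDeriv i ψ x = - ∫ x, Dζ x • ψ x := by
    intro ψ hψ
    refine integral_smul_fderiv_eq_neg_fderiv_smul_of_integrable ?_ ?_ ?_
      (fun x _ => hζ1.differentiable one_ne_zero x) (fun x _ => hψ.differentiable one_ne_zero x)
    · exact (hDζc.smul hψ.continuous).integrable_of_hasCompactSupport hDζs.smul_right
    · exact (hζ1.continuous.smul (hDc ψ hψ)).integrable_of_hasCompactSupport hζc.smul_right
    · exact (hζ1.continuous.smul hψ.continuous).integrable_of_hasCompactSupport hζc.smul_right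
  have hpartsB : ∀ ψ : R3 → R3, ContDiff ℝ 1 ψ →
      ∫ x in B, ζ x • partialDeriv i ψ x = - ∫ x in B, Dζ x • ψ x := fun ψ hψ => by
    rw [← hres _ _ hzero, ← hres _ _ hDzero, hparts ψ hψ]
  have hint : ∀ f : R3 → R3, MemLp f 2 (volume.restrict B) →
      Integrable (fun x => ζ x • f x) (volume.restrict B) := fun f hf => integrable_smul_of_memLp_two hζL hf
  have hDint : ∀ f : R3 → R3, MemLp f 2 (volume.restrict B) →
      Integrable (fun x => Dζ x • f x) (volume.restrict B) := fun f hf => integrable_smul_of_memLp_two hDζL hf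
  have hcs : ∀ (k : R3 → ℝ) (f : R3 → R3), MemLp k 2 (volume.restrict B) →
      AEStronglyMeasurable f (volume.restrict B) →
      ‖∫ x in B, k x • f x‖ₑ ≤ eLpNorm k 2 (volume.restrict B) * eLpNorm f 2 (volume.restrict B) := by
    intro k f hk hf
    refine (enorm_integral_le_lintegral_enorm _).trans ?_
    simp only [enorm_smul]
    exact lintegral_enorm_mul_enorm_le hk.1 hf
  -- Integration by parts against `ζ` survives the `L²` limit, and its right-hand side depends on
  -- `v` alone.
  have hlim : ∀ (H : Fin 3 → R3 → R3) (ψ : ℕ → R3 → R3), ApproxW120 B ψ v H →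
      (∀ i, MemLp (H i) 2 (volume.restrict B)) →
      ∫ x in B, ζ x • H i x = - ∫ x in B, Dζ x • v x := by
    intro H ψ hψ hH
    have hψ1 : ∀ n, ContDiff ℝ 1 (ψ n) := fun n => (hψ.1 n).1.of_le (by exact_mod_cast le_top)
    have hψL : ∀ n, MemLp (ψ n) 2 (volume.restrict B) := fun n =>
      ((hψ1 n).continuous.memLp_of_hasCompactSupport (hψ.1 n).2.1).restrict B
    have hDL : ∀ n, MemLp (partialDeriv i (ψ n)) 2 (volume.restrict B) := fun n =>
      ((hDc _ (hψ1 n)).memLp_of_hasCompactSupport ((hψ.1 n).2.1.fderiv_apply (𝕜 := ℝ) _)).restrict B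
    have h1 : Tendsto (fun n => ∫ x in B, ζ x • partialDeriv i (ψ n) x) atTop
        (𝓝 (∫ x in B, ζ x • H i x)) := by
      rw [tendsto_iff_edist_tendsto_0]
      have hb : Tendsto (fun n => eLpNorm ζ 2 (volume.restrict B) *
          eLpNorm (fun x => partialDeriv i (ψ n) x - H i x) 2 (volume.restrict B)) atTop (𝓝 0) := by
        simpa using ENNReal.Tendsto.const_mul (hψ.2.2 i) (Or.inr hζL.2.ne)
      refine tendsto_of_tendsto_of_tendsto_of_le_of_le tendsto_const_nhds hb (fun _ => zero_le) fun n => ?_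
      rw [edist_eq_enorm_sub, ← integral_sub (hint _ (hDL n)) (hint _ (hH i))]
      simp only [← smul_sub]
      exact hcs _ _ hζL ((hDL n).1.sub (hH i).1)
    have h2 : Tendsto (fun n => ∫ x in B, Dζ x • ψ n x) atTop
        (𝓝 (∫ x in B, Dζ x • v x)) := by
      rw [tendsto_iff_edist_tendsto_0]
      have hb : Tendsto (fun n => eLpNorm Dζ 2 (volume.restrict B) *
          eLpNorm (fun x => ψ n x - v x) 2 (volume.restrict B)) atTop (𝓝 0) := by
        simpa using ENNReal.Tendsto.const_mul hψ.2.1 (Or.inr hDζL.2.ne)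
      refine tendsto_of_tendsto_of_tendsto_of_le_of_le tendsto_const_nhds hb (fun _ => zero_le) fun n => ?_
      rw [edist_eq_enorm_sub, ← integral_sub (hDint _ (hψL n)) (hDint _ hv)]
      simp only [← smul_sub]
      exact hcs _ _ hDζL ((hψL n).1.sub hv.1)
    refine tendsto_nhds_unique h1 ?_
    simp only [hpartsB _ (hψ1 _)]
    exact h2.neg
  rw [hres _ _ hzero]
  simp only [smul_sub]
  rw [integral_sub (hint _ (hG i)) (hint _ (hG' i)), hlim G φ h hG, hlim G' φ' h' hG', sub_self]

end WeakGradient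

/-! ### Recovering a sign from test functions -/

/-- A function with nonnegative averages against all nonnegative test functions is nonnegative. -/
theorem ae_nonneg_of_forall_integral_contDiff_nonneg {f : R3 → ℝ} {B : Set R3}
    (hB : MeasurableSet B) (hf : IntegrableOn f B)
    (h : ∀ φ : R3 → ℝ, ContDiff ℝ 1 φ → HasCompactSupport φ → (∀ x, 0 ≤ φ x) →
      0 ≤ ∫ x in B, f x * φ x) : ∀ᵐ x ∂(volume.restrict B), 0 ≤ f x := by
  -- The fixed ratio 2 of outer to inner radius is what Lebesgue differentiation with shrinking
  -- bumps requires.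
  let φ : ℕ → ContDiffBump (0 : R3) := fun n =>
    ⟨1 / ((n : ℝ) + 1), 2 * (1 / ((n : ℝ) + 1)), by positivity, by
      have : 0 < 1 / ((n : ℝ) + 1) := by positivity
      linarith⟩
  have hlim : Tendsto (fun n => (φ n).rOut) atTop (𝓝 0) := by
    have := (tendsto_one_div_add_atTop_nhds_zero_nat (𝕜 := ℝ)).const_mul 2
    simpa [φ] using this
  have hg : LocallyIntegrable (B.indicator f) volume :=
    ((integrable_indicator_iff hB).2 hf).locallyIntegrable
  have := ContDiffBump.ae_convolution_tendsto_right_of_locallyIntegrable (φ := φ) (μ := volume)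
    (K := 2) hlim (Eventually.of_forall fun n => le_rfl) hg
  rw [ae_restrict_iff' hB]
  filter_upwards [this] with x hx hxB
  rw [indicator_of_mem hxB] at hx
  refine ge_of_tendsto' hx fun n => ?_
  rw [convolution_eq_swap]
  have e : ∀ t, (ContinuousLinearMap.lsmul ℝ ℝ) ((φ n).normed volume (x - t)) (B.indicator f t) =
      B.indicator (fun t => f t * (φ n).normed volume (x - t)) t := by
    intro t
    by_cases ht : t ∈ B
    · simp [ht, mul_comm]
    · simp [ht]
  simp only [e]
  rw [integral_indicator hB]
  refine h (fun t => (φ n).normed volume (x - t)) ?_ ?_ fun t => (φ n).nonneg_normed _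
  · exact (φ n).contDiff_normed.comp (contDiff_const.sub contDiff_id)
  · exact (φ n).hasCompactSupport_normed.comp_homeomorph (Homeomorph.subLeft x)

/-! ### A partition of unity near the boundary -/

theorem IsC2HolderDomain.exists_chart {ν : ℝ≥0} {Ω : Set R3} (h : IsC2HolderDomain ν Ω) {x₀ : R3}
    (hx₀ : x₀ ∈ frontier Ω) {ρ : ℝ} (hρ : 0 < ρ) :
    ∃ c : BoundaryChart Ω, c.center = x₀ ∧ c.radius ≤ ρ := by
  obtain ⟨r, e, g, -, hr, hg, -, hmem⟩ := h.chart x₀ hx₀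
  exact ⟨⟨x₀, min r ρ, e, g, lt_min hr hρ, hg, fun x hx =>
    hmem x (Metric.ball_subset_ball (min_le_left _ _) hx)⟩, rfl, min_le_right _ _⟩

/-- A finite smooth partition of unity near the boundary of `Ω` subordinate to boundary charts. -/
structure BoundaryPartition (Ω : Set R3) (ι : Type) [Fintype ι] where
  chart : ι → BoundaryChart Ω
  weight : ι → R3 → ℝ
  nhd : Set R3
  contDiff_weight : ∀ k, ContDiff ℝ 1 (weight k)
  weight_nonneg : ∀ k x, 0 ≤ weight k x
  sum_weight_le_one : ∀ x, ∑ k, weight k x ≤ 1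
  tsupport_subset : ∀ k, tsupport (weight k) ⊆
    Metric.ball (chart k).center ((chart k).radius / 2)
  isOpen_nhd : IsOpen nhd
  frontier_subset : frontier Ω ⊆ nhd
  sum_weight_eq_one : ∀ x ∈ nhd, ∑ k, weight k x = 1

open scoped Manifold in
theorem IsC2HolderDomain.exists_partition {ν : ℝ≥0} {Ω : Set R3} (h : IsC2HolderDomain ν Ω)
    {ρ : ℝ} (hρ : 0 < ρ) : ∃ (ι : Type) (_ : Fintype ι) (P : BoundaryPartition Ω ι),
      ∀ k, (P.chart k).center ∈ frontier Ω ∧ (P.chart k).radius ≤ ρ := by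
  have hcomp : IsCompact (frontier Ω) :=
    Metric.isCompact_of_isClosed_isBounded isClosed_frontier (h.isBounded.closure.subset
      frontier_subset_closure)
  have hc : ∀ x : frontier Ω, ∃ c : BoundaryChart Ω, c.center = x ∧ c.radius ≤ ρ := fun x =>
    h.exists_chart x.2 hρ
  choose c hcx hcρ using hc
  obtain ⟨t, ht⟩ := hcomp.elim_nhds_subcover' (fun x hx =>
    Metric.ball x ((c ⟨x, hx⟩).radius / 2)) fun x hx =>
      Metric.ball_mem_nhds _ (half_pos (c ⟨x, hx⟩).radius_pos)
  let U : t → Set R3 := fun x => Metric.ball (c x).center ((c x).radius / 2)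
  have hUo : ∀ x, IsOpen (U x) := fun x => Metric.isOpen_ball
  have hUc : frontier Ω ⊆ ⋃ x, U x := by
    intro y hy
    obtain ⟨x, hx⟩ := mem_iUnion.1 (ht hy)
    obtain ⟨hxt, hxy⟩ := mem_iUnion.1 hx
    refine mem_iUnion.2 ⟨⟨x, hxt⟩, ?_⟩
    simp only [U, hcx]
    exact hxy
  -- Covering a thickening makes the weights sum to one on a neighbourhood of the frontier, not only
  -- on it; otherwise the exterior part of the cutoff would not be `C¹`.
  obtain ⟨δ, hδ, hδU⟩ := hcomp.exists_cthickening_subset_open (isOpen_iUnion hUo) hUc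
  obtain ⟨f, hf⟩ := SmoothPartitionOfUnity.exists_isSubordinate 𝓘(ℝ, R3)
    (Metric.isClosed_cthickening (E := frontier Ω) (δ := δ)) U hUo hδU
  refine ⟨t, inferInstance, ⟨fun x => c x, fun x => f x, Metric.thickening δ (frontier Ω),
    fun k => (f k).contMDiff.contDiff.of_le (by exact_mod_cast le_top), fun k x => f.nonneg k x,
    fun x => ?_, hf, Metric.isOpen_thickening, Metric.self_subset_thickening hδ _, fun x hx => ?_⟩,
    fun k => ⟨by simp only [hcx]; exact k.1.2, hcρ _⟩⟩
  · rw [← finsum_eq_sum_of_fintype]; exact f.sum_le_one x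
  · rw [← finsum_eq_sum_of_fintype]; exact f.sum_eq_one (Metric.thickening_subset_cthickening _ _ hx)

/-! ### Cutoffs that approximate the indicator of the complement -/

section ExteriorPart

variable {Ω U : Set R3} {Θ : R3 → ℝ}

/-- The jump of the indicator sits on the frontier, near which `1 - Θ` vanishes identically. So
locally the product is either `1 - Θ` or zero. -/
theorem exterior_cases (hΩ : IsOpen Ω) (hU : IsOpen U) (hfU : frontier Ω ⊆ U)
    (hΘU : ∀ x ∈ U, Θ x = 1) (x : R3) :
    (x ∉ Ω ∧ Ωᶜ.indicator (fun y => 1 - Θ y) =ᶠ[𝓝 x] fun y => 1 - Θ y) ∨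
    ((x ∈ Ω ∨ fderiv ℝ Θ x = 0) ∧ Ωᶜ.indicator (fun y => 1 - Θ y) =ᶠ[𝓝 x] fun _ => 0) := by
  by_cases hxU : x ∈ U
  · right
    have hnear : Θ =ᶠ[𝓝 x] fun _ => 1 := by
      filter_upwards [hU.mem_nhds hxU] with y hy using hΘU y hy
    refine ⟨Or.inr ?_, ?_⟩
    · rw [hnear.fderiv_eq]; simp
    · filter_upwards [hnear] with y hy
      by_cases hyΩ : y ∈ Ω <;> simp [hyΩ, hy]
  by_cases hxΩ : x ∈ Ω
  · right
    refine ⟨Or.inl hxΩ, ?_⟩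
    filter_upwards [hΩ.mem_nhds hxΩ] with y hy
    simp [hy]
  · left
    refine ⟨hxΩ, ?_⟩
    have hcl : x ∉ closure Ω := by
      intro hx
      exact hxU (hfU ⟨hx, fun hi => hxΩ (interior_subset hi)⟩)
    filter_upwards [isClosed_closure.isOpen_compl.mem_nhds hcl] with y hy
    have : y ∉ Ω := fun h => hy (subset_closure h)
    simp [this]

theorem contDiff_exterior (hΩ : IsOpen Ω) (hU : IsOpen U) (hfU : frontier Ω ⊆ U)
    (hΘ : ContDiff ℝ 1 Θ) (hΘU : ∀ x ∈ U, Θ x = 1) :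
    ContDiff ℝ 1 (Ωᶜ.indicator fun y => 1 - Θ y) := by
  rw [contDiff_iff_contDiffAt]
  intro x
  rcases exterior_cases hΩ hU hfU hΘU x with ⟨-, h⟩ | ⟨-, h⟩
  · exact (contDiff_const.sub hΘ).contDiffAt.congr_of_eventuallyEq h
  · exact contDiffAt_const.congr_of_eventuallyEq h

theorem fderiv_exterior (hΩ : IsOpen Ω) (hU : IsOpen U) (hfU : frontier Ω ⊆ U)
    (hΘU : ∀ x ∈ U, Θ x = 1) (x : R3) :
    fderiv ℝ (Ωᶜ.indicator fun y => 1 - Θ y) x = -Ωᶜ.indicator (fderiv ℝ Θ) x := by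
  rcases exterior_cases hΩ hU hfU hΘU x with ⟨hx, h⟩ | ⟨hx, h⟩
  · rw [h.fderiv_eq, fderiv_const_sub, indicator_of_mem hx]
  · rw [h.fderiv_eq]
    rcases hx with hx | hx
    · simp [hx]
    · by_cases hxΩ : x ∈ Ω <;> simp [hxΩ, hx]

end ExteriorPart

theorem Real.smoothTransition.deriv_eq_zero {s : ℝ} (hs : s ∉ Ioo (0 : ℝ) 1) :
    deriv Real.smoothTransition s = 0 := by
  by_cases h0 : s ≤ 0
  · refine IsLocalMin.deriv_eq_zero (Eventually.of_forall fun x => ?_)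
    rw [Real.smoothTransition.zero_of_nonpos h0]
    exact Real.smoothTransition.nonneg x
  · have h1 : 1 ≤ s := by
      by_contra h
      exact hs ⟨not_le.1 h0, not_le.1 h⟩
    refine IsLocalMax.deriv_eq_zero (Eventually.of_forall fun x => ?_)
    rw [Real.smoothTransition.one_of_one_le h1]
    exact Real.smoothTransition.le_one x

theorem Real.smoothTransition.exists_bound_deriv :
    ∃ M : ℝ≥0, ∀ s, ‖deriv Real.smoothTransition s‖ ≤ M := by
  have hc : Continuous (deriv Real.smoothTransition) :=
    (Real.smoothTransition.contDiff (n := 1)).continuous_deriv le_rfl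
  obtain ⟨C, hC⟩ := (isCompact_Icc (a := (0 : ℝ)) (b := 1)).exists_bound_of_continuousOn hc.continuousOn
  refine ⟨C.toNNReal, fun s => ?_⟩
  by_cases hs : s ∈ Ioo (0 : ℝ) 1
  · exact (hC s (Ioo_subset_Icc_self hs)).trans (Real.le_coe_toNNReal _)
  · rw [Real.smoothTransition.deriv_eq_zero hs]; simp

namespace BoundaryPartition

variable {Ω : Set R3} {ι : Type} [Fintype ι] (P : BoundaryPartition Ω ι)

/-- A `C¹` approximation of the indicator function of the complement of `Ω`, with a transition in
a layer of width `ξ` inside `Ω`. -/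
noncomputable def cutoff (ξ : ℝ) (y : R3) : ℝ :=
  ∑ k, P.weight k y * (1 - Real.smoothTransition ((P.chart k).height y / ξ)) +
    Ωᶜ.indicator (fun y => 1 - ∑ k, P.weight k y) y

/-- The bounded part of the differential of the cutoff. -/
noncomputable def regularPart (ξ : ℝ) (y : R3) : R3 →L[ℝ] ℝ :=
  ∑ k, (1 - Real.smoothTransition ((P.chart k).height y / ξ)) • fderiv ℝ (P.weight k) y -
    Ωᶜ.indicator (fun y => ∑ k, fderiv ℝ (P.weight k) y) y

theorem tsupport_subset_ball (k : ι) :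
    tsupport (P.weight k) ⊆ Metric.ball (P.chart k).center (P.chart k).radius :=
  (P.tsupport_subset k).trans (Metric.ball_subset_ball (by
    have := (P.chart k).radius_pos; linarith))

theorem contDiff_profile (k : ι) (ξ : ℝ) :
    ContDiff ℝ 1 fun y => Real.smoothTransition ((P.chart k).height y / ξ) :=
  Real.smoothTransition.contDiff.comp (((P.chart k).contDiff_height.of_le (by norm_num)).div_const ξ)

theorem contDiff_cutoff (hΩ : IsOpen Ω) (ξ : ℝ) : ContDiff ℝ 1 (P.cutoff ξ) := by
  refine ContDiff.add (ContDiff.sum fun k _ => (P.contDiff_weight k).mul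
    (contDiff_const.sub (P.contDiff_profile k ξ))) ?_
  exact contDiff_exterior hΩ P.isOpen_nhd P.frontier_subset
    (ContDiff.sum fun k _ => P.contDiff_weight k) P.sum_weight_eq_one

theorem profile_eq_zero {k : ι} {y : R3} (hy : y ∈ tsupport (P.weight k)) (hyΩ : y ∉ Ω) {ξ : ℝ}
    (hξ : 0 < ξ) : Real.smoothTransition ((P.chart k).height y / ξ) = 0 := by
  rw [(P.chart k).mem_iff_height (P.tsupport_subset_ball k hy), not_lt] at hyΩ
  exact Real.smoothTransition.zero_of_nonpos (div_nonpos_of_nonpos_of_nonneg hyΩ hξ.le)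

theorem eventually_profile_eq_one {k : ι} {y : R3} (hy : y ∈ tsupport (P.weight k)) (hyΩ : y ∈ Ω) :
    ∀ᶠ ξ in 𝓝[>] (0 : ℝ), Real.smoothTransition ((P.chart k).height y / ξ) = 1 := by
  rw [(P.chart k).mem_iff_height (P.tsupport_subset_ball k hy)] at hyΩ
  filter_upwards [Ioo_mem_nhdsGT hyΩ] with ξ hξ
  refine Real.smoothTransition.one_of_one_le ?_
  rw [one_le_div hξ.1]
  exact hξ.2.le

theorem cutoff_eq_one {y : R3} (hy : y ∉ Ω) {ξ : ℝ} (hξ : 0 < ξ) : P.cutoff ξ y = 1 := by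
  have : ∀ k, P.weight k y * (1 - Real.smoothTransition ((P.chart k).height y / ξ)) = P.weight k y := by
    intro k
    by_cases hk : y ∈ tsupport (P.weight k)
    · rw [P.profile_eq_zero hk hy hξ]; ring
    · rw [image_eq_zero_of_notMem_tsupport hk]; ring
  simp only [cutoff, this]
  rw [indicator_of_mem (show y ∈ Ωᶜ from hy)]
  ring

theorem eventually_cutoff_eq_zero {y : R3} (hy : y ∈ Ω) :
    ∀ᶠ ξ in 𝓝[>] (0 : ℝ), P.cutoff ξ y = 0 := by
  have : ∀ᶠ ξ in 𝓝[>] (0 : ℝ), ∀ k,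
      P.weight k y * (1 - Real.smoothTransition ((P.chart k).height y / ξ)) = 0 := by
    rw [eventually_all]
    intro k
    by_cases hk : y ∈ tsupport (P.weight k)
    · filter_upwards [P.eventually_profile_eq_one hk hy] with ξ hξ
      rw [hξ]; ring
    · refine Eventually.of_forall fun ξ => ?_
      rw [image_eq_zero_of_notMem_tsupport hk]; ring
  filter_upwards [this] with ξ hξ
  simp [cutoff, hξ, hy]

theorem abs_cutoff_le_one {ξ : ℝ} (hξ : 0 < ξ) (y : R3) : |P.cutoff ξ y| ≤ 1 := by
  by_cases hy : y ∈ Ω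
  · have h0 : ∀ k, 0 ≤ P.weight k y * (1 - Real.smoothTransition ((P.chart k).height y / ξ)) :=
      fun k => mul_nonneg (P.weight_nonneg k y) (sub_nonneg.2 (Real.smoothTransition.le_one _))
    have h1 : ∀ k, P.weight k y * (1 - Real.smoothTransition ((P.chart k).height y / ξ)) ≤
        P.weight k y := fun k => mul_le_of_le_one_right (P.weight_nonneg k y)
          (by linarith [Real.smoothTransition.nonneg ((P.chart k).height y / ξ)])
    have e : P.cutoff ξ y =
        ∑ k, P.weight k y * (1 - Real.smoothTransition ((P.chart k).height y / ξ)) := by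
      simp [cutoff, hy]
    rw [e, abs_of_nonneg (Finset.sum_nonneg fun k _ => h0 k)]
    exact (Finset.sum_le_sum fun k _ => h1 k).trans (P.sum_weight_le_one y)
  · rw [P.cutoff_eq_one hy hξ]; simp

theorem fderiv_cutoff (hΩ : IsOpen Ω) (ξ : ℝ) (y : R3) :
    fderiv ℝ (P.cutoff ξ) y = P.regularPart ξ y - ∑ k, (P.weight k y *
      (deriv Real.smoothTransition ((P.chart k).height y / ξ) * ξ⁻¹)) •
        fderiv ℝ (P.chart k).height y := by
  have h1 : ∀ k, HasFDerivAt (fun y => Real.smoothTransition ((P.chart k).height y / ξ))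
      ((deriv Real.smoothTransition ((P.chart k).height y / ξ) * ξ⁻¹) •
        fderiv ℝ (P.chart k).height y) y := by
    intro k
    have hst : HasDerivAt Real.smoothTransition
        (deriv Real.smoothTransition ((P.chart k).height y / ξ)) ((P.chart k).height y / ξ) :=
      ((Real.smoothTransition.contDiff (n := 1)).differentiable one_ne_zero _).hasDerivAt
    have hh : HasFDerivAt (fun y => (P.chart k).height y / ξ)
        (ξ⁻¹ • fderiv ℝ (P.chart k).height y) y := by
      simp only [div_eq_inv_mul]
      exact (((P.chart k).contDiff_height.differentiable (by norm_num) y).hasFDerivAt.const_mul ξ⁻¹)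
    have := hst.comp_hasFDerivAt y hh
    rwa [smul_smul] at this
  have hw : ∀ k, HasFDerivAt (P.weight k) (fderiv ℝ (P.weight k) y) y := fun k =>
    ((P.contDiff_weight k).differentiable one_ne_zero y).hasFDerivAt
  have h2 := fun k => (hw k).mul ((h1 k).const_sub 1)
  have h3 := HasFDerivAt.fun_sum (u := Finset.univ) fun k _ => h2 k
  have hΘ : ContDiff ℝ 1 fun y => ∑ k, P.weight k y := ContDiff.sum fun k _ => P.contDiff_weight k
  have h4 : HasFDerivAt (Ωᶜ.indicator fun y => 1 - ∑ k, P.weight k y)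
      (-Ωᶜ.indicator (fderiv ℝ fun y => ∑ k, P.weight k y) y) y := by
    rw [← fderiv_exterior hΩ P.isOpen_nhd P.frontier_subset P.sum_weight_eq_one]
    exact ((contDiff_exterior hΩ P.isOpen_nhd P.frontier_subset hΘ
      P.sum_weight_eq_one).differentiable one_ne_zero y).hasFDerivAt
  have h5 : (fderiv ℝ fun y => ∑ k, P.weight k y) = fun y => ∑ k, fderiv ℝ (P.weight k) y := by
    ext1 z
    exact (HasFDerivAt.fun_sum (u := Finset.univ) fun k _ =>
      ((P.contDiff_weight k).differentiable one_ne_zero z).hasFDerivAt).fderiv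
  rw [h5] at h4
  have h6 : HasFDerivAt (P.cutoff ξ) _ y := h3.add h4
  rw [h6.fderiv, regularPart, Finset.sum_add_distrib]
  simp only [smul_neg, Finset.sum_neg_distrib, smul_smul]
  abel

/-- Off `Ω` every profile is zero on the support of its weight, so the two sums in the definition
cancel. -/
theorem regularPart_eq_zero {y : R3} (hy : y ∉ Ω) {ξ : ℝ} (hξ : 0 < ξ) : P.regularPart ξ y = 0 := by
  have : ∀ k, (1 - Real.smoothTransition ((P.chart k).height y / ξ)) • fderiv ℝ (P.weight k) y =
      fderiv ℝ (P.weight k) y := by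
    intro k
    by_cases hk : y ∈ tsupport (P.weight k)
    · rw [P.profile_eq_zero hk hy hξ]; simp
    · rw [image_eq_zero_of_notMem_tsupport fun h => hk (tsupport_fderiv_subset ℝ h)]; simp
  simp only [regularPart, this]
  rw [indicator_of_mem (show y ∈ Ωᶜ from hy), sub_self]

/-- Together with the bound uniform in `ξ`, this removes the gradients of the weights by dominated
convergence; Hardy's inequality is needed for the singular part only. -/
theorem eventually_regularPart_eq_zero (y : R3) :
    ∀ᶠ ξ in 𝓝[>] (0 : ℝ), P.regularPart ξ y = 0 := by
  by_cases hy : y ∈ Ω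
  · have : ∀ᶠ ξ in 𝓝[>] (0 : ℝ), ∀ k,
        (1 - Real.smoothTransition ((P.chart k).height y / ξ)) • fderiv ℝ (P.weight k) y = 0 := by
      rw [eventually_all]
      intro k
      by_cases hk : y ∈ tsupport (P.weight k)
      · filter_upwards [P.eventually_profile_eq_one hk hy] with ξ hξ
        rw [hξ]; simp
      · refine Eventually.of_forall fun ξ => ?_
        rw [image_eq_zero_of_notMem_tsupport fun h => hk (tsupport_fderiv_subset ℝ h)]; simp
    filter_upwards [this] with ξ hξ
    simp [regularPart, hξ, hy]
  · filter_upwards [self_mem_nhdsWithin] with ξ hξ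
    exact P.regularPart_eq_zero hy hξ

theorem exists_bound_regularPart : ∃ C : ℝ≥0, ∀ ξ > 0, ∀ y, ‖P.regularPart ξ y‖ ≤ C := by
  have h : ∀ k, ∃ C : ℝ≥0, ∀ y, ‖fderiv ℝ (P.weight k) y‖ ≤ C := by
    intro k
    have hcs : HasCompactSupport (P.weight k) :=
      HasCompactSupport.of_support_subset_isCompact (isCompact_closedBall (P.chart k).center
        (P.chart k).radius) ((subset_tsupport _).trans ((P.tsupport_subset_ball k).trans
          Metric.ball_subset_closedBall))
    obtain ⟨C, hC⟩ := ((P.contDiff_weight k).continuous_fderiv one_ne_zero).bounded_above_of_compact_support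
      (hcs.fderiv (𝕜 := ℝ))
    exact ⟨C.toNNReal, fun y => (hC y).trans (Real.le_coe_toNNReal _)⟩
  choose C hC using h
  refine ⟨∑ k, C k, fun ξ hξ y => ?_⟩
  by_cases hy : y ∈ Ω
  · have e : P.regularPart ξ y =
        ∑ k, (1 - Real.smoothTransition ((P.chart k).height y / ξ)) • fderiv ℝ (P.weight k) y := by
      simp [regularPart, hy]
    rw [e]
    push_cast
    refine (norm_sum_le _ _).trans (Finset.sum_le_sum fun k _ => ?_)
    rw [norm_smul]
    have : ‖1 - Real.smoothTransition ((P.chart k).height y / ξ)‖ ≤ 1 := by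
      rw [Real.norm_eq_abs, abs_of_nonneg (sub_nonneg.2 (Real.smoothTransition.le_one _))]
      linarith [Real.smoothTransition.nonneg ((P.chart k).height y / ξ)]
    calc _ ≤ 1 * ‖fderiv ℝ (P.weight k) y‖ := by gcongr
      _ ≤ _ := by rw [one_mul]; exact hC k y
  · rw [P.regularPart_eq_zero hy hξ, norm_zero]; positivity

theorem measurable_regularPart (hΩ : IsOpen Ω) (ξ : ℝ) : Measurable (P.regularPart ξ) := by
  have hc : ∀ k, Continuous (fderiv ℝ (P.weight k)) := fun k =>
    (P.contDiff_weight k).continuous_fderiv one_ne_zero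
  refine Measurable.sub ?_ ?_
  · exact (continuous_finsetSum _ fun k _ =>
      (continuous_const.sub (P.contDiff_profile k ξ).continuous).smul (hc k)).measurable
  · exact (continuous_finsetSum _ fun k _ => hc k).measurable.indicator hΩ.measurableSet.compl

/-- The singular part of the differential lives where the profile is in transition, which lies in
the slab, and has size `1/ξ` along the differential of the height. -/
theorem exists_bound_fderiv_cutoff (hΩ : IsOpen Ω) : ∃ C : ℝ≥0, ∀ ξ > 0,
    (∀ k, ξ ≤ (P.chart k).radius / 2) → ∀ y w, ‖fderiv ℝ (P.cutoff ξ) y w‖ₑ ≤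
      ‖P.regularPart ξ y‖ₑ * ‖w‖ₑ + ∑ k, ((P.chart k).slab ξ).indicator
        (fun y => C * (ENNReal.ofReal ξ)⁻¹ * ‖fderiv ℝ (P.chart k).height y w‖ₑ) y := by
  obtain ⟨M, hM⟩ := Real.smoothTransition.exists_bound_deriv
  refine ⟨M, fun ξ hξ hξr y w => ?_⟩
  rw [P.fderiv_cutoff hΩ, _root_.sub_apply]
  refine enorm_sub_le.trans (add_le_add (ContinuousLinearMap.le_opENorm _ _) ?_)
  rw [_root_.sum_apply]
  refine (enorm_sum_le _ _).trans (Finset.sum_le_sum fun k _ => ?_)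
  rw [_root_.smul_apply, enorm_smul]
  by_cases hs : y ∈ (P.chart k).slab ξ
  · rw [indicator_of_mem hs, enorm_mul, enorm_mul]
    have h1 : ‖P.weight k y‖ₑ ≤ 1 := by
      rw [Real.enorm_of_nonneg (P.weight_nonneg k y), ENNReal.ofReal_le_one]
      exact (Finset.single_le_sum (fun j _ => P.weight_nonneg j y) (Finset.mem_univ k)).trans
        (P.sum_weight_le_one y)
    have h2 : ‖deriv Real.smoothTransition ((P.chart k).height y / ξ)‖ₑ ≤ M := by
      rw [enorm_le_coe]; exact hM _
    have h3 : ‖ξ⁻¹‖ₑ = (ENNReal.ofReal ξ)⁻¹ := by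
      rw [Real.enorm_of_nonneg (by positivity), ENNReal.ofReal_inv_of_pos hξ]
    rw [h3]
    calc _ ≤ 1 * (M * (ENNReal.ofReal ξ)⁻¹) * ‖fderiv ℝ (P.chart k).height y w‖ₑ := by gcongr
      _ = _ := by rw [one_mul]
  · rw [indicator_of_notMem hs]
    by_cases hk : y ∈ tsupport (P.weight k)
    -- A point of the support at height below `ξ` would lie in the slab: the support is in the ball
    -- of half the radius and `ξ` is at most the other half, so the foot of the vertical through the
    -- point is still in the chart.
    · have hd : (P.chart k).height y / ξ ∉ Ioo (0 : ℝ) 1 := by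
        intro hd
        have hh : (P.chart k).height y ∈ Ioo 0 ξ :=
          ⟨by simpa [hξ] using (div_pos_iff_of_pos_right hξ).1 hd.1, (div_lt_one hξ).1 hd.2⟩
        refine hs ⟨?_, hh⟩
        have hb : dist y (P.chart k).center < (P.chart k).radius / 2 := P.tsupport_subset k hk
        have hn := (P.chart k).norm_param_sub ((P.chart k).proj y) ((P.chart k).height y)
        rw [(P.chart k).param_proj_height, abs_of_pos hh.1, ← dist_eq_norm, dist_comm] at hn
        have := dist_triangle ((P.chart k).param ((P.chart k).proj y) 0) y (P.chart k).center
        have := hξr k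
        rw [BoundaryChart.base, mem_ofPred_eq, Metric.mem_ball]
        linarith [hh.2]
      rw [Real.smoothTransition.deriv_eq_zero hd]
      simp
    · rw [image_eq_zero_of_notMem_tsupport hk]; simp

end BoundaryPartition

/-! ### Flux through the boundary layer at a fixed time -/

theorem ENNReal.le_mul_rpow_half_of_sq_le {a b N : ℝ≥0∞} (h : a ^ 2 ≤ b ^ 2 * N) :
    a ≤ b * N ^ (1 / 2 : ℝ) := by
  refine (ENNReal.pow_le_pow_left_iff two_ne_zero).1 (h.trans_eq ?_)
  rw [mul_pow, ← ENNReal.rpow_natCast (N ^ (1 / 2 : ℝ)), ← ENNReal.rpow_mul]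
  norm_num

theorem Continuous.aestronglyMeasurable_clm_apply {E F : Type*} [NormedAddCommGroup E]
    [NormedSpace ℝ E] [NormedAddCommGroup F] [NormedSpace ℝ F] [FiniteDimensional ℝ E]
    [FiniteDimensional ℝ F] {A : R3 → E →L[ℝ] F} (hA : Continuous A) {w : R3 → E} {μ : Measure R3}
    (hw : AEStronglyMeasurable w μ) : AEStronglyMeasurable (fun x => A x (w x)) μ :=
  (ContinuousLinearMap.id ℝ (E →L[ℝ] F)).aestronglyMeasurable_comp₂ hA.aestronglyMeasurable hw

/-- The slabs decrease to the empty set, since a positive height excludes a point from thin slabs;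
absolute continuity of the integral concludes. -/
theorem BoundaryChart.tendsto_lintegral_preimage_slab {Ω : Set R3} (c : BoundaryChart Ω)
    {Y : R3 → R3} (hY : Continuous Y) {B : Set R3} {n : R3 → ℝ≥0∞}
    (hn : ∫⁻ x in B, n x ≠ ⊤) (hfin : volume B ≠ ⊤) {ξ₀ : ℝ} (hξ₀ : 0 < ξ₀)
    (hB : Y ⁻¹' c.slab ξ₀ ⊆ B) :
    Tendsto (fun ξ => ∫⁻ x in Y ⁻¹' c.slab ξ, n x) (𝓝[>] 0) (𝓝 0) := by
  have hmono : ∀ {i j : ℝ}, i ≤ j → Y ⁻¹' c.slab i ⊆ Y ⁻¹' c.slab j := fun h x hx =>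
    ⟨hx.1, hx.2.1, hx.2.2.trans_le h⟩
  have hm : ∀ r, MeasurableSet (Y ⁻¹' c.slab r) := fun r =>
    hY.measurable (c.isOpen_slab r).measurableSet
  have h1 := tendsto_measure_biInter_gt (μ := volume.restrict B) (a := (0 : ℝ))
    (s := fun r => Y ⁻¹' c.slab r) (fun r _ => (hm r).nullMeasurableSet) (fun i j _ h => hmono h)
    ⟨ξ₀, hξ₀, ((measure_mono (subset_univ _)).trans_lt
      (by simpa using hfin.lt_top)).ne⟩
  have h2 : ⋂ r > (0 : ℝ), Y ⁻¹' c.slab r = ∅ := by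
    rw [eq_empty_iff_forall_notMem]
    intro x hx
    simp only [mem_iInter] at hx
    have h0 := (hx 1 one_pos).2.1
    exact lt_irrefl _ (hx _ h0).2.2
  rw [h2, measure_empty] at h1
  refine (tendsto_setLIntegral_zero hn h1).congr' ?_
  filter_upwards [Ioc_mem_nhdsGT hξ₀] with ξ hξ
  rw [Measure.restrict_restrict (hm ξ), inter_eq_left.2 ((hmono hξ.2).trans hB)]

namespace BoundaryPartition

variable {Ω : Set R3} {ι : Type} [Fintype ι] (P : BoundaryPartition Ω ι)

/-- The factor `1/ξ` of the cutoff cancels the factor `ξ` of Hardy's inequality after Cauchy–Schwarz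
with `σ`. The bounded part of the differential is kept separate because it vanishes for another
reason. -/
theorem exists_lintegral_flux_le (hΩ : IsOpen Ω) (K : ℝ≥0) : ∃ C : ℝ≥0,
    ∀ (S Y V v : R3 → R3) (G : Fin 3 → R3 → R3) (B : Set R3) (σ : R3 → ℝ), IsRegularChange K S Y →
    LipschitzWith K V → IsOpen B → MemW120 B v G → NormalTraceEq B (S '' Ω) v V →
    MemLp σ 2 (volume.restrict B) → ∀ ξ ∈ Ioc (0 : ℝ) 1, (∀ k, ξ ≤ (P.chart k).radius / 2) →
    (∀ k, Y ⁻¹' (P.chart k).slab ξ ⊆ B) →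
    ∫⁻ x in B, ‖σ x * fderiv ℝ (P.cutoff ξ) (Y x) (fderiv ℝ Y x (v x - V x))‖ₑ ≤
      C * ((∫⁻ x in B, ‖σ x‖ₑ * ‖P.regularPart ξ (Y x)‖ₑ * ‖v x - V x‖ₑ) +
        eLpNorm σ 2 (volume.restrict B) * ∑ k, (∫⁻ x in Y ⁻¹' (P.chart k).slab ξ,
          (∑ i, ‖G i x‖ₑ ^ 2 + ‖v x - V x‖ₑ ^ 2 + 1)) ^ (1 / 2 : ℝ)) := by
  obtain ⟨C₁, hC₁⟩ := P.exists_bound_fderiv_cutoff hΩ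
  choose C₂ hC₂ using fun k => (P.chart k).exists_hardy K
  set D : ℝ≥0 := C₁ * ∑ k, (C₂ k + 1) with hD
  refine ⟨K + D, fun S Y V v G B σ h hV hB hv hvt hσ ξ hξ hξr hξB => ?_⟩
  obtain ⟨hvm, hGm, φ, hφ⟩ := hv
  obtain ⟨g, ⟨hg, G', φ', -, hG', hφ', hφg⟩, hgn⟩ := hvt
  -- The trace comes with its own approximating sequence and weak gradient, which must be identified
  -- with the given one.
  have hGG : ∀ i, G i =ᵐ[volume.restrict B] G' i := fun i =>
    ApproxW120.ae_eq hB hvm hGm hG' hφ hφ' i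
  have hξ0 : ENNReal.ofReal ξ ≠ 0 := by simpa using hξ.1
  have hEm : ∀ k, MeasurableSet (Y ⁻¹' (P.chart k).slab ξ) := fun k =>
    h.contDiff_inv.continuous.measurable ((P.chart k).isOpen_slab ξ).measurableSet
  have hwm : AEStronglyMeasurable (fun x => v x - V x) (volume.restrict B) :=
    hvm.1.sub hV.continuous.aestronglyMeasurable
  set N : ι → ℝ≥0∞ := fun k => ∫⁻ x in Y ⁻¹' (P.chart k).slab ξ,
          (∑ i, ‖G i x‖ₑ ^ 2 + ‖v x - V x‖ₑ ^ 2 + 1) with hN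
  have hslab : ∀ k, ∫⁻ x in B, ‖σ x‖ₑ * ((P.chart k).slab ξ).indicator
      (fun y => C₁ * (ENNReal.ofReal ξ)⁻¹ *
        ‖fderiv ℝ (P.chart k).height y (fderiv ℝ Y x (v x - V x))‖ₑ) (Y x) ≤
      (C₁ * (C₂ k + 1)) * (eLpNorm σ 2 (volume.restrict B) * N k ^ (1 / 2 : ℝ)) := by
    intro k
    set E := Y ⁻¹' (P.chart k).slab ξ with hE
    have hle : volume.restrict E ≤ (volume.restrict B : Measure R3) :=
      Measure.restrict_mono (hξB k) le_rfl
    have hH := hC₂ k S Y V v g G' φ' B h hV hvm hG' hφ' hg hgn hφg ξ hξ (hξB k)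
    have hNk : ∫⁻ x in E, (∑ i, ‖G' i x‖ₑ ^ 2 + ‖v x - V x‖ₑ ^ 2 + 1) = N k := by
      refine lintegral_congr_ae ?_
      have := ae_all_iff.2 fun i => (hGG i).filter_mono (ae_mono hle)
      filter_upwards [this] with x hx
      simp [hx]
    rw [hNk] at hH
    have hcm : AEStronglyMeasurable (fun x => (P.chart k).conormal Y x (v x - V x))
        (volume.restrict E) :=
      ((P.chart k).continuous_conormal h.contDiff_inv).aestronglyMeasurable_clm_apply
        (hwm.mono_measure hle)
    have e1 : ∫⁻ x in B, ‖σ x‖ₑ * ((P.chart k).slab ξ).indicator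
        (fun y => C₁ * (ENNReal.ofReal ξ)⁻¹ *
          ‖fderiv ℝ (P.chart k).height y (fderiv ℝ Y x (v x - V x))‖ₑ) (Y x) =
        C₁ * (ENNReal.ofReal ξ)⁻¹ *
          ∫⁻ x in E, ‖σ x‖ₑ * ‖(P.chart k).conormal Y x (v x - V x)‖ₑ := by
      have : ∀ x, ‖σ x‖ₑ * ((P.chart k).slab ξ).indicator
          (fun y => C₁ * (ENNReal.ofReal ξ)⁻¹ *
            ‖fderiv ℝ (P.chart k).height y (fderiv ℝ Y x (v x - V x))‖ₑ) (Y x) =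
          E.indicator (fun x => C₁ * (ENNReal.ofReal ξ)⁻¹ *
            (‖σ x‖ₑ * ‖(P.chart k).conormal Y x (v x - V x)‖ₑ)) x := by
        intro x
        by_cases hx : x ∈ E
        · rw [indicator_of_mem hx, indicator_of_mem (show Y x ∈ (P.chart k).slab ξ from hx)]
          simp only [BoundaryChart.conormal, ContinuousLinearMap.comp_apply]
          ring
        · rw [indicator_of_notMem hx,
            indicator_of_notMem (show Y x ∉ (P.chart k).slab ξ from hx), mul_zero]
      simp only [this]
      rw [lintegral_indicator (hEm k), Measure.restrict_restrict (hEm k),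
        inter_eq_left.2 (hξB k), lintegral_const_mul'' _ ?_]
      exact (hσ.1.mono_measure hle).enorm.mul hcm.enorm
    have hb : eLpNorm (fun x => (P.chart k).conormal Y x (v x - V x)) 2 (volume.restrict E) ≤
        (C₂ k + 1) * ENNReal.ofReal ξ * N k ^ (1 / 2 : ℝ) := by
      refine ENNReal.le_mul_rpow_half_of_sq_le ?_
      rw [← lintegral_enorm_sq_eq]
      refine hH.trans ?_
      rw [mul_pow]
      gcongr
      -- `C₂ k + 1` replaces the square root of `C₂ k`.
      calc (C₂ k : ℝ≥0∞) ≤ (C₂ k + 1) * 1 := by rw [mul_one]; exact le_self_add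
        _ ≤ (C₂ k + 1) * (C₂ k + 1) := by gcongr; exact le_add_self
        _ = _ := (sq _).symm
    rw [e1]
    calc _ ≤ C₁ * (ENNReal.ofReal ξ)⁻¹ * (eLpNorm σ 2 (volume.restrict B) *
          ((C₂ k + 1) * ENNReal.ofReal ξ * N k ^ (1 / 2 : ℝ))) := by
          gcongr
          refine (lintegral_enorm_mul_enorm_le (hσ.1.mono_measure hle) hcm).trans ?_
          gcongr
      _ = ((ENNReal.ofReal ξ)⁻¹ * ENNReal.ofReal ξ) * ((C₁ * (C₂ k + 1)) *
          (eLpNorm σ 2 (volume.restrict B) * N k ^ (1 / 2 : ℝ))) := by ring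
      _ = _ := by rw [ENNReal.inv_mul_cancel hξ0 ENNReal.ofReal_ne_top, one_mul]
  have hrm : AEMeasurable (fun x => ‖σ x‖ₑ * (‖P.regularPart ξ (Y x)‖ₑ *
      ‖fderiv ℝ Y x (v x - V x)‖ₑ)) (volume.restrict B) := by
    have h1 : AEMeasurable (fun x => ‖P.regularPart ξ (Y x)‖ₑ) (volume.restrict B) :=
      ((P.measurable_regularPart hΩ ξ).comp h.contDiff_inv.continuous.measurable).enorm.aemeasurable
    exact hσ.1.enorm.mul (h1.mul ((h.contDiff_inv.continuous_fderiv
      one_ne_zero).aestronglyMeasurable_clm_apply hwm).enorm)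
  calc _ ≤ ∫⁻ x in B, (‖σ x‖ₑ * (‖P.regularPart ξ (Y x)‖ₑ * ‖fderiv ℝ Y x (v x - V x)‖ₑ) +
        ∑ k, ‖σ x‖ₑ * ((P.chart k).slab ξ).indicator (fun y => C₁ * (ENNReal.ofReal ξ)⁻¹ *
          ‖fderiv ℝ (P.chart k).height y (fderiv ℝ Y x (v x - V x))‖ₑ) (Y x)) := by
        refine lintegral_mono fun x => ?_
        rw [enorm_mul, ← Finset.mul_sum, ← mul_add]
        gcongr
        exact hC₁ ξ hξ.1 hξr _ _
    _ = (∫⁻ x in B, ‖σ x‖ₑ * (‖P.regularPart ξ (Y x)‖ₑ * ‖fderiv ℝ Y x (v x - V x)‖ₑ)) +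
        ∑ k, ∫⁻ x in B, ‖σ x‖ₑ * ((P.chart k).slab ξ).indicator
          (fun y => C₁ * (ENNReal.ofReal ξ)⁻¹ *
          ‖fderiv ℝ (P.chart k).height y (fderiv ℝ Y x (v x - V x))‖ₑ) (Y x) := by
        rw [lintegral_add_left' hrm, lintegral_finsetSum']
        intro k _
        have hcm : AEMeasurable (fun x => ‖(P.chart k).conormal Y x (v x - V x)‖ₑ)
            (volume.restrict B) :=
          (((P.chart k).continuous_conormal h.contDiff_inv).aestronglyMeasurable_clm_apply hwm).enorm
        exact hσ.1.enorm.mul ((hcm.const_mul (C₁ * (ENNReal.ofReal ξ)⁻¹)).indicator (hEm k))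
    _ ≤ K * (∫⁻ x in B, ‖σ x‖ₑ * ‖P.regularPart ξ (Y x)‖ₑ * ‖v x - V x‖ₑ) +
        ∑ k, (C₁ * (C₂ k + 1)) * (eLpNorm σ 2 (volume.restrict B) * N k ^ (1 / 2 : ℝ)) := by
        gcongr with k
        · rw [← lintegral_const_mul' _ _ ENNReal.coe_ne_top]
          refine lintegral_mono fun x => ?_
          calc _ ≤ ‖σ x‖ₑ * (‖P.regularPart ξ (Y x)‖ₑ * (K * ‖v x - V x‖ₑ)) := by
                gcongr
                refine (ContinuousLinearMap.le_opENorm _ _).trans ?_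
                gcongr
                rw [enorm_le_coe]
                exact h.norm_fderiv_inv_le x
            _ = _ := by ring
        · exact hslab k
    _ ≤ K * (∫⁻ x in B, ‖σ x‖ₑ * ‖P.regularPart ξ (Y x)‖ₑ * ‖v x - V x‖ₑ) +
        D * (eLpNorm σ 2 (volume.restrict B) * ∑ k, N k ^ (1 / 2 : ℝ)) := by
        rw [Finset.mul_sum, Finset.mul_sum]
        gcongr with k
        have : C₂ k + 1 ≤ ∑ k, (C₂ k + 1) :=
          Finset.single_le_sum (f := fun k => C₂ k + 1) (fun _ _ => zero_le) (Finset.mem_univ k)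
        have : C₁ * (C₂ k + 1) ≤ D := by rw [hD]; gcongr
        exact_mod_cast this
    _ ≤ _ := by
        rw [mul_add]
        push_cast
        gcongr
        · exact le_self_add
        · exact le_add_self

/-- A majorant free of `ξ`, obtained by enlarging the layer to all of `B`, for dominated convergence
in time. -/
theorem exists_lintegral_flux_le_energy (hΩ : IsOpen Ω) (K : ℝ≥0) : ∃ C : ℝ≥0,
    ∀ (S Y V v : R3 → R3) (G : Fin 3 → R3 → R3) (B : Set R3) (σ : R3 → ℝ), IsRegularChange K S Y →
    LipschitzWith K V → IsOpen B → MemW120 B v G → NormalTraceEq B (S '' Ω) v V →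
    MemLp σ 2 (volume.restrict B) → ∀ ξ ∈ Ioc (0 : ℝ) 1, (∀ k, ξ ≤ (P.chart k).radius / 2) →
    (∀ k, Y ⁻¹' (P.chart k).slab ξ ⊆ B) →
    ∫⁻ x in B, ‖σ x * fderiv ℝ (P.cutoff ξ) (Y x) (fderiv ℝ Y x (v x - V x))‖ₑ ≤
      C * (eLpNorm σ 2 (volume.restrict B) *
        (∫⁻ x in B, (∑ i, ‖G i x‖ₑ ^ 2 + ‖v x - V x‖ₑ ^ 2 + 1)) ^ (1 / 2 : ℝ)) := by
  obtain ⟨C, hC⟩ := P.exists_lintegral_flux_le hΩ K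
  obtain ⟨M, hM⟩ := P.exists_bound_regularPart
  refine ⟨C * (M + Fintype.card ι), fun S Y V v G B σ h hV hB hv hvt hσ ξ hξ hξr hξB => ?_⟩
  refine (hC S Y V v G B σ h hV hB hv hvt hσ ξ hξ hξr hξB).trans ?_
  have hwm : AEStronglyMeasurable (fun x => v x - V x) (volume.restrict B) :=
    hv.1.1.sub hV.continuous.aestronglyMeasurable
  set N := ∫⁻ x in B, (∑ i, ‖G i x‖ₑ ^ 2 + ‖v x - V x‖ₑ ^ 2 + 1) with hN
  have hw : eLpNorm (fun x => v x - V x) 2 (volume.restrict B) ≤ 1 * N ^ (1 / 2 : ℝ) := by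
    refine ENNReal.le_mul_rpow_half_of_sq_le ?_
    rw [← lintegral_enorm_sq_eq, one_pow, one_mul]
    exact lintegral_mono fun x => le_add_right le_add_self
  have h1 : ∫⁻ x in B, ‖σ x‖ₑ * ‖P.regularPart ξ (Y x)‖ₑ * ‖v x - V x‖ₑ ≤
      M * (eLpNorm σ 2 (volume.restrict B) * N ^ (1 / 2 : ℝ)) := by
    calc _ ≤ ∫⁻ x in B, M * (‖σ x‖ₑ * ‖v x - V x‖ₑ) := by
          refine lintegral_mono fun x => ?_
          rw [mul_right_comm, mul_comm]
          gcongr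
          rw [enorm_le_coe]
          exact hM ξ hξ.1 _
      _ = M * ∫⁻ x in B, ‖σ x‖ₑ * ‖v x - V x‖ₑ := lintegral_const_mul' _ _ ENNReal.coe_ne_top
      _ ≤ _ := by
          gcongr
          refine (lintegral_enorm_mul_enorm_le hσ.1 hwm).trans ?_
          rw [one_mul] at hw
          gcongr
  calc _ ≤ C * (M * (eLpNorm σ 2 (volume.restrict B) * N ^ (1 / 2 : ℝ)) +
        eLpNorm σ 2 (volume.restrict B) * ∑ _k : ι, N ^ (1 / 2 : ℝ)) := by
        gcongr with k
        exact lintegral_mono_set (hξB k)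
    _ = _ := by
        rw [Finset.sum_const, nsmul_eq_mul, Finset.card_univ]
        push_cast
        ring

theorem tendsto_lintegral_flux (hΩ : IsOpen Ω) {K : ℝ≥0} {S Y V v : R3 → R3}
    {G : Fin 3 → R3 → R3} {B : Set R3} {σ : R3 → ℝ} (h : IsRegularChange K S Y)
    (hV : LipschitzWith K V) (hB : IsOpen B) (hBfin : volume B ≠ ⊤)
    (hVm : MemLp V 2 (volume.restrict B)) (hv : MemW120 B v G)
    (hvt : NormalTraceEq B (S '' Ω) v V) (hσ : MemLp σ 2 (volume.restrict B)) {ξ₀ : ℝ}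
    (hξ₀ : ξ₀ ∈ Ioc (0 : ℝ) 1) (hξr : ∀ k, ξ₀ ≤ (P.chart k).radius / 2)
    (hξB : ∀ ξ ∈ Ioc 0 ξ₀, ∀ k, Y ⁻¹' (P.chart k).slab ξ ⊆ B) :
    Tendsto (fun ξ => ∫⁻ x in B,
      ‖σ x * fderiv ℝ (P.cutoff ξ) (Y x) (fderiv ℝ Y x (v x - V x))‖ₑ) (𝓝[>] 0) (𝓝 0) := by
  obtain ⟨C, hC⟩ := P.exists_lintegral_flux_le hΩ K
  obtain ⟨M, hM⟩ := P.exists_bound_regularPart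
  have hw : MemLp (fun x => v x - V x) 2 (volume.restrict B) := hv.1.sub hVm
  have hsq : ∀ {f : R3 → R3}, MemLp f 2 (volume.restrict B) → ∫⁻ x in B, ‖f x‖ₑ ^ 2 < ⊤ := by
    intro f hf
    rw [lintegral_enorm_sq_eq]
    exact ENNReal.pow_lt_top hf.2
  have hN : ∫⁻ x in B, (∑ i, ‖G i x‖ₑ ^ 2 + ‖v x - V x‖ₑ ^ 2 + 1) ≠ ⊤ := by
    rw [lintegral_add_right _ measurable_const, lintegral_add_right' _ (hw.1.enorm.pow_const _),
      lintegral_finsetSum' _ fun i _ => (hv.2.1 i).1.enorm.pow_const _]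
    refine (ENNReal.add_lt_top.2 ⟨ENNReal.add_lt_top.2 ⟨ENNReal.sum_lt_top.2 fun i _ =>
      hsq (hv.2.1 i), hsq hw⟩, ?_⟩).ne
    simpa using hBfin.lt_top
  have hσw : ∫⁻ x in B, ‖σ x‖ₑ * ‖v x - V x‖ₑ ≠ ⊤ :=
    ((lintegral_enorm_mul_enorm_le hσ.1 hw.1).trans_lt (ENNReal.mul_lt_top hσ.2 hw.2)).ne
  have h1 : Tendsto (fun ξ => ∫⁻ x in B, ‖σ x‖ₑ * ‖P.regularPart ξ (Y x)‖ₑ * ‖v x - V x‖ₑ)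
      (𝓝[>] 0) (𝓝 0) := by
    rw [← lintegral_zero (μ := volume.restrict B)]
    refine tendsto_lintegral_filter_of_dominated_convergence'
      (fun x => M * (‖σ x‖ₑ * ‖v x - V x‖ₑ)) ?_ ?_ ?_ ?_
    · refine Eventually.of_forall fun ξ => ?_
      have : AEMeasurable (fun x => ‖P.regularPart ξ (Y x)‖ₑ) (volume.restrict B) :=
        ((P.measurable_regularPart hΩ ξ).comp h.contDiff_inv.continuous.measurable).enorm.aemeasurable
      exact (hσ.1.enorm.mul this).mul hw.1.enorm
    · filter_upwards [self_mem_nhdsWithin] with ξ hξ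
      refine Eventually.of_forall fun x => ?_
      rw [mul_right_comm, mul_comm]
      gcongr
      rw [enorm_le_coe]
      exact hM ξ hξ _
    · rw [lintegral_const_mul' _ _ ENNReal.coe_ne_top]
      exact ENNReal.mul_ne_top ENNReal.coe_ne_top hσw
    · refine Eventually.of_forall fun x => tendsto_const_nhds.congr' ?_
      filter_upwards [P.eventually_regularPart_eq_zero (Y x)] with ξ hξ
      have h0 : ‖P.regularPart ξ (Y x)‖ₑ = 0 := by
        rw [← ofReal_norm, hξ, norm_zero, ENNReal.ofReal_zero]
      rw [h0, mul_zero, zero_mul]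
  have h2 : ∀ k, Tendsto (fun ξ => (∫⁻ x in Y ⁻¹' (P.chart k).slab ξ,
      (∑ i, ‖G i x‖ₑ ^ 2 + ‖v x - V x‖ₑ ^ 2 + 1)) ^ (1 / 2 : ℝ)) (𝓝[>] 0) (𝓝 0) := by
    intro k
    have := ((P.chart k).tendsto_lintegral_preimage_slab h.contDiff_inv.continuous hN hBfin
      hξ₀.1 (hξB ξ₀ ⟨hξ₀.1, le_rfl⟩ k)).ennrpow_const (1 / 2)
    rwa [ENNReal.zero_rpow_of_pos (by norm_num)] at this
  have h3 : Tendsto (fun ξ => C * ((∫⁻ x in B,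
      ‖σ x‖ₑ * ‖P.regularPart ξ (Y x)‖ₑ * ‖v x - V x‖ₑ) +
        eLpNorm σ 2 (volume.restrict B) * ∑ k, (∫⁻ x in Y ⁻¹' (P.chart k).slab ξ,
          (∑ i, ‖G i x‖ₑ ^ 2 + ‖v x - V x‖ₑ ^ 2 + 1)) ^ (1 / 2 : ℝ))) (𝓝[>] 0) (𝓝 0) := by
    have h4 := tendsto_finsetSum (Finset.univ : Finset ι) fun k _ => h2 k
    have h5 := ENNReal.Tendsto.const_mul (a := eLpNorm σ 2 (volume.restrict B)) h4 (Or.inr hσ.2.ne)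
    have h6 := ENNReal.Tendsto.const_mul (a := (C : ℝ≥0∞)) (h1.add h5) (Or.inr ENNReal.coe_ne_top)
    simpa using h6
  refine tendsto_of_tendsto_of_tendsto_of_le_of_le' tendsto_const_nhds h3
    (Eventually.of_forall fun _ => zero_le) ?_
  filter_upwards [Ioc_mem_nhdsGT hξ₀.1] with ξ hξ
  exact hC S Y V v G B σ h hV hB hv hvt hσ ξ ⟨hξ.1, hξ.2.trans hξ₀.2⟩
    (fun k => hξ.2.trans (hξr k)) (hξB ξ hξ)

end BoundaryPartition

/-! ### The weak formulation and transported test functions -/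

/-- The differentials of the test functions of the weak formulation act on space-time vectors
`(1, u)`; the compact support of the test function is immaterial on a bounded set. -/
theorem WeakContinuityEq.integral_eq {T R : ℝ} (hT : 0 < T) (hR : 0 < R) {ρ₀ : R3 → ℝ}
    {ρ : ℝ → R3 → ℝ} {u : ℝ → R3 → R3}
    (h : WeakContinuityEq T (Metric.ball 0 R) ρ₀ ρ u) {ψ : ℝ × R3 → ℝ} (hψ : ContDiff ℝ 1 ψ)
    {τ : ℝ} (hτ : τ ∈ Icc 0 T) :
    ∫ x in Metric.ball 0 R, (ρ τ x * ψ (τ, x) - ρ₀ x * ψ (0, x)) =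
      ∫ t in (0 : ℝ)..τ, ∫ x in Metric.ball 0 R, ρ t x * fderiv ℝ ψ (t, x) (1, u t x) := by
  let κ : ContDiffBump (0 : ℝ) := ⟨T + 1, T + 2, by linarith, by linarith⟩
  let χ : ContDiffBump (0 : R3) := ⟨R, R + 1, hR, by linarith⟩
  let φ : ℝ × R3 → ℝ := fun p => κ p.1 * χ p.2 * ψ p
  have hφ : ContDiff ℝ 1 φ :=
    ((κ.contDiff.comp contDiff_fst).mul (χ.contDiff.comp contDiff_snd)).mul hψ
  have hφc : HasCompactSupport φ := by
    refine HasCompactSupport.intro ((isCompact_closedBall (0 : ℝ) (T + 2)).prod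
      (isCompact_closedBall (0 : R3) (R + 1))) fun p hp => ?_
    rw [mem_prod, not_and_or] at hp
    have : κ p.1 = 0 ∨ χ p.2 = 0 := by
      refine hp.imp (fun h => ?_) fun h => ?_
      · exact κ.zero_of_le_dist (not_le.1 h).le
      · exact χ.zero_of_le_dist (not_le.1 h).le
    rcases this with h | h <;> simp [φ, h]
  have hev : ∀ t ∈ Icc 0 T, ∀ x ∈ Metric.ball (0 : R3) R, φ =ᶠ[𝓝 (t, x)] ψ := by
    intro t ht x hx
    have h1 : (κ : ℝ → ℝ) =ᶠ[𝓝 t] 1 := κ.eventuallyEq_one_of_mem_ball (by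
      rw [mem_ball_zero_iff, Real.norm_eq_abs, abs_of_nonneg ht.1]
      exact ht.2.trans_lt (by simp [κ]))
    have h2 : (χ : R3 → ℝ) =ᶠ[𝓝 x] 1 := χ.eventuallyEq_one_of_mem_ball hx
    filter_upwards [h1.prod_inl_nhds x, h2.prod_inr_nhds t] with p hp hq
    simp [φ, hp, hq]
  have h0 : (0 : ℝ) ∈ Icc 0 T := ⟨le_rfl, hT.le⟩
  have key := h τ hτ φ hφ hφc
  calc _ = ∫ x in Metric.ball 0 R, (ρ τ x * φ (τ, x) - ρ₀ x * φ (0, x)) := by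
        refine setIntegral_congr_fun Metric.isOpen_ball.measurableSet fun x hx => ?_
        simp only [(hev τ hτ x hx).eq_of_nhds, (hev 0 h0 x hx).eq_of_nhds]
    _ = _ := key
    _ = _ := by
        refine intervalIntegral.integral_congr fun t ht => ?_
        rw [uIcc_of_le hτ.1] at ht
        refine setIntegral_congr_fun Metric.isOpen_ball.measurableSet fun x hx => ?_
        simp only [(hev t ⟨ht.1, ht.2.trans hτ.2⟩ x hx).fderiv_eq]
        rw [← mul_add, ← map_add]
        simp

theorem MemLinftyL2.memLp {T : ℝ} {B : Set R3} {ρ : ℝ → R3 → ℝ} (h : MemLinftyL2 T B ρ) :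
    MemLp (Function.uncurry ρ) 2 ((volume.restrict (Ioo 0 T)).prod (volume.restrict B)) := by
  obtain ⟨hm, C, hC⟩ := h
  refine ⟨hm, ?_⟩
  have : eLpNorm (Function.uncurry ρ) 2 ((volume.restrict (Ioo 0 T)).prod (volume.restrict B)) ^ 2
      < ⊤ := by
    rw [← lintegral_enorm_sq_eq, lintegral_prod _ (hm.enorm.pow_const _)]
    calc _ ≤ ∫⁻ _ in Ioo 0 T, (C : ℝ≥0∞) ^ 2 := by
          refine lintegral_mono_ae ?_
          filter_upwards [hC] with t ht
          simp only [Function.uncurry_apply_pair]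
          rw [lintegral_enorm_sq_eq]
          gcongr
      _ < ⊤ := by
          rw [setLIntegral_const]
          exact ENNReal.mul_lt_top (ENNReal.pow_lt_top ENNReal.coe_lt_top) (by simp)
  exact (ENNReal.pow_lt_top_iff.1 this).resolve_right two_ne_zero

theorem MeasureTheory.IntegrableOn.mul_of_abs_le {B : Set R3} {f φ : R3 → ℝ} (hf : IntegrableOn f B)
    (hφ : Continuous φ) {M : ℝ} (hM : ∀ x, |φ x| ≤ M) : IntegrableOn (fun x => f x * φ x) B :=
  Integrable.mul_bdd (c := M) hf hφ.aestronglyMeasurable (Eventually.of_forall hM)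

/-- By the equation, `t ↦ ∫ ρ t φ` is a constant plus a primitive of an integrable function, hence
continuous; for `φ ≥ 0` it is nonnegative at almost every time, hence at every time. -/
theorem WeakContinuityEq.ae_nonneg {T R : ℝ} (hT : 0 < T) (hR : 0 < R) {ρ₀ : R3 → ℝ}
    {ρ : ℝ → R3 → ℝ} {u : ℝ → R3 → R3} (h : WeakContinuityEq T (Metric.ball 0 R) ρ₀ ρ u)
    (hρ₀ : IntegrableOn ρ₀ (Metric.ball 0 R)) (hρ : MemLinftyL2 T (Metric.ball 0 R) ρ)
    (hρ_int : ∀ τ ∈ Icc 0 T, IntegrableOn (ρ τ) (Metric.ball 0 R))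
    (hρ_nonneg : ∀ᵐ t ∂(volume.restrict (Ioo 0 T)),
      ∀ᵐ x ∂(volume.restrict (Metric.ball 0 R)), 0 ≤ ρ t x)
    (hu : MemL2W120 T (Metric.ball 0 R) u) {τ : ℝ} (hτ : τ ∈ Icc 0 T) :
    ∀ᵐ x ∂(volume.restrict (Metric.ball 0 R)), 0 ≤ ρ τ x := by
  refine ae_nonneg_of_forall_integral_contDiff_nonneg Metric.isOpen_ball.measurableSet
    (hρ_int τ hτ) fun φ hφ hφc hφ0 => ?_
  obtain ⟨G, hum, -, -⟩ := hu
  obtain ⟨M, hM⟩ := hφc.exists_bound_of_continuous hφ.continuous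
  set F : ℝ → ℝ := fun t => ∫ x in Metric.ball 0 R, ρ t x * fderiv ℝ φ x (u t x) with hF
  have hFint : IntegrableOn F (Icc 0 T) := by
    obtain ⟨D, hD⟩ := (hφc.fderiv ℝ).exists_bound_of_continuous (hφ.continuous_fderiv one_ne_zero)
    have h1 : MemLp (fun p : ℝ × R3 => fderiv ℝ φ p.2 (u p.1 p.2)) 2
        ((volume.restrict (Ioo 0 T)).prod (volume.restrict (Metric.ball 0 R))) := by
      refine MemLp.of_le_mul (c := D) hum ?_ (Eventually.of_forall fun p => ?_)
      · exact (ContinuousLinearMap.id ℝ (R3 →L[ℝ] ℝ)).aestronglyMeasurable_comp₂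
          ((hφ.continuous_fderiv one_ne_zero).comp continuous_snd).aestronglyMeasurable hum.1
      · exact ContinuousLinearMap.le_of_opNorm_le _ (hD _) _
    rw [integrableOn_Icc_iff_integrableOn_Ioo]
    exact (integrable_smul_of_memLp_two hρ.memLp h1).integral_prod_left
  have hψ : ContDiff ℝ 1 fun p : ℝ × R3 => φ p.2 := hφ.comp contDiff_snd
  have heq : ∀ t ∈ Icc 0 T, ∫ x in Metric.ball 0 R, ρ t x * φ x =
      (∫ x in Metric.ball 0 R, ρ₀ x * φ x) + ∫ s in (0 : ℝ)..t, F s := by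
    intro t ht
    have h1 := h.integral_eq hT hR hψ ht
    rw [integral_sub ((hρ_int t ht).mul_of_abs_le hφ.continuous hM)
      (hρ₀.mul_of_abs_le hφ.continuous hM), sub_eq_iff_eq_add'] at h1
    rw [h1]
    congr 1
    refine intervalIntegral.integral_congr fun s _ => ?_
    refine integral_congr_ae (Eventually.of_forall fun x => ?_)
    have h2 : HasFDerivAt (fun p : ℝ × R3 => φ p.2)
        (fderiv ℝ φ x ∘L ContinuousLinearMap.snd ℝ ℝ R3) (s, x) :=
      (hφ.differentiable one_ne_zero x).hasFDerivAt.comp (s, x) hasFDerivAt_snd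
    simp only [h2.fderiv]
    rfl
  set g : ℝ → ℝ := fun t => (∫ x in Metric.ball 0 R, ρ₀ x * φ x) + ∫ s in (0 : ℝ)..t, F s with hg
  have hgc : ContinuousOn g (Icc 0 T) := by
    have := intervalIntegral.continuousOn_primitive_interval (f := F) (μ := volume) (a := 0)
      (b := T) (by rwa [uIcc_of_le hT.le])
    rw [uIcc_of_le hT.le] at this
    exact continuousOn_const.add this
  -- Nonnegativity is phrased as `g = max g 0`, an almost everywhere equality of continuous
  -- functions, which holds everywhere on the interval.
  have hgae : g =ᵐ[volume.restrict (Icc 0 T)] fun t => max (g t) 0 := by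
    rw [← restrict_Ioo_eq_restrict_Icc]
    filter_upwards [hρ_nonneg, ae_restrict_mem measurableSet_Ioo] with t ht htT
    rw [max_eq_left]
    simp only [hg]
    rw [← heq t (Ioo_subset_Icc_self htT)]
    refine integral_nonneg_of_ae ?_
    filter_upwards [ht] with x hx using mul_nonneg hx (hφ0 x)
  have := Measure.eqOn_Icc_of_ae_eq volume hT.ne hgae hgc (hgc.sup continuousOn_const) hτ
  rw [heq τ hτ]
  exact (le_max_right _ _).trans_eq this.symm

theorem IsRegularChange.mono {K K' : ℝ≥0} {S Y : R3 → R3} (h : IsRegularChange K S Y)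
    (hK : K ≤ K') : IsRegularChange K' S Y where
  left_inv := h.left_inv
  right_inv := h.right_inv
  contDiff := h.contDiff
  contDiff_inv := h.contDiff_inv
  lipschitz := h.lipschitz.weaken hK
  lipschitz_inv := h.lipschitz_inv.weaken hK
  lipschitz_fderiv_inv := h.lipschitz_fderiv_inv.weaken hK

theorem BoundaryChart.norm_lt_of_mem_slab {Ω : Set R3} (c : BoundaryChart Ω) {R ξ : ℝ}
    (hc : ‖c.center‖ < R) {y : R3} (hy : y ∈ c.slab ξ) : ‖y‖ < R + c.radius + ξ := by
  have h1 : ‖c.param (c.proj y) 0 - c.center‖ < c.radius := mem_ball_iff_norm.1 hy.1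
  have h2 := c.norm_param_sub (c.proj y) (c.height y)
  rw [c.param_proj_height, abs_of_pos hy.2.1] at h2
  have h3 : y = (y - c.param (c.proj y) 0) + (c.param (c.proj y) 0 - c.center) + c.center := by
    abel
  have h4 := norm_add₃_le (a := y - c.param (c.proj y) 0) (b := c.param (c.proj y) 0 - c.center)
    (c := c.center)
  rw [← h3] at h4
  linarith [hy.2.2]

/-- Split `(1, v) = (1, V) + (0, v - V)`; the differential of `Y` annihilates the first summand. -/
theorem IsRegularFlow.fderiv_comp {T : ℝ} {K : ℝ≥0} {V X Y : ℝ → R3 → R3}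
    (h : IsRegularFlow T K V X Y) {f : R3 → ℝ} (hf : Differentiable ℝ f) {t : ℝ}
    (ht : t ∈ Icc 0 T) (x v : R3) :
    fderiv ℝ (f ∘ Function.uncurry Y) (t, x) (1, v) =
      fderiv ℝ f (Y t x) (fderiv ℝ (Y t) x (v - V t x)) := by
  have hY := (h.contDiff_inv.differentiable one_ne_zero (t, x)).hasFDerivAt
  have h1 : HasFDerivAt (Y t) (fderiv ℝ (Function.uncurry Y) (t, x) ∘L
      ContinuousLinearMap.inr ℝ ℝ R3) x := hY.comp x (hasFDerivAt_prodMk_right t x)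
  have h2 : HasFDerivAt (f ∘ Function.uncurry Y)
      (fderiv ℝ f (Y t x) ∘L fderiv ℝ (Function.uncurry Y) (t, x)) (t, x) :=
    (hf (Y t x)).hasFDerivAt.comp (t, x) hY
  have h3 : ((1, v) : ℝ × R3) = (1, V t x) + (0, v - V t x) := by simp
  rw [h2.fderiv, h1.fderiv, ContinuousLinearMap.comp_apply, h3, map_add, h.transport t ht x,
    zero_add]
  rfl

/-! ### Dominated convergence in time -/

theorem ENNReal.rpow_half_le_one_add (a : ℝ≥0∞) : a ^ (1 / 2 : ℝ) ≤ 1 + a := by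
  rcases le_total a 1 with h | h
  · exact (ENNReal.rpow_le_one h (by norm_num)).trans le_self_add
  · calc a ^ (1 / 2 : ℝ) ≤ a ^ (1 : ℝ) := ENNReal.rpow_le_rpow_of_exponent_le h (by norm_num)
      _ ≤ 1 + a := by rw [ENNReal.rpow_one]; exact le_add_self

/-- The time-integrability of the energy that controls the flux through the moving boundary. -/
theorem exists_integrable_energy {T : ℝ} {B : Set R3} (hB : volume B ≠ ⊤) {u : ℝ → R3 → R3}
    {G : Fin 3 → ℝ → R3 → R3}
    (hu : MemLp (Function.uncurry u) 2 ((volume.restrict (Ioo 0 T)).prod (volume.restrict B)))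
    (hG : ∀ i, MemLp (Function.uncurry (G i)) 2
      ((volume.restrict (Ioo 0 T)).prod (volume.restrict B))) (L C : ℝ≥0) :
    ∃ b : ℝ → ℝ, IntegrableOn b (Ioo 0 T) ∧ (∀ t, 0 ≤ b t) ∧ ∀ᵐ t ∂(volume.restrict (Ioo 0 T)), ∀ V : R3 → R3,
      (∀ x, ‖V x‖ ≤ L) →
        C * (1 + ∫⁻ x in B, (∑ i, ‖G i t x‖ₑ ^ 2 + ‖u t x - V x‖ₑ ^ 2 + 1)) ≤
          ENNReal.ofReal (b t) := by
  -- Bounding `|u - V|²` by `2|u|² + 2L²` removes `V` from the majorant, so one null set of times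
  -- serves every field bounded by `L`.
  set n : ℝ × R3 → ℝ≥0∞ := fun p =>
    ∑ i, ‖G i p.1 p.2‖ₑ ^ 2 + (2 * ‖u p.1 p.2‖ₑ ^ 2 + 2 * (L : ℝ≥0∞) ^ 2) + 1 with hn
  set μ := (volume.restrict (Ioo 0 T)).prod (volume.restrict B) with hμ
  have hGm : ∀ i, AEMeasurable (fun p : ℝ × R3 => ‖G i p.1 p.2‖ₑ ^ 2) μ := fun i =>
    (hG i).1.enorm.pow_const 2
  have hum : AEMeasurable (fun p : ℝ × R3 => ‖u p.1 p.2‖ₑ ^ 2) μ := hu.1.enorm.pow_const 2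
  have hnm : AEMeasurable n μ :=
    ((Finset.aemeasurable_fun_sum _ fun i _ => hGm i).add
      ((hum.const_mul 2).add_const _)).add_const _
  have hsq : ∀ {f : ℝ → R3 → R3}, MemLp (Function.uncurry f) 2 μ →
      ∫⁻ p, ‖f p.1 p.2‖ₑ ^ 2 ∂μ < ⊤ := by
    intro f hf
    have := lintegral_enorm_sq_eq μ (Function.uncurry f)
    exact this.trans_lt (ENNReal.pow_lt_top hf.2)
  have hμfin : μ univ < ⊤ := by
    rw [hμ, ← univ_prod_univ, Measure.prod_prod]
    simpa using ENNReal.mul_lt_top ENNReal.ofReal_lt_top hB.lt_top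
  have hnfin : ∫⁻ t in Ioo 0 T, ∫⁻ x in B, n (t, x) ≠ ⊤ := by
    rw [← lintegral_prod _ hnm, hn, lintegral_add_right _ measurable_const,
      lintegral_add_right' _ ((hum.const_mul 2).add_const _),
      lintegral_finsetSum' _ fun i _ => hGm i, lintegral_add_right _ measurable_const,
      lintegral_const_mul'' _ hum, lintegral_const, lintegral_const]
    refine (ENNReal.add_lt_top.2 ⟨ENNReal.add_lt_top.2 ⟨ENNReal.sum_lt_top.2 fun i _ =>
      hsq (hG i), ENNReal.add_lt_top.2 ⟨ENNReal.mul_lt_top (by simp) (hsq hu),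
        ENNReal.mul_lt_top (by finiteness) hμfin⟩⟩, ENNReal.mul_lt_top (by simp) hμfin⟩).ne
  have hNm : AEMeasurable (fun t => ∫⁻ x in B, n (t, x)) (volume.restrict (Ioo 0 T)) :=
    hnm.lintegral_prod_right'
  have hbm : AEMeasurable (fun t => C * (1 + ∫⁻ x in B, n (t, x))) (volume.restrict (Ioo 0 T)) :=
    (hNm.const_add 1).const_mul _
  have hbfin : ∫⁻ t in Ioo 0 T, C * (1 + ∫⁻ x in B, n (t, x)) ≠ ⊤ := by
    rw [lintegral_const_mul'' _ (hNm.const_add 1), lintegral_add_left measurable_const]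
    refine ENNReal.mul_ne_top ENNReal.coe_ne_top (ENNReal.add_ne_top.2 ⟨?_, hnfin⟩)
    simp
  refine ⟨fun t => (C * (1 + ∫⁻ x in B, n (t, x))).toReal,
    integrable_toReal_of_lintegral_ne_top hbm hbfin, fun t => ENNReal.toReal_nonneg, ?_⟩
  filter_upwards [ae_lt_top' hbm hbfin] with t ht V hV
  rw [ENNReal.ofReal_toReal ht.ne]
  gcongr with x
  simp only [hn]
  gcongr
  refine (enorm_sq_le_two_mul (u t x - V x) (u t x)).trans ?_
  rw [sub_sub_cancel_left, enorm_neg]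
  gcongr
  rw [enorm_le_coe]
  exact hV x

/-- As the collar shrinks, the transported cut-offs carry no flux through the moving boundary. -/
theorem BoundaryPartition.tendsto_integral_transport {Ω : Set R3} {ι : Type} [Fintype ι]
    (P : BoundaryPartition Ω ι) (hΩ : IsOpen Ω) {T : ℝ} {K L : ℝ≥0} {B : Set R3} (hB : IsOpen B)
    (hBfin : volume B ≠ ⊤) {V X Y : ℝ → R3 → R3} (hV : IsRegularField T L V)
    (hY : IsRegularFlow T K V X Y) {ρ : ℝ → R3 → ℝ} (hρ : MemLinftyL2 T B ρ) {u : ℝ → R3 → R3}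
    (hu : MemL2W120 T B u)
    (htrace : ∀ᵐ t ∂(volume.restrict (Ioo 0 T)), NormalTraceEq B (X t '' Ω) (u t) (V t)) {ξ₀ : ℝ}
    (hξ₀ : ξ₀ ∈ Ioc (0 : ℝ) 1) (hξr : ∀ k, ξ₀ ≤ (P.chart k).radius / 2)
    (hξB : ∀ t ∈ Icc 0 T, ∀ ξ ∈ Ioc 0 ξ₀, ∀ k, Y t ⁻¹' (P.chart k).slab ξ ⊆ B) {τ : ℝ}
    (hτ : τ ∈ Icc 0 T) :
    Tendsto (fun ξ => ∫ t in (0 : ℝ)..τ, ∫ x in B,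
      ρ t x * fderiv ℝ (P.cutoff ξ ∘ Function.uncurry Y) (t, x) (1, u t x)) (𝓝[>] 0) (𝓝 0) := by
  obtain ⟨G, hum, hGm, hu⟩ := hu
  -- A single number bounds the flow maps, their inverses and the field, so `C` does not depend on
  -- time.
  obtain ⟨C, hC⟩ := P.exists_lintegral_flux_le_energy hΩ (max K L)
  obtain ⟨D, hD⟩ := hρ.2
  obtain ⟨b, hb, hb0, hbN⟩ := exists_integrable_energy hBfin hum hGm L (C * D)
  have hchange : ∀ t ∈ Icc 0 T, IsRegularChange (max K L) (X t) (Y t) := fun t ht =>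
    (hY.isRegularChange ht).mono (le_max_left _ _)
  have hlip : ∀ t ∈ Icc 0 T, LipschitzWith (max K L) (V t) := fun t ht =>
    (hV.lipschitz t ht).weaken (le_max_right _ _)
  have hφ : ∀ ξ, ContDiff ℝ 1 (P.cutoff ξ ∘ Function.uncurry Y) := fun ξ =>
    (P.contDiff_cutoff hΩ ξ).comp hY.contDiff_inv
  have : Fact (volume B < ⊤) := ⟨hBfin.lt_top⟩
  set H : ℝ → ℝ → ℝ := fun ξ t => ∫ x in B,
      ρ t x * fderiv ℝ (P.cutoff ξ ∘ Function.uncurry Y) (t, x) (1, u t x) with hH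
  have hHle : ∀ ξ, ∀ t ∈ Icc 0 T, ‖H ξ t‖ₑ ≤ ∫⁻ x in B,
      ‖ρ t x * fderiv ℝ (P.cutoff ξ) (Y t x) (fderiv ℝ (Y t) x (u t x - V t x))‖ₑ := by
    intro ξ t ht
    refine (enorm_integral_le_lintegral_enorm _).trans_eq ?_
    simp only [hY.fderiv_comp ((P.contDiff_cutoff hΩ ξ).differentiable one_ne_zero) ht]
  have hle : volume.restrict (uIoc 0 τ) ≤ (volume.restrict (Ioo 0 T) : Measure ℝ) := by
    rw [restrict_Ioo_eq_restrict_Ioc, uIoc_of_le hτ.1]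
    exact Measure.restrict_mono (Ioc_subset_Ioc_right hτ.2) le_rfl
  have hcore : ∀ᵐ t ∂(volume.restrict (Ioo 0 T)),
      (∀ ξ ∈ Ioc 0 ξ₀, ‖H ξ t‖ ≤ b t) ∧ Tendsto (fun ξ => H ξ t) (𝓝[>] 0) (𝓝 0) := by
    filter_upwards [hD, hρ.1.prodMk_left, hbN, hu, htrace, ae_restrict_mem measurableSet_Ioo]
      with t htD htm htb htu htt htI
    have ht : t ∈ Icc 0 T := Ioo_subset_Icc_self htI
    have hσ : MemLp (ρ t) 2 (volume.restrict B) := ⟨htm, htD.trans_lt ENNReal.coe_lt_top⟩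
    refine ⟨fun ξ hξ => ?_, ?_⟩
    · have h1 := hC (X t) (Y t) (V t) (u t) (fun i => G i t) B (ρ t) (hchange t ht) (hlip t ht) hB
        htu htt hσ ξ ⟨hξ.1, hξ.2.trans hξ₀.2⟩ (fun k => hξ.2.trans (hξr k)) (hξB t ht ξ hξ)
      have h2 : ‖H ξ t‖ₑ ≤ ENNReal.ofReal (b t) := by
        refine ((hHle ξ t ht).trans h1).trans (le_trans ?_ (htb (V t) (hV.norm_le t ht)))
        push_cast
        rw [mul_assoc]
        gcongr
        exact ENNReal.rpow_half_le_one_add _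
      rw [← ofReal_norm] at h2
      exact (ENNReal.ofReal_le_ofReal_iff (hb0 t)).1 h2
    · rw [tendsto_zero_iff_enorm_tendsto_zero]
      refine tendsto_of_tendsto_of_tendsto_of_le_of_le tendsto_const_nhds
        (P.tendsto_lintegral_flux hΩ (hchange t ht) (hlip t ht) hB hBfin ?_ htu htt hσ hξ₀ hξr
          (hξB t ht)) (fun _ => zero_le) fun ξ => hHle ξ t ht
      exact MemLp.of_bound (hV.lipschitz t ht).continuous.aestronglyMeasurable L
        (Eventually.of_forall (hV.norm_le t ht))
  have h0 : ∫ _ in (0 : ℝ)..τ, (0 : ℝ) = 0 := by simp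
  suffices Tendsto (fun ξ => ∫ t in (0 : ℝ)..τ, H ξ t) (𝓝[>] 0) (𝓝 (∫ _ in (0 : ℝ)..τ, (0 : ℝ))) by
    rwa [h0] at this
  refine intervalIntegral.tendsto_integral_filter_of_dominated_convergence b ?_ ?_ ?_ ?_
  · refine Eventually.of_forall fun ξ => AEStronglyMeasurable.mono_measure ?_ hle
    refine AEStronglyMeasurable.integral_prod_right' (f := fun p : ℝ × R3 =>
      ρ p.1 p.2 * fderiv ℝ (P.cutoff ξ ∘ Function.uncurry Y) p (1, u p.1 p.2)) (hρ.1.mul ?_)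
    exact (ContinuousLinearMap.id ℝ (ℝ × R3 →L[ℝ] ℝ)).aestronglyMeasurable_comp₂
      ((hφ ξ).continuous_fderiv one_ne_zero).aestronglyMeasurable
      (aestronglyMeasurable_const.prodMk hum.1)
  · filter_upwards [Ioc_mem_nhdsGT hξ₀.1] with ξ hξ
    rw [← ae_restrict_iff' measurableSet_uIoc]
    filter_upwards [ae_mono hle hcore] with t ht using ht.1 ξ hξ
  · rw [intervalIntegrable_iff]
    exact Integrable.mono_measure hb hle
  · rw [← ae_restrict_iff' measurableSet_uIoc]
    filter_upwards [ae_mono hle hcore] with t ht using ht.2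

/-! ### The vacuum outside the moving domain -/

theorem lemma4p1
    (T R : ℝ) (hT : 0 < T) (hR : 0 < R)
    (ν : ℝ≥0) (hν : 0 < ν) (hν1 : ν ≤ 1)
    (Ω₀ : Set R3) (hΩ₀ : IsC2HolderDomain ν Ω₀) (hΩ₀R : closure Ω₀ ⊆ Metric.ball 0 R)
    (V : ℝ → R3 → R3) (hV : IsC1C3c T R V)
    (X : ℝ → R3 → R3) (hX : IsFlow T V X)
    (ρ₀ : R3 → ℝ) (hρ₀ : MemLp ρ₀ 2 volume) (hρ₀_nonneg : ∀ᵐ x, 0 ≤ ρ₀ x)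
    (hρ₀_zero : ∀ᵐ x ∂(volume.restrict (Metric.ball 0 (2 * R) \ Ω₀)), ρ₀ x = 0)
    (ρ : ℝ → R3 → ℝ) (hρ : MemLinftyL2 T (Metric.ball 0 (2 * R)) ρ)
    (hρ_int : ∀ τ ∈ Icc 0 T, IntegrableOn (ρ τ) (Metric.ball 0 (2 * R)) volume)
    (hρ_nonneg : ∀ᵐ t ∂(volume.restrict (Ioo 0 T)),
      ∀ᵐ x ∂(volume.restrict (Metric.ball 0 (2 * R))), 0 ≤ ρ t x)
    (u : ℝ → R3 → R3) (hu : MemL2W120 T (Metric.ball 0 (2 * R)) u)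
    (hcont : WeakContinuityEq T (Metric.ball 0 (2 * R)) ρ₀ ρ u)
    (htrace : ∀ᵐ τ ∂(volume.restrict (Ioo 0 T)),
      NormalTraceEq (Metric.ball 0 (2 * R)) (X τ '' Ω₀) (u τ) (V τ)) :
    ∀ τ ∈ Icc 0 T,
      ∀ᵐ x ∂(volume.restrict (Metric.ball 0 (2 * R) \ (X τ '' Ω₀))), ρ τ x = 0 := by
  have hR2 : 0 < 2 * R := by linarith
  obtain ⟨L, hL, hVL⟩ := hV.exists_isRegularField hT
  obtain ⟨K, Y, hY⟩ := hX.exists_isRegularFlow hT hL hVL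
  obtain ⟨ι, _, P, hP⟩ := hΩ₀.exists_partition (half_pos hR)
  set B := Metric.ball (0 : R3) (2 * R) with hB
  have hBfin : volume B ≠ ⊤ := measure_ball_lt_top.ne
  have : IsFiniteMeasure (volume.restrict B) := ⟨by simpa using hBfin.lt_top⟩
  obtain ⟨ξ₀, ⟨hξ1, hξR, hξr⟩, hξ0⟩ : ∃ ξ₀ : ℝ,
      (ξ₀ ≤ 1 ∧ ξ₀ ≤ R / 2 ∧ ∀ k, ξ₀ ≤ (P.chart k).radius / 2) ∧ 0 < ξ₀ := by
    have hle : ∀ a : ℝ, 0 < a → ∀ᶠ ξ in 𝓝[>] (0 : ℝ), ξ ≤ a := fun a ha => by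
      filter_upwards [Ioc_mem_nhdsGT ha] with ξ hξ using hξ.2
    exact (((hle 1 one_pos).and ((hle _ (half_pos hR)).and (eventually_all.2 fun k =>
      hle _ (half_pos (P.chart k).radius_pos)))).and self_mem_nhdsWithin).exists
  -- Chart centres have norm below `R`, and radius and width are at most `R / 2`, so the slabs lie
  -- in `B`. The flow leaves a point fixed or puts it in the closed ball of radius `R`, so the
  -- transported slabs stay in `B`.
  have hξB : ∀ t ∈ Icc 0 T, ∀ ξ ∈ Ioc 0 ξ₀, ∀ k, Y t ⁻¹' (P.chart k).slab ξ ⊆ B := by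
    intro t ht ξ hξ k x hx
    have hc : ‖(P.chart k).center‖ < R :=
      mem_ball_zero_iff.1 (hΩ₀R (frontier_subset_closure (hP k).1))
    have h1 := (P.chart k).norm_lt_of_mem_slab hc hx
    rw [hB, mem_ball_zero_iff]
    rcases hX.eq_self_or_norm_le hVL.lipschitz hV.2.1 ht (Y t x) with h | h <;>
      rw [hY.right_inv t ht] at h
    · rw [h]
      linarith [(hP k).2, hξ.2]
    · linarith
  have hρ₀B : IntegrableOn ρ₀ B := (hρ₀.restrict B).integrable one_le_two
  intro τ hτ
  have h0 : (0 : ℝ) ∈ Icc 0 T := ⟨le_rfl, hT.le⟩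
  have hY0 : ∀ x, Y 0 x = x := fun x => by simpa [(hX x).1] using hY.left_inv 0 h0 x
  have hnonneg := hcont.ae_nonneg hT hR2 hρ₀B hρ hρ_int hρ_nonneg hu hτ
  have hφ : ∀ ξ, ContDiff ℝ 1 (P.cutoff ξ ∘ Function.uncurry Y) := fun ξ =>
    (P.contDiff_cutoff hΩ₀.isOpen ξ).comp hY.contDiff_inv
  have hlim := P.tendsto_integral_transport hΩ₀.isOpen Metric.isOpen_ball hBfin hVL hY hρ hu htrace
    ⟨hξ0, hξ1⟩ hξr hξB hτ
  -- The vanishing flux becomes a statement about the integrals at times `τ` and 0, whose limit is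
  -- also computed directly from the pointwise limit of the cutoffs.
  simp only [← fun ξ => hcont.integral_eq hT hR2 (hφ ξ) hτ] at hlim
  have hmeas : MeasurableSet (Y τ ⁻¹' Ω₀) :=
    (hY.isRegularChange hτ).contDiff_inv.continuous.measurable hΩ₀.isOpen.measurableSet
  have hpt : ∀ y, Tendsto (fun ξ => P.cutoff ξ y) (𝓝[>] 0) (𝓝 (Ω₀ᶜ.indicator 1 y)) := by
    intro y
    refine tendsto_const_nhds.congr' ?_
    by_cases hy : y ∈ Ω₀
    · filter_upwards [P.eventually_cutoff_eq_zero hy] with ξ hξ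
      simp [hξ, hy]
    · filter_upwards [self_mem_nhdsWithin] with ξ hξ
      simp [P.cutoff_eq_one hy hξ, hy]
  have hlim' : Tendsto (fun ξ => ∫ x in B, (ρ τ x * (P.cutoff ξ ∘ Function.uncurry Y) (τ, x) -
      ρ₀ x * (P.cutoff ξ ∘ Function.uncurry Y) (0, x))) (𝓝[>] 0)
      (𝓝 (∫ x in B, (ρ τ x * Ω₀ᶜ.indicator 1 (Y τ x) - ρ₀ x * Ω₀ᶜ.indicator 1 (Y 0 x)))) := by
    refine tendsto_integral_filter_of_dominated_convergence (fun x => |ρ τ x| + |ρ₀ x|) ?_ ?_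
      ((hρ_int τ hτ).abs.add hρ₀B.abs) ?_
    · refine Eventually.of_forall fun ξ => ?_
      have hc : ∀ t, Continuous fun x => (P.cutoff ξ ∘ Function.uncurry Y) (t, x) := fun t =>
        (hφ ξ).continuous.comp (continuous_const.prodMk continuous_id)
      exact ((hρ_int τ hτ).1.mul (hc τ).aestronglyMeasurable).sub
        (hρ₀B.1.mul (hc 0).aestronglyMeasurable)
    · filter_upwards [self_mem_nhdsWithin] with ξ hξ
      refine Eventually.of_forall fun x => (norm_sub_le _ _).trans ?_
      rw [Real.norm_eq_abs, Real.norm_eq_abs, abs_mul, abs_mul]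
      exact add_le_add (mul_le_of_le_one_right (abs_nonneg _) (P.abs_cutoff_le_one hξ _))
        (mul_le_of_le_one_right (abs_nonneg _) (P.abs_cutoff_le_one hξ _))
    · exact Eventually.of_forall fun x => ((hpt (Y τ x)).const_mul _).sub ((hpt (Y 0 x)).const_mul _)
  have hzero : ∀ᵐ x ∂(volume.restrict B), ρ₀ x * Ω₀ᶜ.indicator 1 (Y 0 x) = 0 := by
    rw [sdiff_eq, inter_comm, ← Measure.restrict_restrict hΩ₀.isOpen.measurableSet.compl,
      ae_restrict_iff' hΩ₀.isOpen.measurableSet.compl] at hρ₀_zero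
    filter_upwards [hρ₀_zero] with x hx
    rw [hY0]
    by_cases hxΩ : x ∈ Ω₀
    · simp [hxΩ]
    · rw [hx hxΩ, zero_mul]
  have hint : ∫ x in B, ρ τ x * Ω₀ᶜ.indicator 1 (Y τ x) = 0 := by
    rw [← tendsto_nhds_unique hlim' hlim]
    refine integral_congr_ae ?_
    filter_upwards [hzero] with x hx
    rw [hx, sub_zero]
  have hind : ∀ x, ρ τ x * Ω₀ᶜ.indicator 1 (Y τ x) = (Y τ ⁻¹' Ω₀)ᶜ.indicator (ρ τ) x := by
    intro x
    by_cases hx : Y τ x ∈ Ω₀ <;> simp [hx]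
  simp only [hind] at hint
  -- A nonnegative function with zero integral over `B` vanishes almost everywhere; the function is
  -- `ρ τ` cut off to the complement of `X τ '' Ω₀`.
  rw [integral_eq_zero_iff_of_nonneg_ae ?_ ((hρ_int τ hτ).indicator hmeas.compl)] at hint
  · rw [(hY.isRegularChange hτ).image_eq_preimage, sdiff_eq, inter_comm,
      ← Measure.restrict_restrict hmeas.compl, ae_restrict_iff' hmeas.compl]
    filter_upwards [hint] with x hx hxY
    rwa [indicator_of_mem hxY] at hx
  · filter_upwards [hnonneg] with x hx
    exact indicator_nonneg (fun _ _ => hx) x
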